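/- **Setting.** Let $d\in\mathbb N=\{0,1,2,\dots\}$ and let $E$ be a sequentially complete locally convex Hausdorff space over $\mathbb C$. Let $\operatorname{csn}(E)$ be the set of continuous seminorms on $E$ and $\mathfrak B(E)$ the family of non-empty absolutely convex closed bounded subsets of $E$. For $B\in\mathfrak B(E)$ let $E_B$ be the linear span of $B$, normed by the Minkowski functional of $B$. A *representation* of $(\mathbb R^d,+)$ on $E$ is a group homomorphism $\pi$ from $(\mathbb R^d,+)$ to the group of topological linear automorphisms of $E$ such that $(x,e)\mapsto\pi(x)e$ is separately continuous; write $\gamma_e(x)=\pi(x)e$. It is a *projective generalized proto-Banach representation* if for every $p\in\operatorname{csn}(E)$ there are $q\in\operatorname{csn}(E)$ and $\kappa>0$ with $p(\pi(x)e)\le e^{\kappa|x|}q(e)$ for all $x\in\mathbb R^d$, $e\in E$. It is an *inductive generalized proto-Banach representation* if for every $B\in\mathfrak B(E)$ there are $A\in\mathfrak B(E)$ and $\kappa>0$ such that $\pi(x)e\in E_A$ and $\|\pi(x)e\|_{E_A}\le e^{\kappa|x|}\|e\|_{E_B}$ for all $x\in\mathbb R^d$, $e\in E_B$. A *weight sequence*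 is a sequence $M=(M_p)_{p\in\mathbb N}$ of positive numbers with $M_0=M_1=1$, $M_p^{1/p}\to\infty$ and $M_p^2\le M_{p-1}M_{p+1}$ for $p\ge1$. Put $m_p=M_p/M_{p-1}$ for $p\ge 1$ and $M_\alpha=M_{|\alpha|}$ for $\alpha\in\mathbb N^d$, and consider * $(M.2)$: there are $C_0,H\ge1$ with $M_{p+q}\le C_0H^{p+q}M_pM_q$ for all $p,q\in\mathbb N$; * $(M.2)^*$: there are integers $p_0,N\ge1$ with $2m_p\le m_{Np}$ for all $p\ge p_0$. Let $\mathfrak R$ be the set of non-decreasing sequences $r=(r_j)_{j\in\mathbb N}$ of positive numbers with $r_0=r_1=1$ and $r_j\to\infty$. For a normed space $F$, $\mathcal E^{(M)}(\mathbb R^d;F)$ (respectively $\mathcal E^{\{M\}}(\mathbb R^d;F)$) is the space of all $\varphi\in C^\infty(\mathbb R^d;F)$ for which all the seminorms $$\sup_{\alpha\in\mathbb N^d}\sup_{x\in K}\frac{h^{|\alpha|}p(\partial^\alpha\varphi(x))}{M_\alpha}\qquad\Big(\text{respectively}\quad \sup_{\alpha\in\mathbb N^d}\sup_{x\in K}\frac{p(\partial^\alpha\varphi(x))}{M_\alpha\prod_{j=0}^{|\alpha|}r_j}\Big)$$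 are finite, where $K\subset\mathbb R^d$ is compact, $p\in\operatorname{csn}(F)$, and $h>0$ (respectively $r\in\mathfrak R$); these seminorms define its topology. Below, $[M]$ stands for $(M)$ (Beurling case) throughout or for $\{M\}$ (Roumieu case) throughout. Let $E^{[M]}$ be the set of all $e\in E$ such that $\gamma_e\in\mathcal E^{[M]}(\mathbb R^d;E_B)$ for some $B\in\mathfrak B(E)$. A set $\widetilde B\subseteq E^{[M]}$ is called *bounded* if there is $B\in\mathfrak B(E)$ such that $\{\gamma_e: e\in\widetilde B\}$ is contained and bounded in $\mathcal E^{[M]}(\mathbb R^d;E_B)$. Let $C_{\exp}(\mathbb R^d)$ be the set of continuous $f:\mathbb R^d\to\mathbb C$ with $\sup_x|f(x)|e^{n|x|}<\infty$ for all $n\in\mathbb N$. For $h>0$ let $\mathcal K^{M,h}(\mathbb R^d)$ be the set of all $\varphi\in C^\infty(\mathbb R^d)$ with $\sup_{\alpha}\sup_{x}h^{|\alpha|}|\partial^\alpha\varphi(x)|e^{n|x|}/M_\alpha<\infty$ for all $n\in\mathbb N$, and put $\mathcal K^{(M)}(\mathbb R^d)=\bigcap_{h>0}\mathcal K^{M,h}(\mathbb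 R^d)$ and $\mathcal K^{\{M\}}(\mathbb R^d)=\bigcup_{h>0}\mathcal K^{M,h}(\mathbb R^d)$. **Theorem (factorization).** Let $\pi$ be a projective or an inductive generalized proto-Banach representation of $(\mathbb R^d,+)$ on the sequentially complete locally convex Hausdorff space $E$, and let $M$ be a weight sequence satisfying $(M.2)$ and $(M.2)^*$. For all $f\in C_{\exp}(\mathbb R^d)$ and $e\in E$ the weak integral $$\Pi(f)e=\int_{\mathbb R^d}f(x)\,\pi(x)e\,\mathrm dx\in E$$ exists, and, in the Beurling case as well as in the Roumieu case, $$\Pi(\mathcal K^{[M]}(\mathbb R^d))E=\Pi(\mathcal K^{[M]}(\mathbb R^d))E^{[M]}=E^{[M]},$$ where $\Pi(\mathcal K)S=\{\Pi(\psi)e:\psi\in\mathcal K,\ e\in S\}$. Moreover, for every bounded set $\widetilde B\subseteq E^{[M]}$ there are $\psi\in\mathcal K^{[M]}(\mathbb R^d)$ and a bounded set $\widetilde A\subseteq E^{[M]}$ such that $\Pi(\psi)\widetilde A=\widetilde B$. -/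

import Mathlib

open Filter Topology MeasureTheory
open scoped ContDiff Pointwise

namespace UltraVectors

/-! ### Sequential completeness, bounded disks and the normed spaces they span -/

/-- Every Cauchy sequence of the topological abelian group `E` converges. -/
def IsSequentiallyComplete (E : Type*) [AddCommGroup E] [TopologicalSpace E] : Prop :=
  ∀ u : ℕ → E, (∀ U ∈ 𝓝 (0 : E), ∃ N : ℕ, ∀ m ≥ N, ∀ n ≥ N, u m - u n ∈ U) →
    ∃ a : E, Tendsto u atTop (𝓝 a)

/-- The family `𝔅(E)` of non-empty absolutely convex closed bounded subsets of `E`. -/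
structure BoundedDisk (E : Type*) [AddCommGroup E] [Module ℂ E] [TopologicalSpace E] where
  carrier : Set E
  nonempty : carrier.Nonempty
  balanced : Balanced ℂ carrier
  convex : Convex ℝ carrier
  isClosed : IsClosed carrier
  bounded : Bornology.IsVonNBounded ℂ carrier

/-- The space `E_B`: the linear span of the bounded disk `B`. Its norm, introduced below, is the
Minkowski functional of `B`; it does not carry the topology of `E`. -/
def BoundedDisk.Space {E : Type*} [AddCommGroup E] [Module ℂ E] [TopologicalSpace E]
    (B : BoundedDisk E) : Type _ :=
  Submodule.span ℂ B.carrier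

section DiskSpace

variable {E : Type*} [AddCommGroup E] [Module ℂ E] [TopologicalSpace E] (B : BoundedDisk E)

/-- The underlying vector of `E`. -/
def BoundedDisk.Space.val {B : BoundedDisk E} (x : B.Space) : E := Subtype.val x

instance : AddCommGroup B.Space :=
  inferInstanceAs (AddCommGroup (Submodule.span ℂ B.carrier))

instance : Module ℂ B.Space :=
  inferInstanceAs (Module ℂ (Submodule.span ℂ B.carrier))

noncomputable instance : Norm B.Space := ⟨fun x => gauge B.carrier x.val⟩

theorem BoundedDisk.norm_def (x : B.Space) : ‖x‖ = gauge B.carrier x.val := rfl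

theorem BoundedDisk.exists_mem_smul {x : E} (hx : x ∈ Submodule.span ℂ B.carrier) :
    ∃ r : ℝ, 0 < r ∧ x ∈ r • B.carrier := by
  have key : ∀ (c : ℂ) (r : ℝ), ‖c‖ ≤ r → c • B.carrier ⊆ r • B.carrier := by
    intro c r h
    have hr : r • B.carrier = (r : ℂ) • B.carrier := by
      ext y; simp [Set.mem_smul_set]
    rw [hr]
    apply B.balanced.smul_mono
    simpa using h.trans (le_abs_self r)
  induction hx using Submodule.span_induction with
  | mem x h => exact ⟨1, one_pos, by simpa using h⟩
  | zero =>
    refine ⟨1, one_pos, ?_⟩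
    simpa using B.balanced.zero_mem B.nonempty
  | add x y _ _ hx hy =>
    obtain ⟨r, hr, hx⟩ := hx
    obtain ⟨s, hs, hy⟩ := hy
    refine ⟨r + s, by positivity, ?_⟩
    rw [B.convex.add_smul hr.le hs.le]
    exact Set.add_mem_add hx hy
  | smul a x _ hx =>
    obtain ⟨r, hr, b, hb, rfl⟩ := hx
    refine ⟨(‖a‖ + 1) * r, by positivity, key (a * r) _ ?_ ⟨b, hb, ?_⟩⟩
    · rw [norm_mul, Complex.norm_real, Real.norm_of_nonneg hr.le]
      nlinarith [norm_nonneg a]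
    · simp [mul_smul]

theorem BoundedDisk.absorbent_preimage :
    Absorbent ℝ {x : B.Space | x.val ∈ B.carrier} := by
  intro x
  obtain ⟨r, hr, b, hb, hx⟩ := B.exists_mem_smul x.2
  have hx' : r • b = x.val := hx
  change ∀ᶠ a in Bornology.cobounded ℝ, _
  filter_upwards [eventually_cobounded_le_norm r] with a ha
  have ha0 : a ≠ 0 := by
    rintro rfl
    simp at ha
    linarith
  rw [Set.singleton_subset_iff, Set.mem_smul_set_iff_inv_smul_mem₀ ha0]
  change a⁻¹ • x.val ∈ B.carrier
  rw [← hx', smul_smul]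
  have : (a⁻¹ * r) • b = ((a⁻¹ * r : ℝ) : ℂ) • b := (Complex.coe_smul _ _).symm
  rw [this]
  apply B.balanced.smul_mem _ hb
  rw [Complex.norm_real, norm_mul, norm_inv, Real.norm_of_nonneg hr.le]
  exact inv_mul_le_one_of_le₀ ha (norm_nonneg a)

theorem BoundedDisk.norm_eq_gauge_preimage (x : B.Space) :
    ‖x‖ = gauge {x : B.Space | x.val ∈ B.carrier} x := by
  rw [B.norm_def]
  simp only [gauge_def']
  rfl

theorem BoundedDisk.norm_core [T1Space E] : NormedSpace.Core ℂ B.Space where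
  norm_nonneg x := gauge_nonneg _
  norm_smul c x := by
    change gauge B.carrier (c • x.val) = ‖c‖ * gauge B.carrier x.val
    exact gauge_smul B.balanced c x.val
  norm_triangle x y := by
    simp only [B.norm_eq_gauge_preimage]
    refine gauge_add_le ?_ B.absorbent_preimage x y
    exact B.convex.is_linear_preimage ⟨fun _ _ => rfl, fun _ _ => rfl⟩
  norm_eq_zero_iff x := by
    constructor
    · intro h
      by_contra hne
      have hx0 : x.val ≠ 0 := fun h0 => hne (Subtype.ext h0)
      have hU : ({x.val}ᶜ : Set E) ∈ 𝓝 (0 : E) := isOpen_compl_singleton.mem_nhds hx0.symm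
      obtain ⟨R, hR, hRU⟩ := (B.bounded hU).exists_pos
      have hlt : gauge B.carrier x.val < R⁻¹ := by
        rw [← B.norm_def, h]; positivity
      obtain ⟨r, ⟨hr0, hr⟩, hrR⟩ := exists_lt_of_csInf_lt (B.exists_mem_smul x.2) hlt
      obtain ⟨b, hb, hbx⟩ := hr
      have hmem := hRU ((r⁻¹ : ℝ) : ℂ) (by
        rw [Complex.norm_real, Real.norm_of_nonneg (by positivity)]
        exact ((lt_inv_comm₀ hr0 hR).1 hrR).le) hb
      obtain ⟨u, hu, hub⟩ := hmem
      apply hu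
      have h2 : r • b = x.val := hbx
      have h3 : ((r⁻¹ : ℝ) : ℂ) • u = b := hub
      rw [Set.mem_singleton_iff, ← h2, ← h3, Complex.coe_smul, smul_smul,
        mul_inv_cancel₀ hr0.ne', one_smul]
    · rintro rfl
      exact gauge_zero

noncomputable instance [T1Space E] : NormedAddCommGroup B.Space :=
  NormedAddCommGroup.ofCore B.norm_core

noncomputable instance [T1Space E] : NormedSpace ℂ B.Space :=
  NormedSpace.ofCore B.norm_core

end DiskSpace

/-! ### Weight sequences -/

/-- Weight sequences: positive, normalized, log-convex, with `M_p ^ (1/p) → ∞`. -/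
structure IsWeightSequence (M : ℕ → ℝ) : Prop where
  pos : ∀ p, 0 < M p
  zero : M 0 = 1
  one : M 1 = 1
  tendsto : Tendsto (fun p : ℕ => M p ^ (1 / (p : ℝ))) atTop atTop
  logConvex : ∀ p, M (p + 1) ^ 2 ≤ M p * M (p + 2)

/-- Condition `(M.2)`. -/
def CondM2 (M : ℕ → ℝ) : Prop :=
  ∃ C₀ H : ℝ, 1 ≤ C₀ ∧ 1 ≤ H ∧ ∀ p q : ℕ, M (p + q) ≤ C₀ * H ^ (p + q) * M p * M q

/-- The quotients `m_p = M_p / M_{p-1}`, for `p ≥ 1` (not used for `p = 0`). -/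
noncomputable def quotSeq (M : ℕ → ℝ) (p : ℕ) : ℝ := M p / M (p - 1)

/-- Condition `(M.2)^*`. -/
def CondM2Star (M : ℕ → ℝ) : Prop :=
  ∃ p₀ N : ℕ, 1 ≤ p₀ ∧ 1 ≤ N ∧ ∀ p ≥ p₀, 2 * quotSeq M p ≤ quotSeq M (N * p)

/-- The set `ℜ` of non-decreasing sequences of positive numbers with `r_0 = r_1 = 1` that tend
to infinity. -/
structure IsRSequence (r : ℕ → ℝ) : Prop where
  pos : ∀ j, 0 < r j
  zero : r 0 = 1
  one : r 1 = 1
  mono : Monotone r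
  tendsto : Tendsto r atTop atTop

/-- The two types of ultradifferentiability: `(M)` and `{M}`. -/
inductive UltraType
  | beurling
  | roumieu

/-! ### Partial derivatives and ultradifferentiable functions -/

/-- The partial derivative `∂_i f`. -/
noncomputable def partialDeriv {d : ℕ} {F : Type*} [NormedAddCommGroup F] [NormedSpace ℝ F]
    (i : Fin d) (f : EuclideanSpace ℝ (Fin d) → F) : EuclideanSpace ℝ (Fin d) → F :=
  fun x => lineDeriv ℝ f x (EuclideanSpace.single i 1)

/-- The iterated partial derivative `∂^α f = ∂_1^{α_1} ⋯ ∂_d^{α_d} f`. -/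
noncomputable def multiDeriv {d : ℕ} {F : Type*} [NormedAddCommGroup F] [NormedSpace ℝ F]
    (α : Fin d → ℕ) (f : EuclideanSpace ℝ (Fin d) → F) : EuclideanSpace ℝ (Fin d) → F :=
  (List.finRange d).foldr (fun i g => (partialDeriv i)^[α i] g) f

/-- The length `|α|` of a multi-index. -/
def multiLength {d : ℕ} (α : Fin d → ℕ) : ℕ := ∑ i, α i

/-- `𝓑` is a bounded subset of `ℰ^{[M]}(ℝ^d; F)` for the normed space `F`: its elements are smooth,
and each of the seminorms that define the space is bounded on `𝓑`. In the Beurling case these are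
`sup_α sup_{x ∈ K} h^{|α|} p(∂^α f(x)) / M_α`, and in the Roumieu case
`sup_α sup_{x ∈ K} p(∂^α f(x)) / (M_α r_0 ⋯ r_{|α|})`, for compact `K`, continuous seminorms `p`
on `F`, and `h > 0`, respectively `r ∈ ℜ`. -/
def IsBoundedInUltra (t : UltraType) (M : ℕ → ℝ) {d : ℕ} {F : Type*} [NormedAddCommGroup F]
    [NormedSpace ℂ F] (𝓑 : Set (EuclideanSpace ℝ (Fin d) → F)) : Prop :=
  (∀ f ∈ 𝓑, ContDiff ℝ ∞ f) ∧
  match t with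
  | .beurling =>
      ∀ K : Set (EuclideanSpace ℝ (Fin d)), IsCompact K → ∀ h : ℝ, 0 < h →
        ∀ p : Seminorm ℂ F, Continuous p → ∃ C : ℝ, ∀ f ∈ 𝓑, ∀ α : Fin d → ℕ, ∀ x ∈ K,
          h ^ multiLength α * p (multiDeriv α f x) / M (multiLength α) ≤ C
  | .roumieu =>
      ∀ K : Set (EuclideanSpace ℝ (Fin d)), IsCompact K → ∀ r : ℕ → ℝ, IsRSequence r →
        ∀ p : Seminorm ℂ F, Continuous p → ∃ C : ℝ, ∀ f ∈ 𝓑, ∀ α : Fin d → ℕ, ∀ x ∈ K,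
          p (multiDeriv α f x) /
            (M (multiLength α) * ∏ j ∈ Finset.range (multiLength α + 1), r j) ≤ C

/-- The space `ℰ^{[M]}(ℝ^d; F)` for a normed space `F`. -/
def UltraFunctions (t : UltraType) (M : ℕ → ℝ) (d : ℕ) (F : Type*) [NormedAddCommGroup F]
    [NormedSpace ℂ F] : Set (EuclideanSpace ℝ (Fin d) → F) :=
  {f | IsBoundedInUltra t M {f}}

/-- The space `C_exp(ℝ^d)`. -/
def CExp (d : ℕ) : Set (EuclideanSpace ℝ (Fin d) → ℂ) :=
  {f | Continuous f ∧ ∀ n : ℕ, ∃ C : ℝ, ∀ x, ‖f x‖ * Real.exp (n * ‖x‖) ≤ C}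

/-- The space `𝒦^{M,h}(ℝ^d)`. -/
def KSpaceH (M : ℕ → ℝ) (h : ℝ) (d : ℕ) : Set (EuclideanSpace ℝ (Fin d) → ℂ) :=
  {φ | ContDiff ℝ ∞ φ ∧ ∀ n : ℕ, ∃ C : ℝ, ∀ (α : Fin d → ℕ) (x : EuclideanSpace ℝ (Fin d)),
    h ^ multiLength α * ‖multiDeriv α φ x‖ * Real.exp (n * ‖x‖) / M (multiLength α) ≤ C}

/-- The space `𝒦^{[M]}(ℝ^d)`: the intersection of all `𝒦^{M,h}(ℝ^d)`, `h > 0`, in the Beurling case,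
and their union in the Roumieu case. -/
def KSpace (t : UltraType) (M : ℕ → ℝ) (d : ℕ) : Set (EuclideanSpace ℝ (Fin d) → ℂ) :=
  match t with
  | .beurling => {φ | ∀ h : ℝ, 0 < h → φ ∈ KSpaceH M h d}
  | .roumieu => {φ | ∃ h : ℝ, 0 < h ∧ φ ∈ KSpaceH M h d}

/-! ### Representations of `(ℝ^d, +)` -/

/-- A representation of `(ℝ^d, +)` on `E`: a group homomorphism into the group of topological linear
automorphisms of `E` whose orbit mappings are continuous. (Each `π(x)` is continuous as an element
of `GL(E)`, so this says that the action is separately continuous.) -/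
structure Representation (d : ℕ) (E : Type*) [AddCommGroup E] [Module ℂ E]
    [TopologicalSpace E] where
  toHom : Multiplicative (EuclideanSpace ℝ (Fin d)) →* (E ≃L[ℂ] E)
  continuous_orbit : ∀ e : E, Continuous fun x => toHom (Multiplicative.ofAdd x) e

section Representations

variable {d : ℕ} {E : Type*} [AddCommGroup E] [Module ℂ E] [TopologicalSpace E]

/-- The orbit mapping `γ_e(x) = π(x) e`. -/
def Representation.orbit (π : Representation d E) (e : E) (x : EuclideanSpace ℝ (Fin d)) : E :=
  π.toHom (Multiplicative.ofAdd x) e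

/-- Projective generalized proto-Banach representations. -/
def Representation.IsProjective (π : Representation d E) : Prop :=
  ∀ p : Seminorm ℂ E, Continuous p → ∃ q : Seminorm ℂ E, Continuous q ∧ ∃ κ : ℝ, 0 < κ ∧
    ∀ (x : EuclideanSpace ℝ (Fin d)) (e : E), p (π.orbit e x) ≤ Real.exp (κ * ‖x‖) * q e

/-- Inductive generalized proto-Banach representations: every bounded disk `B` has a bounded disk
`A` and `κ > 0` such that `π(x)` maps `E_B` into `E_A` with norm at most `e^{κ|x|}`. -/
def Representation.IsInductive (π : Representation d E) : Prop :=
  ∀ B : BoundedDisk E, ∃ A : BoundedDisk E, ∃ κ : ℝ, 0 < κ ∧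
    ∀ (x : EuclideanSpace ℝ (Fin d)) (e : B.Space),
      ∃ a : A.Space, a.val = π.orbit e.val x ∧ ‖a‖ ≤ Real.exp (κ * ‖x‖) * ‖e‖

/-- The orbit mappings of the vectors in `S`, viewed as mappings into `E_B`. -/
def Representation.orbitsIn (π : Representation d E) (B : BoundedDisk E) (S : Set E) :
    Set (EuclideanSpace ℝ (Fin d) → B.Space) :=
  {f | ∃ e ∈ S, ∀ x, (f x).val = π.orbit e x}

/-- The space `E^{[M]}` of ultradifferentiable vectors of class `[M]`: for some bounded disk `B` the
orbit mapping of the vector belongs to `ℰ^{[M]}(ℝ^d; E_B)`. -/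
def Representation.ultraVectors [T1Space E] (π : Representation d E) (t : UltraType)
    (M : ℕ → ℝ) : Set E :=
  {e | ∃ B : BoundedDisk E, ∃ f ∈ UltraFunctions t M d B.Space, ∀ x, (f x).val = π.orbit e x}

/-- The bounded sets of `E^{[M]}`: for some bounded disk `B` the orbit mappings of all the vectors
form a set that is contained and bounded in `ℰ^{[M]}(ℝ^d; E_B)`. -/
def Representation.IsBoundedUltra [T1Space E] (π : Representation d E) (t : UltraType)
    (M : ℕ → ℝ) (S : Set E) : Prop :=
  ∃ B : BoundedDisk E,
    (∀ e ∈ S, ∃ f : EuclideanSpace ℝ (Fin d) → B.Space, ∀ x, (f x).val = π.orbit e x) ∧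
    IsBoundedInUltra t M (π.orbitsIn B S)

/-- `v` is the weak integral of `g : ℝ^d → E`. -/
def IsWeakIntegral (g : EuclideanSpace ℝ (Fin d) → E) (v : E) : Prop :=
  ∀ ℓ : E →L[ℂ] ℂ, Integrable (fun x => ℓ (g x)) ∧ ∫ x, ℓ (g x) = ℓ v

open Classical in
/-- The weak integral of `g : ℝ^d → E`. It is unique when `E` is locally convex and Hausdorff; the
value is `0` if there is none. -/
noncomputable def weakIntegral (g : EuclideanSpace ℝ (Fin d) → E) : E :=
  if h : ∃ v, IsWeakIntegral g v then h.choose else 0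

/-- The operator `Π(f) e = ∫ f(x) π(x) e dx`, a weak integral. -/
noncomputable def Representation.bigPi (π : Representation d E)
    (f : EuclideanSpace ℝ (Fin d) → ℂ) (e : E) : E :=
  weakIntegral fun x => f x • π.orbit e x

end Representations

end UltraVectors

open UltraVectors

/-! Formally, `Π(ψ)` acts on a smooth vector as the Fourier multiplier of `ψ`, with the derivatives
of the orbit in place of the frequency variable. To write `e = Π(ψ) a` one looks for an entire
function `G` such that `exp(-G)` is the Fourier transform of a test function `ψ`, and puts `a =
exp(G)(∂) e`. Two demands compete. On every strip `|Im z| < σ` the function `exp(-G)` must decay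
fast enough for its inverse Fourier transform to lie in `𝒦^{N,h}`, and `exp(G)` must grow slowly
enough for the operator of infinite order `exp(G)(∂)` to converge on vectors whose derivatives are
bounded by `C A^{|α|} N_α`.

Both are met by `G(q) = ε ∑ⱼ (1 - exp(-q τⱼ))` with `q = ∑ᵢ (2πi zᵢ)^L`, `τⱼ = (Λ νⱼ)^{-L}` and `νⱼ
= N_{j+1}/N_j`. Roughly, `G` counts the indices with `q τⱼ ≥ 1`. If `k` of them satisfy this, then
`|exp(-G)|` is at most a constant times `exp(-εk/2)`, and by `(M.2)` this beats the powers of the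
frequency, because `νₖ^n ≤ C H^{k+n} N_n` (`SymbolBound.exists_exp_gTot_bound`). In the other
direction, the exponentials of the partial sums `G_J` are dominated on strips by the polynomials
`P_J = ∏_{j<J} (1 + c τⱼ (q + R))`. Condition `(M.2)^*` makes `∑_{j≥k} τⱼ ≤ K (k+1) τₖ` for large
`L`, with `K` independent of `Λ`. A Cauchy estimate then bounds the `n`-th coefficient of `P_J`,
uniformly in `J`, by a geometric factor times `∏_{j<n} τⱼ = Λ^{-Ln} N_n^{-L}`
(`TauSeq.coeff_growPoly_mul_le`). A large `Λ` makes the series of derivatives converge.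

The vector `a` is the limit of `Π(k_J) e`, where `k_J` has the Fourier transform `exp(G_J - q τ_J)`.
Consecutive symbols differ by `P_J (q+R+1)²` times a function that is `O(τ_J)` and integrable on
planes. Integration by parts moves the polynomials to the orbit, so the differences are summable.
Moreover `exp(-G) exp(G_J - q τ_J)` differs little from `exp(-q τ_J)`, whose kernels are dilations
of one function and form an approximate identity. Hence `Π(ψ) a = e`
(`Representation.JetBound.exists_factorization`).

The Beurling and Roumieu cases are reduced to one weight `N` with one step `A`. A Roumieu bound by
all sequences of `ℜ` is a geometric bound for `N = M` (`exists_geometric_bound`). A Beurling bound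
is a bound for a regular weight `N` that is still small compared with `M`
(`RegularWeight.exists_smaller`). Projective and inductive representations enter only through
`Representation.HasExpGrowth`. Everything is estimated weakly, on scalar functions `ℓ(π(x) e)`.
Uniform Taylor estimates and the bipolar theorem bring the results back to the normed space of a
single disk (`Representation.JetBound.exists_disk`). The inclusion `Π(𝒦^{[M]})E ⊆ E^{[M]}` follows
by moving the derivatives to the test function (`Representation.exists_jetBound_bigPi`). -/

namespace UltraVectors

set_option linter.unusedSectionVars false

/-! ### Families of partial derivatives -/

section PartialFamily

variable {d : ℕ} {G : Type*} [NormedAddCommGroup G] [NormedSpace ℝ G]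

/-- The `i`-th vector of the standard basis. -/
noncomputable abbrev stdVec {d : ℕ} (i : Fin d) : EuclideanSpace ℝ (Fin d) :=
  EuclideanSpace.single i 1

/-- A family of continuous functions, indexed by multi-indices, in which `F (α + eᵢ)` is the
`i`-th partial derivative of `F α`. -/
structure IsPartialFamily (F : (Fin d → ℕ) → EuclideanSpace ℝ (Fin d) → G) : Prop where
  continuous : ∀ α, Continuous (F α)
  hasLineDerivAt : ∀ α i x, HasLineDerivAt ℝ (F α) (F (α + Pi.single i 1) x) x (stdVec i)

/-- The derivative with given partial derivatives. -/
noncomputable def gradMap (g : Fin d → G) : EuclideanSpace ℝ (Fin d) →L[ℝ] G :=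
  ∑ i, (EuclideanSpace.proj i : EuclideanSpace ℝ (Fin d) →L[ℝ] ℝ).smulRight (g i)

theorem gradMap_apply (g : Fin d → G) (h : EuclideanSpace ℝ (Fin d)) :
    gradMap g h = ∑ i, h i • g i := by
  simp [gradMap]

theorem norm_sum_single_le (s : Finset (Fin d)) (h : EuclideanSpace ℝ (Fin d)) :
    ‖∑ i ∈ s, h i • stdVec i‖ ≤ d * ‖h‖ := by
  calc ‖∑ i ∈ s, h i • stdVec i‖ ≤ ∑ i ∈ s, ‖h‖ := by
        refine norm_sum_le_of_le _ fun i _ => ?_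
        rw [norm_smul]
        simpa using PiLp.norm_apply_le h i
    _ ≤ ∑ i : Fin d, ‖h‖ := Finset.sum_le_sum_of_subset_of_nonneg (Finset.subset_univ s)
        fun _ _ _ => norm_nonneg _
    _ = d * ‖h‖ := by simp

theorem sum_single_eq (h : EuclideanSpace ℝ (Fin d)) : ∑ i, h i • stdVec i = h := by
  ext j
  simp [Pi.single_apply, Finset.sum_apply]

/-- A function with continuous partial derivatives is differentiable. -/
theorem hasFDerivAt_of_partial {f : EuclideanSpace ℝ (Fin d) → G}
    {f' : Fin d → EuclideanSpace ℝ (Fin d) → G} (hc : ∀ i, Continuous (f' i))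
    (hf : ∀ i x, HasLineDerivAt ℝ f (f' i x) x (stdVec i)) (x : EuclideanSpace ℝ (Fin d)) :
    HasFDerivAt f (gradMap fun i => f' i x) x := by
  -- The coordinates of the increment are switched on one at a time. Each stage is a mean value
  -- estimate along one coordinate direction and uses only the continuity at `x` of the
  -- corresponding partial derivative.
  have main : ∀ s : Finset (Fin d),
      (fun h : EuclideanSpace ℝ (Fin d) => f (x + ∑ i ∈ s, h i • stdVec i) - f x -
        ∑ i ∈ s, h i • f' i x) =o[𝓝 0] fun h => h := by
    intro s
    induction s using Finset.induction_on with
    | empty => simp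
    | insert j s hj ih =>
      have step : (fun h : EuclideanSpace ℝ (Fin d) =>
          f (x + ∑ i ∈ s, h i • stdVec i + h j • stdVec j) - f (x + ∑ i ∈ s, h i • stdVec i) -
            h j • f' j x) =o[𝓝 0] fun h => h := by
        rw [Asymptotics.isLittleO_iff]
        intro ε hε
        obtain ⟨δ, hδ, hδ'⟩ := Metric.continuousAt_iff.1 ((hc j).continuousAt (x := x)) ε hε
        have hd : (0 : ℝ) < d + 1 := by positivity
        filter_upwards [Metric.ball_mem_nhds (0 : EuclideanSpace ℝ (Fin d)) (div_pos hδ hd)]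
          with h hh
        rw [mem_ball_zero_iff, lt_div_iff₀ hd] at hh
        set y := x + ∑ i ∈ s, h i • stdVec i with hy
        have hderiv : ∀ t : ℝ, HasDerivAt (fun t : ℝ => f (y + t • stdVec j) - t • f' j x)
            (f' j (y + t • stdVec j) - f' j x) t := by
          intro t
          have h1 := hf j (y + t • stdVec j)
          unfold HasLineDerivAt at h1
          have h2 : HasDerivAt (fun s : ℝ => f (y + s • stdVec j)) (f' j (y + t • stdVec j)) t := by
            have h3 := HasDerivAt.scomp_of_eq (g₁ := fun s : ℝ => f (y + t • stdVec j + s • stdVec j))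
              (h := fun s : ℝ => s - t) (x := t) (h' := 1) h1 ((hasDerivAt_id t).sub_const t)
              (by simp)
            refine (h3.congr_deriv (by simp)).congr_of_eventuallyEq (Eventually.of_forall fun s => ?_)
            simp only [Function.comp]
            rw [show y + t • stdVec j + (s - t) • stdVec j = y + s • stdVec j by module]
          simpa using h2.fun_sub (HasDerivAt.smul_const (hasDerivAt_id' t) (f' j x))
        have hb := (convex_segment (𝕜 := ℝ) (0 : ℝ) (h j)).norm_image_sub_le_of_norm_hasDerivWithin_le
          (f := fun t : ℝ => f (y + t • stdVec j) - t • f' j x)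
          (f' := fun t => f' j (y + t • stdVec j) - f' j x) (C := ε)
          (fun t _ => (hderiv t).hasDerivWithinAt) (fun t ht => ?_)
          (left_mem_segment _ _ _) (right_mem_segment _ _ _)
        · simp only [zero_smul, add_zero, sub_zero] at hb
          have e : f (y + h j • stdVec j) - f y - h j • f' j x =
            f (y + h j • stdVec j) - h j • f' j x - f y := by abel
          rw [e]
          refine hb.trans (mul_le_mul_of_nonneg_left ?_ hε.le)
          exact PiLp.norm_apply_le h j
        · rw [← dist_eq_norm]
          refine (hδ' ?_).le
          rw [dist_eq_norm, hy, add_assoc, add_sub_cancel_left]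
          have ht' : ‖t‖ ≤ ‖h j‖ := by
            rw [segment_eq_uIcc] at ht
            simpa using Set.abs_sub_left_of_mem_uIcc ht
          calc ‖∑ i ∈ s, h i • stdVec i + t • stdVec j‖ ≤ d * ‖h‖ + ‖h‖ := by
                refine (norm_add_le _ _).trans (add_le_add (norm_sum_single_le s h) ?_)
                rw [norm_smul]
                simpa using ht'.trans (PiLp.norm_apply_le h j)
            _ = ‖h‖ * (d + 1) := by ring
            _ < δ := hh
      refine (step.add ih).congr_left fun h => ?_
      rw [Finset.sum_insert hj, Finset.sum_insert hj, ← add_assoc, add_right_comm]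
      abel_nf
  rw [hasFDerivAt_iff_isLittleO_nhds_zero]
  refine (main Finset.univ).congr_left fun h => ?_
  rw [sum_single_eq, gradMap_apply]

theorem IsPartialFamily.hasFDerivAt {F : (Fin d → ℕ) → EuclideanSpace ℝ (Fin d) → G}
    (hF : IsPartialFamily F) (α : Fin d → ℕ) (x : EuclideanSpace ℝ (Fin d)) :
    HasFDerivAt (F α) (gradMap fun i => F (α + Pi.single i 1) x) x :=
  hasFDerivAt_of_partial (fun i => hF.continuous _) (fun i x => hF.hasLineDerivAt α i x) x

theorem IsPartialFamily.contDiff {F : (Fin d → ℕ) → EuclideanSpace ℝ (Fin d) → G}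
    (hF : IsPartialFamily F) (α : Fin d → ℕ) : ContDiff ℝ ∞ (F α) := by
  rw [contDiff_infty]
  intro n
  induction n generalizing α with
  | zero => exact contDiff_zero.2 (hF.continuous α)
  | succ n ih =>
    refine (contDiff_succ_iff_hasFDerivAt (n := n)).2 ⟨_, ?_, hF.hasFDerivAt α⟩
    unfold gradMap
    refine ContDiff.sum fun _ _ => ?_
    exact contDiff_const.smulRight (ih _)

theorem IsPartialFamily.partialDeriv_eq {F : (Fin d → ℕ) → EuclideanSpace ℝ (Fin d) → G}
    (hF : IsPartialFamily F) (α : Fin d → ℕ) (i : Fin d) :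
    partialDeriv i (F α) = F (α + Pi.single i 1) :=
  funext fun x => (hF.hasLineDerivAt α i x).lineDeriv

theorem IsPartialFamily.iterate_partialDeriv {F : (Fin d → ℕ) → EuclideanSpace ℝ (Fin d) → G}
    (hF : IsPartialFamily F) (i : Fin d) (n : ℕ) (α : Fin d → ℕ) :
    (partialDeriv i)^[n] (F α) = F (α + Pi.single i n) := by
  induction n generalizing α with
  | zero => simp
  | succ n ih =>
    rw [Function.iterate_succ_apply, hF.partialDeriv_eq, ih, add_assoc, ← Pi.single_add, add_comm 1 n]

theorem IsPartialFamily.multiDeriv_eq {F : (Fin d → ℕ) → EuclideanSpace ℝ (Fin d) → G}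
    (hF : IsPartialFamily F) (α : Fin d → ℕ) : multiDeriv α (F 0) = F α := by
  have key : ∀ l : List (Fin d), l.foldr (fun i g => (partialDeriv i)^[α i] g) (F 0) =
      F ((l.map fun i => Pi.single i (α i)).sum) := by
    intro l
    induction l with
    | nil => simp
    | cons i l ih =>
      rw [List.foldr_cons, ih, hF.iterate_partialDeriv, List.map_cons, List.sum_cons, add_comm]
  rw [multiDeriv, key]
  congr 1
  rw [← Fin.sum_univ_def]
  exact Finset.univ_sum_single α

theorem partialDeriv_eq_fderiv {f : EuclideanSpace ℝ (Fin d) → G} (hf : ContDiff ℝ ∞ f)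
    (i : Fin d) : partialDeriv i f = fun x => fderiv ℝ f x (stdVec i) :=
  funext fun x => ((hf.differentiable (by simp)) x).lineDeriv_eq_fderiv

theorem contDiff_partialDeriv {f : EuclideanSpace ℝ (Fin d) → G} (hf : ContDiff ℝ ∞ f)
    (i : Fin d) : ContDiff ℝ ∞ (partialDeriv i f) := by
  rw [partialDeriv_eq_fderiv hf]
  exact (hf.fderiv_right (m := ∞) (by simp)).clm_apply contDiff_const

theorem partialDeriv_comm {f : EuclideanSpace ℝ (Fin d) → G} (hf : ContDiff ℝ ∞ f)
    (i j : Fin d) : partialDeriv i (partialDeriv j f) = partialDeriv j (partialDeriv i f) := by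
  have h : ∀ i j, partialDeriv i (partialDeriv j f) = fun x =>
      fderiv ℝ (fderiv ℝ f) x (stdVec i) (stdVec j) := by
    intro i j
    rw [partialDeriv_eq_fderiv (contDiff_partialDeriv hf j), partialDeriv_eq_fderiv hf]
    funext x
    have hd : DifferentiableAt ℝ (fderiv ℝ f) x :=
      ((hf.fderiv_right (m := ∞) (by simp)).differentiable (by simp)) x
    have h2 := hd.hasFDerivAt.clm_apply (hasFDerivAt_const (stdVec j) x)
    rw [h2.fderiv]
    simp
  rw [h, h]
  funext x
  exact (hf.contDiffAt.isSymmSndFDerivAt (by simpa using WithTop.coe_le_coe.2 (le_top : (2 : ℕ∞) ≤ ⊤))) _ _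

theorem contDiff_iterate_partialDeriv {f : EuclideanSpace ℝ (Fin d) → G} (hf : ContDiff ℝ ∞ f)
    (i : Fin d) (n : ℕ) : ContDiff ℝ ∞ ((partialDeriv i)^[n] f) := by
  induction n with
  | zero => exact hf
  | succ n ih => rw [Function.iterate_succ_apply']; exact contDiff_partialDeriv ih i

theorem partialDeriv_iterate_comm {f : EuclideanSpace ℝ (Fin d) → G} (hf : ContDiff ℝ ∞ f)
    (i j : Fin d) (n : ℕ) :
    partialDeriv i ((partialDeriv j)^[n] f) = (partialDeriv j)^[n] (partialDeriv i f) := by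
  induction n with
  | zero => rfl
  | succ n ih =>
    rw [Function.iterate_succ_apply', Function.iterate_succ_apply',
      partialDeriv_comm (contDiff_iterate_partialDeriv hf j n), ih]

theorem isPartialFamily_multiDeriv {f : EuclideanSpace ℝ (Fin d) → G} (hf : ContDiff ℝ ∞ f) :
    IsPartialFamily fun α => multiDeriv α f := by
  have hs : ∀ (l : List (Fin d)) (α : Fin d → ℕ),
      ContDiff ℝ ∞ (l.foldr (fun i g => (partialDeriv i)^[α i] g) f) := by
    intro l α
    induction l with
    | nil => exact hf
    | cons i l ih => exact contDiff_iterate_partialDeriv ih i _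
  have hcongr : ∀ (l : List (Fin d)) (α β : Fin d → ℕ), (∀ j ∈ l, α j = β j) →
      l.foldr (fun i g => (partialDeriv i)^[α i] g) f =
        l.foldr (fun i g => (partialDeriv i)^[β i] g) f := by
    intro l α β h
    induction l with
    | nil => rfl
    | cons j l ih =>
      rw [List.foldr_cons, List.foldr_cons, ih fun k hk => h k (List.mem_cons_of_mem _ hk),
        h j List.mem_cons_self]
  -- The extra derivative commutes through the fold until it meets its own index. Since the list has
  -- no repetitions, exactly one exponent is raised.
  have hd : ∀ (l : List (Fin d)) (α : Fin d → ℕ) (i : Fin d), i ∈ l → l.Nodup →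
      partialDeriv i (l.foldr (fun i g => (partialDeriv i)^[α i] g) f) =
        l.foldr (fun j g => (partialDeriv j)^[(α + Pi.single i 1 : Fin d → ℕ) j] g) f := by
    intro l α i hi hl
    induction l with
    | nil => simp at hi
    | cons j l ih =>
      rw [List.nodup_cons] at hl
      rw [List.foldr_cons, List.foldr_cons]
      by_cases hij : i = j
      · subst hij
        rw [← Function.iterate_succ_apply' (partialDeriv i)]
        rw [hcongr l (α + Pi.single i 1) α]
        · simp
        · intro k hk
          have : k ≠ i := fun h => hl.1 (h ▸ hk)
          simp [this]
      · rw [partialDeriv_iterate_comm (hs l α), ih (by simpa [hij] using hi) hl.2]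
        simp [Pi.single_apply, Ne.symm hij]
  refine ⟨fun α => (hs _ α).continuous, fun α i x => ?_⟩
  have h1 := hd (List.finRange d) α i (List.mem_finRange i) (List.nodup_finRange d)
  have h2 : multiDeriv (α + Pi.single i 1) f = partialDeriv i (multiDeriv α f) := h1.symm
  simp only [h2]
  have h3 : DifferentiableAt ℝ (multiDeriv α f) x := ((hs _ α).differentiable (by simp)) x
  exact h3.lineDifferentiableAt.hasLineDerivAt

theorem multiLength_add_single (α : Fin d → ℕ) (i : Fin d) (n : ℕ) :
    multiLength (α + Pi.single i n) = multiLength α + n := by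
  simp [multiLength, Finset.sum_add_distrib]

theorem multiDeriv_zero (f : EuclideanSpace ℝ (Fin d) → G) : multiDeriv 0 f = f := by
  have : ∀ l : List (Fin d), l.foldr (fun i g => (partialDeriv i)^[(0 : Fin d → ℕ) i] g) f = f := by
    intro l
    induction l with
    | nil => rfl
    | cons i l ih => rw [List.foldr_cons, ih]; rfl
  exact this _

end PartialFamily

/-! ### Duality in locally convex spaces -/

section Duality

variable {E : Type*} [AddCommGroup E] [Module ℂ E] [TopologicalSpace E]
  [IsTopologicalAddGroup E] [ContinuousSMul ℂ E]

/-- Hahn–Banach, starting from the functional `c v ↦ c p(v)` on a line. It turns every seminorm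
estimate of a weak integral or of a limit into an estimate of scalar functions that is uniform over
the functionals dominated by `p`. -/
theorem exists_dual_eq_seminorm {p : Seminorm ℂ E} (hp : Continuous p) (v : E) :
    ∃ ℓ : E →L[ℂ] ℂ, (∀ x, ‖ℓ x‖ ≤ p x) ∧ ‖ℓ v‖ = p v := by
  by_cases hv : v = 0
  · exact ⟨0, fun x => by simp, by simp [hv]⟩
  let f : Module.Dual ℂ (Submodule.span ℂ {v}) :=
    ((p v : ℂ) • LinearMap.id) ∘ₗ (LinearEquiv.toSpanNonzeroSingleton ℂ E v hv).symm.toLinearMap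
  have hf : ∀ x : Submodule.span ℂ {v}, ‖f x‖ ≤ p x := by
    intro x
    obtain ⟨c, rfl⟩ := (LinearEquiv.toSpanNonzeroSingleton ℂ E v hv).surjective x
    simp only [f, LinearMap.comp_apply, LinearEquiv.coe_coe, LinearEquiv.symm_apply_apply]
    simp [LinearEquiv.toSpanNonzeroSingleton_apply, map_smul_eq_mul, mul_comm,
      abs_of_nonneg (apply_nonneg p v)]
  obtain ⟨g, hg, hgp⟩ := Module.Dual.exists_extension_of_le_seminorm _ f hf
  have hc : Continuous g := by
    refine continuous_of_continuousAt_zero g ?_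
    rw [ContinuousAt, map_zero]
    refine squeeze_zero_norm hgp ?_
    simpa using hp.tendsto 0
  refine ⟨⟨g, hc⟩, hgp, ?_⟩
  have h1 := hg (LinearEquiv.toSpanNonzeroSingleton ℂ E v hv 1)
  have h2 : f (LinearEquiv.toSpanNonzeroSingleton ℂ E v hv 1) = (p v : ℂ) := by
    simp only [f, LinearMap.comp_apply, LinearEquiv.coe_coe, LinearEquiv.symm_apply_apply]
    simp
  rw [h2] at h1
  simp only [LinearEquiv.toSpanNonzeroSingleton_apply, one_smul] at h1
  change ‖g v‖ = p v
  rw [h1]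
  simp

theorem seminorm_le_of_dual {p : Seminorm ℂ E} (hp : Continuous p) {v : E} {r : ℝ}
    (h : ∀ ℓ : E →L[ℂ] ℂ, (∀ x, ‖ℓ x‖ ≤ p x) → ‖ℓ v‖ ≤ r) : p v ≤ r := by
  obtain ⟨ℓ, h1, h2⟩ := exists_dual_eq_seminorm hp v
  exact h2 ▸ h ℓ h1

/-- The seminorm `|ℓ|` of a continuous functional. -/
noncomputable def dualSeminorm (ℓ : E →L[ℂ] ℂ) : Seminorm ℂ E :=
  (normSeminorm ℂ ℂ).comp ℓ.toLinearMap

theorem continuous_dualSeminorm (ℓ : E →L[ℂ] ℂ) : Continuous (dualSeminorm ℓ) :=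
  ℓ.continuous.norm

variable [LocallyConvexSpace ℝ E]

theorem exists_seminorm_ball_subset {U : Set E} (hU : U ∈ 𝓝 (0 : E)) :
    ∃ p : Seminorm ℂ E, Continuous p ∧ ∀ x, p x < 1 → x ∈ U := by
  have hsm : ContinuousSMul ℝ E := IsScalarTower.continuousSMul (M := ℝ) (α := E) ℂ
  obtain ⟨V, ⟨hV0, hVc⟩, hVU⟩ := (LocallyConvexSpace.convex_basis_zero ℝ E).mem_iff.1 hU
  -- This set is balanced by design and convex because `V` is. It is a neighbourhood of `0` because
  -- it contains the balanced core of `V`.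
  let W : Set E := {v | ∀ c : ℂ, ‖c‖ ≤ 1 → c • v ∈ V}
  have hWV : W ⊆ V := fun v hv => by simpa using hv 1 (by simp)
  have hWb : Balanced ℂ W := by
    rintro a ha _ ⟨v, hv, rfl⟩ c hc
    rw [smul_smul]
    exact hv _ (by rw [norm_mul]; exact mul_le_one₀ hc (norm_nonneg _) ha)
  have hWc : Convex ℝ W := by
    intro x hx y hy a b ha hb hab c hc
    rw [smul_add, smul_comm c a, smul_comm c b]
    exact hVc (hx c hc) (hy c hc) ha hb hab
  have hW0 : W ∈ 𝓝 (0 : E) := by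
    refine mem_of_superset (balancedCore_mem_nhds_zero (𝕜 := ℂ) hV0) fun v hv c hc => ?_
    exact balancedCore_subset V ((balancedCore_balanced V).smul_mem hc hv)
  have hWa : Absorbent ℝ W := absorbent_nhds_zero hW0
  refine ⟨gaugeSeminorm hWb hWc hWa, continuous_gauge hWc hW0, fun x hx => hVU (hWV ?_)⟩
  exact setOfPred_gauge_lt_one_subset_self hWc (mem_of_mem_nhds hW0) hWa hx

theorem isVonNBounded_iff_seminorm {Z : Set E} : Bornology.IsVonNBounded ℂ Z ↔
    ∀ p : Seminorm ℂ E, Continuous p → ∃ C : ℝ, ∀ z ∈ Z, p z ≤ C := by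
  constructor
  · intro hZ p hp
    have hU : {x : E | p x < 1} ∈ 𝓝 (0 : E) :=
      (isOpen_lt hp continuous_const).mem_nhds (by simp)
    obtain ⟨r, hr, h⟩ := (hZ hU).exists_pos
    refine ⟨r, fun z hz => ?_⟩
    obtain ⟨u, hu, rfl⟩ := h (r : ℂ) (by simp [abs_of_pos hr]) hz
    have hu' : p u < 1 := hu
    change p ((r : ℂ) • u) ≤ r
    rw [map_smul_eq_mul, Complex.norm_real, Real.norm_of_nonneg hr.le]
    nlinarith
  · intro h U hU
    obtain ⟨p, hp, hpU⟩ := exists_seminorm_ball_subset hU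
    obtain ⟨C, hC⟩ := h p hp
    refine Absorbs.of_norm ⟨max C 0 + 1, fun a ha z hz => ?_⟩
    have ha0 : 0 < ‖a‖ := by linarith [le_max_right C 0]
    rw [Set.mem_smul_set_iff_inv_smul_mem₀ (norm_pos_iff.1 ha0)]
    refine hpU _ ?_
    rw [map_smul_eq_mul, norm_inv, inv_mul_lt_iff₀ ha0, mul_one]
    linarith [hC z hz, le_max_left C 0]

theorem eq_of_forall_dual_eq [T2Space E] {v w : E} (h : ∀ ℓ : E →L[ℂ] ℂ, ℓ v = ℓ w) : v = w := by
  by_contra hne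
  obtain ⟨f, hf⟩ := RCLike.geometric_hahn_banach_point_point (𝕜 := ℂ) hne
  rw [h f] at hf
  exact lt_irrefl _ hf

/-- The shape `b m + b n` suits errors measured against a common limit that is not yet known to
exist in `E`, such as a scalar integral. -/
theorem cauchy_of_seminorm (hE : IsSequentiallyComplete E) {u : ℕ → E}
    (h : ∀ p : Seminorm ℂ E, Continuous p → ∃ b : ℕ → ℝ, Tendsto b atTop (𝓝 0) ∧
      ∀ m n, p (u m - u n) ≤ b m + b n) : ∃ a, Tendsto u atTop (𝓝 a) := by
  refine hE u fun U hU => ?_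
  obtain ⟨p, hp, hpU⟩ := exists_seminorm_ball_subset hU
  obtain ⟨b, hb, hpb⟩ := h p hp
  obtain ⟨N, hN⟩ := eventually_atTop.1 (hb.eventually (gt_mem_nhds (show (0 : ℝ) < 1 / 2 by norm_num)))
  refine ⟨N, fun m hm n hn => hpU _ ((hpb m n).trans_lt ?_)⟩
  linarith [hN m hm, hN n hn]

end Duality

/-! ### Bounded disks -/

section Disks

variable {E : Type*} [AddCommGroup E] [Module ℂ E] [TopologicalSpace E]

theorem BoundedDisk.mem_span {B : BoundedDisk E} {v : E} (hv : v ∈ B.carrier) :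
    v ∈ Submodule.span ℂ B.carrier := Submodule.subset_span hv

/-- An element of the linear span of `B`, as a vector of the normed space. -/
def BoundedDisk.toSpace {B : BoundedDisk E} (v : E)
    (hv : v ∈ Submodule.span ℂ B.carrier) : B.Space :=
  ⟨v, hv⟩

theorem BoundedDisk.val_injective {B : BoundedDisk E} :
    Function.Injective (BoundedDisk.Space.val : B.Space → E) := Subtype.val_injective

@[simp] theorem BoundedDisk.val_zero {B : BoundedDisk E} : (0 : B.Space).val = 0 := rfl
@[simp] theorem BoundedDisk.val_add {B : BoundedDisk E} (x y : B.Space) :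
    (x + y).val = x.val + y.val := rfl
@[simp] theorem BoundedDisk.val_sub {B : BoundedDisk E} (x y : B.Space) :
    (x - y).val = x.val - y.val := rfl
@[simp] theorem BoundedDisk.val_smul {B : BoundedDisk E} (c : ℂ) (x : B.Space) :
    (c • x).val = c • x.val := rfl

variable {B : BoundedDisk E}

theorem BoundedDisk.smul_mem_span {r : ℝ} {v : E} (hv : v ∈ r • B.carrier) :
    v ∈ Submodule.span ℂ B.carrier := by
  obtain ⟨b, hb, rfl⟩ := hv
  change r • b ∈ _
  rw [← Complex.coe_smul]
  exact Submodule.smul_mem _ _ (BoundedDisk.mem_span hb)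

variable [T1Space E]

theorem BoundedDisk.norm_le_of_mem_smul {r : ℝ} (hr : 0 ≤ r) (x : B.Space)
    (hv : x.val ∈ r • B.carrier) : ‖x‖ ≤ r :=
  gauge_le_of_mem hr hv

theorem BoundedDisk.exists_mem_of_norm_lt (x : B.Space) {r : ℝ} (hr : ‖x‖ < r) :
    ∃ s, 0 < s ∧ s < r ∧ ∃ b ∈ B.carrier, x.val = s • b := by
  obtain ⟨s, ⟨hs0, ⟨b, hb, hbx⟩⟩, hsr⟩ := exists_lt_of_csInf_lt (B.exists_mem_smul x.2) hr
  exact ⟨s, hs0, hsr, b, hb, hbx.symm⟩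

theorem BoundedDisk.seminorm_le {p : Seminorm ℂ E} {C : ℝ}
    (h : ∀ b ∈ B.carrier, p b ≤ C) (x : B.Space) : p x.val ≤ C * ‖x‖ := by
  have hC : 0 ≤ C := by
    obtain ⟨b, hb⟩ := B.nonempty
    exact (apply_nonneg p b).trans (h b hb)
  have : ∀ r, ‖x‖ < r → p x.val ≤ C * r := by
    intro r hr
    obtain ⟨s, hs0, hsr, b, hb, hx⟩ := BoundedDisk.exists_mem_of_norm_lt x hr
    rw [hx, ← Complex.coe_smul, map_smul_eq_mul, Complex.norm_real, Real.norm_of_nonneg hs0.le,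
      mul_comm]
    exact mul_le_mul (h b hb) hsr.le hs0.le hC
  refine le_of_tendsto_of_tendsto (b := 𝓝[>] ‖x‖) tendsto_const_nhds (f := fun _ => p x.val)
    (g := fun r => C * r) ?_ (eventually_nhdsWithin_of_forall fun r hr => this r hr)
  exact (continuous_const.mul continuous_id).continuousWithinAt

variable [IsTopologicalAddGroup E] [ContinuousSMul ℂ E] [LocallyConvexSpace ℝ E]

theorem BoundedDisk.exists_seminorm_bound (B : BoundedDisk E) {p : Seminorm ℂ E}
    (hp : Continuous p) : ∃ C : ℝ, 0 ≤ C ∧ (∀ b ∈ B.carrier, p b ≤ C) ∧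
      ∀ x : B.Space, p x.val ≤ C * ‖x‖ := by
  obtain ⟨C, hC⟩ := isVonNBounded_iff_seminorm.1 B.bounded p hp
  refine ⟨C, ?_, hC, BoundedDisk.seminorm_le hC⟩
  obtain ⟨b, hb⟩ := B.nonempty
  exact (apply_nonneg p b).trans (hC b hb)

/-- The inclusion of the span of a disk followed by a continuous functional. -/
noncomputable def BoundedDisk.restrictDual (B : BoundedDisk E) (ℓ : E →L[ℂ] ℂ) :
    B.Space →L[ℂ] ℂ :=
  LinearMap.mkContinuousOfExistsBound
    { toFun := fun x => ℓ x.val, map_add' := fun x y => by simp, map_smul' := fun c x => by simp }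
    (by
      obtain ⟨C, _, _, h⟩ := B.exists_seminorm_bound (continuous_dualSeminorm ℓ)
      exact ⟨C, h⟩)

/-- The bipolar theorem: a closed absolutely convex set is separated from any point outside it by a
functional that is bounded by `1` on the set. -/
theorem BoundedDisk.mem_carrier_of_dual {v : E}
    (h : ∀ ℓ : E →L[ℂ] ℂ, (∀ b ∈ B.carrier, ‖ℓ b‖ ≤ 1) → ‖ℓ v‖ ≤ 1) : v ∈ B.carrier := by
  by_contra hv
  obtain ⟨f, u, hfu, hu⟩ := RCLike.geometric_hahn_banach_closed_point (𝕜 := ℂ) B.convex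
    B.isClosed hv
  have hu0 : 0 < u := by
    have := hfu 0 (B.balanced.zero_mem B.nonempty)
    simpa using this
  have hb : ∀ b ∈ B.carrier, ‖f b‖ ≤ u := by
    intro b hb
    by_cases h0 : f b = 0
    · rw [h0, norm_zero]; exact hu0.le
    -- Rotating `b` within the balanced set makes `f b` real and positive, so a bound on real parts
    -- becomes a bound on moduli.
    have h1 := hfu ((starRingEnd ℂ (f b) / ‖f b‖) • b) (B.balanced.smul_mem (by
      rw [norm_div, RCLike.norm_conj, Complex.norm_real, norm_norm, div_self]
      simpa using h0) hb)
    rw [map_smul, smul_eq_mul, div_mul_eq_mul_div, mul_comm, Complex.mul_conj,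
      Complex.normSq_eq_norm_sq] at h1
    have h2 : (((‖f b‖ ^ 2 : ℝ) : ℂ) / (‖f b‖ : ℂ)) = ((‖f b‖ : ℝ) : ℂ) := by
      have : (‖f b‖ : ℂ) ≠ 0 := by simpa using h0
      push_cast
      field_simp
    rw [h2] at h1
    exact le_of_lt (by simpa using h1)
  have h3 := h (((u⁻¹ : ℝ) : ℂ) • f) (fun b hb' => by
    rw [_root_.smul_apply, smul_eq_mul, norm_mul, Complex.norm_real,
      Real.norm_of_nonneg (by positivity), inv_mul_le_iff₀ hu0, mul_one]
    exact hb b hb')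
  rw [_root_.smul_apply, smul_eq_mul, norm_mul, Complex.norm_real,
      Real.norm_of_nonneg (by positivity), inv_mul_le_iff₀ hu0, mul_one] at h3
  have : (RCLike.re (f v) : ℝ) ≤ ‖f v‖ := RCLike.re_le_norm _
  linarith

/-- The norm of `E_B` is thereby controlled by continuous functionals of `E` itself. This is how
weak Taylor estimates become differentiability for the norm of `E_B`. -/
theorem BoundedDisk.norm_le_of_dual (x : B.Space) {r : ℝ} (hr : 0 ≤ r)
    (h : ∀ ℓ : E →L[ℂ] ℂ, (∀ b ∈ B.carrier, ‖ℓ b‖ ≤ 1) → ‖ℓ x.val‖ ≤ r) : ‖x‖ ≤ r := by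
  refine le_of_forall_pos_le_add fun ε hε => ?_
  have hrε : 0 < r + ε := by positivity
  refine BoundedDisk.norm_le_of_mem_smul hrε.le x ?_
  rw [Set.mem_smul_set_iff_inv_smul_mem₀ hrε.ne']
  refine BoundedDisk.mem_carrier_of_dual fun ℓ hℓ => ?_
  rw [← Complex.coe_smul, map_smul, smul_eq_mul, norm_mul, Complex.norm_real,
    Real.norm_of_nonneg (by positivity), inv_mul_le_iff₀ hrε, mul_one]
  exact (h ℓ hℓ).trans (by linarith)

/-- A bounded set is contained in a bounded disk. -/
theorem exists_boundedDisk {Z : Set E}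
    (hZ : ∀ p : Seminorm ℂ E, Continuous p → ∃ C : ℝ, ∀ z ∈ Z, p z ≤ C) :
    ∃ B : BoundedDisk E, Z ⊆ B.carrier := by
  choose! C hC using hZ
  -- The disk is cut out by all the seminorm bounds of `Z` at once. The maximum with `0` keeps the
  -- origin inside even if `Z` is empty.
  refine ⟨⟨{x | ∀ p : Seminorm ℂ E, Continuous p → p x ≤ max (C p) 0}, ⟨0, fun p _ => by simp⟩,
    ?_, ?_, ?_, ?_⟩, fun z hz p hp => (hC p hp z hz).trans (le_max_left _ _)⟩
  · rintro a ha _ ⟨v, hv, rfl⟩ p hp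
    change p (a • v) ≤ _
    rw [map_smul_eq_mul]
    exact (mul_le_of_le_one_left (apply_nonneg p v) ha).trans (hv p hp)
  · intro x hx y hy a b ha hb hab p hp
    refine (map_add_le_add p _ _).trans ?_
    rw [← Complex.coe_smul, ← Complex.coe_smul, map_smul_eq_mul, map_smul_eq_mul,
      Complex.norm_real, Complex.norm_real, Real.norm_of_nonneg ha, Real.norm_of_nonneg hb]
    calc a * p x + b * p y ≤ a * max (C p) 0 + b * max (C p) 0 :=
          add_le_add (mul_le_mul_of_nonneg_left (hx p hp) ha)
            (mul_le_mul_of_nonneg_left (hy p hp) hb)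
      _ = max (C p) 0 := by rw [← add_mul, hab, one_mul]
  · have : {x : E | ∀ p : Seminorm ℂ E, Continuous p → p x ≤ max (C p) 0} =
        ⋂ p : {p : Seminorm ℂ E // Continuous p}, {x | p.1 x ≤ max (C p.1) 0} := by
      ext x; simp
    rw [this]
    exact isClosed_iInter fun p => isClosed_le p.2 continuous_const
  · rw [isVonNBounded_iff_seminorm]
    exact fun p hp => ⟨_, fun z hz => hz p hp⟩

end Disks

/-! ### Weak integrals -/

section WeakIntegral

variable {d : ℕ} {E : Type*} [AddCommGroup E] [Module ℂ E] [TopologicalSpace E]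
  [IsTopologicalAddGroup E] [ContinuousSMul ℂ E] [LocallyConvexSpace ℝ E]

theorem isWeakIntegral_weakIntegral {g : EuclideanSpace ℝ (Fin d) → E} {v : E}
    (hv : IsWeakIntegral g v) : IsWeakIntegral g (weakIntegral g) := by
  have h : ∃ v, IsWeakIntegral g v := ⟨v, hv⟩
  rw [weakIntegral, dif_pos h]
  exact h.choose_spec

/-- Scalar functions all of whose exponential moments are finite. -/
structure HasExpMoments (f : EuclideanSpace ℝ (Fin d) → ℂ) : Prop where
  meas : AEStronglyMeasurable f
  integrable : ∀ κ : ℝ, Integrable fun x => ‖f x‖ * Real.exp (κ * ‖x‖)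

/-- Vector functions of at most exponential growth with respect to each seminorm. -/
structure HasExpGrowthFun (g : EuclideanSpace ℝ (Fin d) → E) : Prop where
  continuous : Continuous g
  bound : ∀ p : Seminorm ℂ E, Continuous p →
    ∃ C κ : ℝ, 0 ≤ C ∧ 0 ≤ κ ∧ ∀ x, p (g x) ≤ C * Real.exp (κ * ‖x‖)

theorem integrable_mul_of_expBound {f u : EuclideanSpace ℝ (Fin d) → ℂ}
    (hf : AEStronglyMeasurable f) {κ : ℝ} (hi : Integrable fun x => ‖f x‖ * Real.exp (κ * ‖x‖))
    (hu : Continuous u) {C : ℝ} (h : ∀ x, ‖u x‖ ≤ C * Real.exp (κ * ‖x‖)) :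
    Integrable fun x => f x * u x := by
  refine (hi.const_mul C).mono' (hf.mul hu.aestronglyMeasurable) (Eventually.of_forall fun x => ?_)
  rw [norm_mul]
  calc ‖f x‖ * ‖u x‖ ≤ ‖f x‖ * (C * Real.exp (κ * ‖x‖)) := by gcongr; exact h x
    _ = C * (‖f x‖ * Real.exp (κ * ‖x‖)) := by ring

theorem norm_integral_mul_le {f u : EuclideanSpace ℝ (Fin d) → ℂ}
    {κ : ℝ} (hi : Integrable fun x => ‖f x‖ * Real.exp (κ * ‖x‖))
    {C : ℝ} (h : ∀ x, ‖u x‖ ≤ C * Real.exp (κ * ‖x‖)) :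
    ‖∫ x, f x * u x‖ ≤ C * ∫ x, ‖f x‖ * Real.exp (κ * ‖x‖) := by
  rw [← integral_const_mul]
  refine norm_integral_le_of_norm_le (hi.const_mul C) (Eventually.of_forall fun x => ?_)
  rw [norm_mul]
  calc ‖f x‖ * ‖u x‖ ≤ ‖f x‖ * (C * Real.exp (κ * ‖x‖)) := by gcongr; exact h x
    _ = C * (‖f x‖ * Real.exp (κ * ‖x‖)) := by ring

theorem HasExpMoments.norm_integrable {f : EuclideanSpace ℝ (Fin d) → ℂ} (hf : HasExpMoments f) :
    Integrable f := by
  have := hf.integrable 0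
  simp only [zero_mul, Real.exp_zero, mul_one] at this
  exact (integrable_norm_iff hf.meas).1 this

/-- Existence of weak integrals against functions with exponential moments, as limits of Riemann
sums. -/
theorem exists_isWeakIntegral (hE : IsSequentiallyComplete E)
    {f : EuclideanSpace ℝ (Fin d) → ℂ} (hf : HasExpMoments f)
    {g : EuclideanSpace ℝ (Fin d) → E} (hg : HasExpGrowthFun g) :
    ∃ v, IsWeakIntegral (fun x => f x • g x) v := by
  let V := EuclideanSpace ℝ (Fin d)
  -- Simple functions approximating the identity provide the cells and the nodes of the Riemann sums
  -- `σ n`. The bound `‖s n x‖ ≤ 2‖x‖` keeps the exponential growth of `g` at the nodes dominated,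
  -- with rate `2κ`.
  let s : ℕ → SimpleFunc V V := fun n =>
    SimpleFunc.approxOn id measurable_id Set.univ 0 (Set.mem_univ 0) n
  have hs : ∀ x, Tendsto (fun n => s n x) atTop (𝓝 x) := fun x =>
    SimpleFunc.tendsto_approxOn measurable_id (Set.mem_univ 0) (by simp)
  have hsb : ∀ n x, ‖s n x‖ ≤ 2 * ‖x‖ := by
    intro n x
    have h := SimpleFunc.edist_approxOn_y0_le measurable_id (Set.mem_univ (0 : V)) x n
    rw [edist_dist, edist_dist, ← ENNReal.ofReal_add dist_nonneg dist_nonneg,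
      ENNReal.ofReal_le_ofReal_iff (by positivity), dist_zero_left, id, dist_zero_left] at h
    linarith
  let σ : ℕ → E := fun n => ∑ y ∈ (s n).range, (∫ x in (s n) ⁻¹' {y}, f x) • g y
  have hσ : ∀ (ℓ : E →L[ℂ] ℂ) n, ℓ (σ n) = ∫ x, f x * ℓ (g (s n x)) := by
    intro ℓ n
    have h1 : ∀ x, f x * ℓ (g (s n x)) = ∑ y ∈ (s n).range,
        ((s n) ⁻¹' {y}).indicator f x * ℓ (g y) := by
      intro x
      rw [Finset.sum_eq_single (s n x)]
      · simp
      · intro y _ hy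
        rw [Set.indicator_of_notMem (by simpa using hy.symm), zero_mul]
      · intro h
        exact absurd (SimpleFunc.mem_range_self _ x) h
    simp_rw [h1]
    rw [integral_finsetSum]
    · simp only [σ, map_sum, map_smul, smul_eq_mul]
      refine Finset.sum_congr rfl fun y _ => ?_
      rw [integral_mul_const, integral_indicator ((s n).measurableSet_fiber y)]
    · exact fun y _ => (hf.norm_integrable.indicator ((s n).measurableSet_fiber y)).mul_const _
  -- This number bounds the error of the Riemann sum under all functionals dominated by `p`
  -- simultaneously. Its convergence to `0` makes the sums Cauchy for `p`.
  let I : Seminorm ℂ E → ℕ → ℝ := fun p n => ∫ x, ‖f x‖ * p (g (s n x) - g x)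
  have hmeas : ∀ p : Seminorm ℂ E, Continuous p → ∀ n,
      AEStronglyMeasurable (fun x => ‖f x‖ * p (g (s n x) - g x)) := by
    intro p hp n
    have hc : Continuous fun z : V × V => p (g z.1 - g z.2) :=
      hp.comp ((hg.continuous.comp continuous_fst).sub (hg.continuous.comp continuous_snd))
    exact hf.meas.norm.mul
      (hc.measurable.comp ((s n).measurable.prodMk measurable_id)).aestronglyMeasurable
  have hbound : ∀ p : Seminorm ℂ E, Continuous p → ∃ b : V → ℝ, Integrable b ∧ ∀ n x,
      ‖(‖f x‖ * p (g (s n x) - g x))‖ ≤ b x := by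
    intro p hp
    obtain ⟨C, κ, hC, hκ, hpC⟩ := hg.bound p hp
    refine ⟨fun x => 2 * C * (‖f x‖ * Real.exp ((2 * κ) * ‖x‖)),
      (hf.integrable _).const_mul _, fun n x => ?_⟩
    rw [Real.norm_of_nonneg (by positivity)]
    have h1 : p (g (s n x)) ≤ C * Real.exp (2 * κ * ‖x‖) := by
      refine (hpC _).trans ?_
      have := mul_le_mul_of_nonneg_left (hsb n x) hκ
      gcongr C * Real.exp ?_
      linarith
    have h2 : p (g x) ≤ C * Real.exp (2 * κ * ‖x‖) := by
      refine (hpC _).trans ?_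
      have := mul_nonneg hκ (norm_nonneg x)
      gcongr C * Real.exp ?_
      linarith
    calc ‖f x‖ * p (g (s n x) - g x) ≤ ‖f x‖ * (2 * (C * Real.exp (2 * κ * ‖x‖))) := by
          gcongr
          refine (map_sub_le_add p _ _).trans ?_
          linarith
      _ = _ := by ring
  have hI : ∀ p : Seminorm ℂ E, Continuous p → Tendsto (I p) atTop (𝓝 0) := by
    intro p hp
    obtain ⟨b, hb, hbn⟩ := hbound p hp
    have := tendsto_integral_of_dominated_convergence (f := fun _ : V => (0 : ℝ)) b (hmeas p hp) hb
      (fun n => Eventually.of_forall (hbn n)) (Eventually.of_forall fun x => ?_)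
    · simpa using this
    · have hc : Continuous fun z : V => p (g z - g x) :=
        hp.comp (hg.continuous.sub continuous_const)
      have := ((hc.tendsto x).comp (hs x)).const_mul ‖f x‖
      simpa using this
  have hint : ∀ (ℓ : E →L[ℂ] ℂ), Integrable (fun x => f x * ℓ (g x)) := by
    intro ℓ
    obtain ⟨C, κ, _, _, h⟩ := hg.bound _ (continuous_dualSeminorm ℓ)
    exact integrable_mul_of_expBound hf.meas (hf.integrable κ) (ℓ.continuous.comp hg.continuous) h
  have herr : ∀ p : Seminorm ℂ E, Continuous p → ∀ ℓ : E →L[ℂ] ℂ, (∀ x, ‖ℓ x‖ ≤ p x) →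
      ∀ n, ‖ℓ (σ n) - ∫ x, f x * ℓ (g x)‖ ≤ I p n := by
    intro p hp ℓ hℓ n
    obtain ⟨b, hb, hbn⟩ := hbound p hp
    have hd : Integrable fun x => ‖f x‖ * p (g (s n x) - g x) :=
      hb.mono' (hmeas p hp n) (Eventually.of_forall (hbn n))
    have hle : ∀ x, ‖f x * ℓ (g (s n x) - g x)‖ ≤ ‖f x‖ * p (g (s n x) - g x) := fun x => by
      rw [norm_mul]
      gcongr
      exact hℓ _
    have hm : AEStronglyMeasurable fun x => f x * ℓ (g (s n x) - g x) := by
      have hc : Continuous fun z : V × V => ℓ (g z.1 - g z.2) :=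
        ℓ.continuous.comp ((hg.continuous.comp continuous_fst).sub
          (hg.continuous.comp continuous_snd))
      exact hf.meas.mul
        (hc.measurable.comp ((s n).measurable.prodMk measurable_id)).aestronglyMeasurable
    have h3 : Integrable fun x => f x * ℓ (g (s n x) - g x) :=
      hd.mono' hm (Eventually.of_forall hle)
    have h4 : ℓ (σ n) = (∫ x, f x * ℓ (g (s n x) - g x)) + ∫ x, f x * ℓ (g x) := by
      rw [hσ, ← integral_add h3 (hint ℓ)]
      congr 1
      funext x
      rw [map_sub]; ring
    rw [h4, add_sub_cancel_right]
    exact norm_integral_le_of_norm_le hd (Eventually.of_forall hle)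
  obtain ⟨v, hv⟩ := cauchy_of_seminorm hE (u := σ) fun p hp =>
    ⟨I p, hI p hp, fun m n => seminorm_le_of_dual hp fun ℓ hℓ => by
      have e : ℓ (σ m - σ n) = (ℓ (σ m) - ∫ x, f x * ℓ (g x)) - (ℓ (σ n) - ∫ x, f x * ℓ (g x)) := by
        rw [map_sub]; ring
      rw [e]
      exact (norm_sub_le _ _).trans (add_le_add (herr p hp ℓ hℓ m) (herr p hp ℓ hℓ n))⟩
  refine ⟨v, fun ℓ => ?_⟩
  simp only [map_smul, smul_eq_mul]
  refine ⟨hint ℓ, ?_⟩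
  have h1 : Tendsto (fun n => ℓ (σ n)) atTop (𝓝 (ℓ v)) := (ℓ.continuous.tendsto v).comp hv
  have h2 : Tendsto (fun n => ℓ (σ n)) atTop (𝓝 (∫ x, f x * ℓ (g x))) := by
    rw [tendsto_iff_norm_sub_tendsto_zero]
    exact squeeze_zero (fun _ => norm_nonneg _)
      (herr _ (continuous_dualSeminorm ℓ) ℓ fun x => le_rfl) (hI _ (continuous_dualSeminorm ℓ))
  exact tendsto_nhds_unique h2 h1

end WeakIntegral

/-! ### Integrability of exponentials -/

section ExpIntegrable

variable {d : ℕ}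

theorem integrable_one_add_norm_pow :
    Integrable fun x : EuclideanSpace ℝ (Fin d) => ((1 + ‖x‖) ^ (d + 1))⁻¹ := by
  have h := integrable_one_add_norm (E := EuclideanSpace ℝ (Fin d)) (μ := volume) (r := d + 1)
    (by simp)
  refine h.congr (Eventually.of_forall fun x => ?_)
  have : (0 : ℝ) ≤ 1 + ‖x‖ := by positivity
  simp only
  rw [Real.rpow_neg this]
  congr 1
  exact_mod_cast Real.rpow_natCast (1 + ‖x‖) (d + 1)

theorem integrable_exp_neg_norm {c : ℝ} (hc : 0 < c) :
    Integrable fun x : EuclideanSpace ℝ (Fin d) => Real.exp (-(c * ‖x‖)) := by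
  have hnn : (0 : ℝ) < (d + 1).factorial := by positivity
  refine ((integrable_one_add_norm_pow (d := d)).const_mul
    (Real.exp c * (d + 1).factorial / c ^ (d + 1))).mono' (by fun_prop)
      (Eventually.of_forall fun x => ?_)
  rw [Real.norm_of_nonneg (Real.exp_pos _).le]
  have h1 := Real.pow_div_factorial_le_exp (c * (1 + ‖x‖)) (by positivity) (d + 1)
  have h2 : Real.exp (c * (1 + ‖x‖)) = Real.exp c * Real.exp (c * ‖x‖) := by
    rw [← Real.exp_add]; ring_nf
  rw [h2, div_le_iff₀ hnn, mul_pow] at h1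
  rw [Real.exp_neg, ← div_eq_mul_inv, le_div_iff₀ (by positivity),
    inv_mul_le_iff₀ (by positivity), mul_div_assoc', le_div_iff₀ (by positivity)]
  linarith

theorem hasExpMoments_of_forall_bound {f : EuclideanSpace ℝ (Fin d) → ℂ} (hf : Continuous f)
    (h : ∀ n : ℕ, ∃ C : ℝ, ∀ x, ‖f x‖ * Real.exp (n * ‖x‖) ≤ C) : HasExpMoments f := by
  refine ⟨hf.aestronglyMeasurable, fun κ => ?_⟩
  obtain ⟨n, hn⟩ := exists_nat_ge (κ + 1)
  obtain ⟨C, hC⟩ := h n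
  refine ((integrable_exp_neg_norm (d := d) one_pos).const_mul C).mono'
    (by fun_prop) (Eventually.of_forall fun x => ?_)
  rw [Real.norm_of_nonneg (by positivity)]
  calc ‖f x‖ * Real.exp (κ * ‖x‖) ≤ ‖f x‖ * (Real.exp (n * ‖x‖) * Real.exp (-(1 * ‖x‖))) := by
        rw [← Real.exp_add]
        gcongr
        nlinarith [norm_nonneg x]
    _ = (‖f x‖ * Real.exp (n * ‖x‖)) * Real.exp (-(1 * ‖x‖)) := by ring
    _ ≤ C * Real.exp (-(1 * ‖x‖)) := by gcongr; exact hC x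

theorem CExp.hasExpMoments {f : EuclideanSpace ℝ (Fin d) → ℂ} (hf : f ∈ CExp d) :
    HasExpMoments f := hasExpMoments_of_forall_bound hf.1 hf.2

end ExpIntegrable

/-! ### Representations of exponential growth -/

section Growth

variable {d : ℕ} {E : Type*} [AddCommGroup E] [Module ℂ E] [TopologicalSpace E]
  [IsTopologicalAddGroup E] [ContinuousSMul ℂ E] [LocallyConvexSpace ℝ E] [T2Space E]

/-- The common growth property of projective and of inductive generalized proto-Banach
representations. -/
def Representation.HasExpGrowth (π : Representation d E) : Prop :=
  ∀ B : BoundedDisk E, ∀ p : Seminorm ℂ E, Continuous p → ∃ C κ : ℝ, 0 ≤ C ∧ 0 ≤ κ ∧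
    ∀ (x : EuclideanSpace ℝ (Fin d)) (b : B.Space),
      p (π.orbit b.val x) ≤ C * Real.exp (κ * ‖x‖) * ‖b‖

/-- In the projective case `q` is bounded on `B`, in the inductive case `p` is bounded on `A`. From
here on the two kinds of representations are treated alike. -/
theorem Representation.hasExpGrowth {π : Representation d E}
    (hπ : π.IsProjective ∨ π.IsInductive) : π.HasExpGrowth := by
  intro B p hp
  rcases hπ with hπ | hπ
  · obtain ⟨q, hq, κ, hκ, h⟩ := hπ p hp
    obtain ⟨C, hC, _, hqC⟩ := B.exists_seminorm_bound hq
    refine ⟨C, κ, hC, hκ.le, fun x b => (h x _).trans ?_⟩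
    calc Real.exp (κ * ‖x‖) * q b.val ≤ Real.exp (κ * ‖x‖) * (C * ‖b‖) := by gcongr; exact hqC b
      _ = _ := by ring
  · obtain ⟨A, κ, hκ, h⟩ := hπ B
    obtain ⟨C, hC, _, hqC⟩ := A.exists_seminorm_bound hp
    refine ⟨C, κ, hC, hκ.le, fun x b => ?_⟩
    obtain ⟨a, ha, hab⟩ := h x b
    rw [← ha]
    calc p a.val ≤ C * ‖a‖ := hqC a
      _ ≤ C * (Real.exp (κ * ‖x‖) * ‖b‖) := by gcongr
      _ = _ := by ring

theorem exists_mem_disk (e : E) : ∃ B : BoundedDisk E, ∃ b : B.Space, b.val = e := by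
  obtain ⟨B, hB⟩ := exists_boundedDisk (Z := {e}) fun p _ => ⟨p e, by simp⟩
  exact ⟨B, BoundedDisk.toSpace e (BoundedDisk.mem_span (hB rfl)), rfl⟩

variable {π : Representation d E}

theorem Representation.HasExpGrowth.orbit (hπ : π.HasExpGrowth) (e : E) :
    HasExpGrowthFun (π.orbit e) := by
  refine ⟨π.continuous_orbit e, fun p hp => ?_⟩
  obtain ⟨B, b, rfl⟩ := exists_mem_disk e
  obtain ⟨C, κ, hC, hκ, h⟩ := hπ B p hp
  refine ⟨C * ‖b‖, κ, by positivity, hκ, fun x => (h x b).trans (le_of_eq (by ring))⟩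

theorem Representation.isWeakIntegral_bigPi (hE : IsSequentiallyComplete E)
    (hπ : π.HasExpGrowth) {f : EuclideanSpace ℝ (Fin d) → ℂ} (hf : HasExpMoments f) (e : E) :
    IsWeakIntegral (fun x => f x • π.orbit e x) (π.bigPi f e) := by
  obtain ⟨v, hv⟩ := exists_isWeakIntegral hE hf (hπ.orbit e)
  exact isWeakIntegral_weakIntegral hv

/-- `π(x)` as a continuous linear map. -/
def Representation.act (π : Representation d E) (x : EuclideanSpace ℝ (Fin d)) : E →L[ℂ] E :=
  (π.toHom (Multiplicative.ofAdd x) : E →L[ℂ] E)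

@[simp] theorem Representation.act_apply (x : EuclideanSpace ℝ (Fin d)) (e : E) :
    π.act x e = π.orbit e x := rfl

theorem Representation.orbit_zero (e : E) : π.orbit e 0 = e := by
  simp [Representation.orbit]
  rfl

theorem Representation.orbit_orbit (e : E) (x y : EuclideanSpace ℝ (Fin d)) :
    π.orbit (π.orbit e y) x = π.orbit e (x + y) := by
  simp [Representation.orbit, ofAdd_add]
  rfl

theorem Representation.dual_bigPi (hE : IsSequentiallyComplete E)
    (hπ : π.HasExpGrowth) {f : EuclideanSpace ℝ (Fin d) → ℂ} (hf : HasExpMoments f) (e : E)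
    (ℓ : E →L[ℂ] ℂ) : ℓ (π.bigPi f e) = ∫ y, f y * ℓ (π.orbit e y) := by
  have := (π.isWeakIntegral_bigPi hE hπ hf e ℓ).2
  simpa using this.symm

/-- Since `π(x)` is continuous, `ℓ ∘ π(x)` is again a functional and the weak integral may be tested
against it. Orbits of vectors `Π(f)e` thus become scalar integrals of translates. -/
theorem Representation.dual_orbit_bigPi (hE : IsSequentiallyComplete E)
    (hπ : π.HasExpGrowth) {f : EuclideanSpace ℝ (Fin d) → ℂ} (hf : HasExpMoments f) (e : E)
    (ℓ : E →L[ℂ] ℂ) (x : EuclideanSpace ℝ (Fin d)) :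
    ℓ (π.orbit (π.bigPi f e) x) = ∫ y, f y * ℓ (π.orbit e (x + y)) := by
  have := π.dual_bigPi hE hπ hf e (ℓ.comp (π.act x))
  simpa [Representation.orbit_orbit] using this

end Growth

/-! ### Functions on strips and their Fourier kernels -/

section Strip

variable {d : ℕ}

/-- The point `ξ + iη` of `ℂ^d`. -/
noncomputable def cpt (ξ η : EuclideanSpace ℝ (Fin d)) : Fin d → ℂ :=
  fun i => (ξ i : ℂ) + Complex.I * (η i : ℂ)

/-- Holomorphic functions on the strip `|Im z| < σ` that are bounded by `A (1 + |Re z|)^{-d-1}`. -/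
structure StripBound (σ A : ℝ) (Φ : (Fin d → ℂ) → ℂ) : Prop where
  diff : ∀ ξ η : EuclideanSpace ℝ (Fin d), ‖η‖ < σ → DifferentiableAt ℂ Φ (cpt ξ η)
  bound : ∀ ξ η : EuclideanSpace ℝ (Fin d), ‖η‖ < σ →
    ‖Φ (cpt ξ η)‖ ≤ A * ((1 + ‖ξ‖) ^ (d + 1))⁻¹

theorem continuous_cpt (η : EuclideanSpace ℝ (Fin d)) :
    Continuous fun ξ : EuclideanSpace ℝ (Fin d) => cpt ξ η := by
  refine continuous_pi fun i => ?_
  unfold cpt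
  fun_prop

theorem StripBound.continuous {σ A : ℝ} {Φ : (Fin d → ℂ) → ℂ} (h : StripBound σ A Φ)
    {η : EuclideanSpace ℝ (Fin d)} (hη : ‖η‖ < σ) : Continuous fun ξ => Φ (cpt ξ η) :=
  continuous_iff_continuousAt.2 fun ξ =>
    (h.diff ξ η hη).continuousAt.comp (f := fun ξ => cpt ξ η) (continuous_cpt η).continuousAt

theorem StripBound.integrable {σ A : ℝ} {Φ : (Fin d → ℂ) → ℂ} (h : StripBound σ A Φ)
    {η : EuclideanSpace ℝ (Fin d)} (hη : ‖η‖ < σ) : Integrable fun ξ => Φ (cpt ξ η) :=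
  (integrable_one_add_norm_pow.const_mul A).mono' (h.continuous hη).aestronglyMeasurable
    (Eventually.of_forall fun ξ => h.bound ξ η hη)

theorem StripBound.nonneg {σ A : ℝ} {Φ : (Fin d → ℂ) → ℂ} (h : StripBound σ A Φ)
    (hσ : 0 < σ) : 0 ≤ A := by
  have := (norm_nonneg _).trans (h.bound 0 0 (by simpa using hσ))
  simpa using this

theorem one_add_norm_pow_shift (ξ v : EuclideanSpace ℝ (Fin d)) {T : ℝ} (hv : ‖v‖ ≤ T) :
    ((1 + ‖ξ + v‖) ^ (d + 1))⁻¹ ≤ (1 + T) ^ (d + 1) * ((1 + ‖ξ‖) ^ (d + 1))⁻¹ := by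
  have hT : 0 ≤ T := (norm_nonneg v).trans hv
  rw [inv_le_iff_one_le_mul₀ (by positivity), mul_assoc, mul_comm, mul_assoc,
    inv_mul_eq_div, one_le_div (by positivity), ← mul_pow] 
  gcongr
  have h1 : ‖ξ‖ ≤ ‖ξ + v‖ + ‖v‖ := by
    have := norm_sub_le (ξ + v) v
    rwa [add_sub_cancel_right] at this
  nlinarith [norm_nonneg (ξ + v)]

/-- The integral of a holomorphic function over horizontal planes does not depend on the plane. -/
theorem StripBound.integral_shift {σ A : ℝ} {Φ : (Fin d → ℂ) → ℂ} (h : StripBound σ A Φ)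
    {η : EuclideanSpace ℝ (Fin d)} (hη : ‖η‖ < σ) :
    ∫ ξ, Φ (cpt ξ η) = ∫ ξ, Φ (cpt ξ 0) := by
  have hσ : 0 < σ := (norm_nonneg η).trans_lt hη
  have hA := h.nonneg hσ
  -- The complex line through `ξ` in the direction `η`. The integral over `ξ` becomes a function `H`
  -- of the single variable `ζ`, to be compared at `0` and at `i`.
  let L : EuclideanSpace ℝ (Fin d) → ℂ → Fin d → ℂ := fun ξ ζ i => (ξ i : ℂ) + ζ * η i
  have hL : ∀ ξ ζ, L ξ ζ = cpt (ξ + ζ.re • η) (ζ.im • η) := by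
    intro ξ ζ
    funext i
    simp only [L, cpt, PiLp.add_apply, PiLp.smul_apply, smul_eq_mul]
    conv_lhs => rw [← Complex.re_add_im ζ]
    push_cast
    ring
  have hLd : ∀ ξ ζ, DifferentiableAt ℂ (L ξ) ζ := by
    intro ξ ζ
    refine differentiableAt_pi.2 fun i => ?_
    simp only [L]
    fun_prop
  let H : ℂ → ℂ := fun ζ => ∫ ξ, Φ (L ξ ζ)
  let U : Set ℂ := {ζ | |ζ.im| * ‖η‖ < σ}
  have hU : IsOpen U := isOpen_lt (by fun_prop) continuous_const
  have hUn : ∀ {ζ}, ζ ∈ U → ‖ζ.im • η‖ < σ := by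
    intro ζ hζ
    rw [norm_smul]; exact hζ
  have hdiff : ∀ ξ ζ, ζ ∈ U → DifferentiableAt ℂ (fun ζ => Φ (L ξ ζ)) ζ := by
    intro ξ ζ hζ
    have h1 := h.diff (ξ + ζ.re • η) (ζ.im • η) (hUn hζ)
    rw [← hL] at h1
    exact h1.comp ζ (hLd ξ ζ)
  have hcont : ∀ ζ, ζ ∈ U → Continuous fun ξ => Φ (L ξ ζ) := by
    intro ζ hζ
    simp only [hL]
    exact (h.continuous (hUn hζ)).comp (continuous_id.add continuous_const)
  have hbd : ∀ ξ ζ, ζ ∈ U → ∀ T : ℝ, |ζ.re| ≤ T → ‖Φ (L ξ ζ)‖ ≤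
      A * ((1 + T * ‖η‖) ^ (d + 1) * ((1 + ‖ξ‖) ^ (d + 1))⁻¹) := by
    intro ξ ζ hζ T hT
    rw [hL]
    refine (h.bound _ _ (hUn hζ)).trans (mul_le_mul_of_nonneg_left ?_ hA)
    refine one_add_norm_pow_shift ξ _ ?_
    rw [norm_smul]
    exact mul_le_mul_of_nonneg_right hT (norm_nonneg _)
  have hderiv : ∀ ζ ∈ U, ∃ H', HasDerivAt H H' ζ := by
    intro ζ₀ hζ₀
    obtain ⟨δ, hδ, hδU⟩ := Metric.isOpen_iff.1 hU ζ₀ hζ₀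
    have hδ2 : 0 < δ / 2 := by positivity
    have hsub : ∀ ζ ∈ Metric.ball ζ₀ (δ / 2), Metric.closedBall ζ (δ / 4) ⊆ Metric.ball ζ₀ δ := by
      intro ζ hζ s hs
      rw [Metric.mem_ball] at *
      rw [Metric.mem_closedBall] at hs
      linarith [dist_triangle s ζ ζ₀]
    let T := |ζ₀.re| + δ
    have hT : ∀ ζ ∈ Metric.ball ζ₀ δ, |ζ.re| ≤ T := by
      intro ζ hζ
      rw [Metric.mem_ball, dist_eq_norm] at hζ
      have h1 := (Complex.abs_re_le_norm (ζ - ζ₀)).trans hζ.le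
      rw [Complex.sub_re] at h1
      have h2 := abs_add_le (ζ.re - ζ₀.re) ζ₀.re
      rw [sub_add_cancel] at h2
      linarith
    -- The derivative is a limit of difference quotients that are continuous in `ξ`. Only its
    -- measurability is drawn from this; its size comes from Cauchy's estimate on circles of radius
    -- `δ/4`.
    have hlim : ∀ ξ, Tendsto (fun n : ℕ => ((δ / 2 / (n + 2) : ℝ) : ℂ)⁻¹ *
        (Φ (L ξ (ζ₀ + ((δ / 2 / (n + 2) : ℝ) : ℂ))) - Φ (L ξ ζ₀))) atTop
        (𝓝 (deriv (fun ζ => Φ (L ξ ζ)) ζ₀)) := by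
      intro ξ
      have h1 := (hdiff ξ ζ₀ hζ₀).hasDerivAt.tendsto_slope_zero
      have h2 : Tendsto (fun n : ℕ => ((δ / 2 / (n + 2) : ℝ) : ℂ)) atTop (𝓝[≠] 0) := by
        refine tendsto_nhdsWithin_iff.2 ⟨?_, Eventually.of_forall fun n => ?_⟩
        · have h3 : Tendsto (fun n : ℕ => δ / 2 / ((n : ℝ) + 2)) atTop (𝓝 0) :=
            tendsto_const_nhds.div_atTop
              (tendsto_atTop_add_const_right _ _ tendsto_natCast_atTop_atTop)
          have := (Complex.continuous_ofReal.tendsto 0).comp h3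
          simpa [Function.comp_def] using this
        · have : δ / 2 / ((n : ℝ) + 2) ≠ 0 := by positivity
          exact Complex.ofReal_ne_zero.2 this
      simpa [Function.comp_def, smul_eq_mul] using h1.comp h2
    have hmem : ∀ n : ℕ, ζ₀ + ((δ / 2 / (n + 2) : ℝ) : ℂ) ∈ U := by
      intro n
      refine hδU ?_
      rw [Metric.mem_ball, dist_eq_norm, add_sub_cancel_left, Complex.norm_real,
        Real.norm_of_nonneg (by positivity), div_lt_iff₀ (by positivity)]
      have : (0 : ℝ) ≤ n := by positivity
      nlinarith
    have key := hasDerivAt_integral_of_dominated_loc_of_deriv_le (𝕜 := ℂ) (μ := volume)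
      (F := fun ζ ξ => Φ (L ξ ζ)) (F' := fun ζ ξ => deriv (fun ζ => Φ (L ξ ζ)) ζ)
      (bound := fun ξ => A * ((1 + T * ‖η‖) ^ (d + 1) * ((1 + ‖ξ‖) ^ (d + 1))⁻¹) / (δ / 4))
      (x₀ := ζ₀) (Metric.ball_mem_nhds ζ₀ hδ2)
      ((hU.eventually_mem hζ₀).mono fun ζ hζ => (hcont ζ hζ).aestronglyMeasurable)
      (((integrable_one_add_norm_pow.const_mul ((1 + T * ‖η‖) ^ (d + 1))).const_mul A).mono'
        (hcont ζ₀ hζ₀).aestronglyMeasurable (Eventually.of_forall fun ξ =>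
          hbd ξ ζ₀ hζ₀ T (hT ζ₀ (Metric.mem_ball_self hδ))))
      (aestronglyMeasurable_of_tendsto_ae atTop
        (fun n => ((continuous_const.mul ((hcont _ (hmem n)).sub
          (hcont _ hζ₀)))).aestronglyMeasurable) (Eventually.of_forall hlim))
      (Eventually.of_forall fun ξ ζ hζ => ?_)
      (((integrable_one_add_norm_pow.const_mul ((1 + T * ‖η‖) ^ (d + 1))).const_mul A).div_const _)
      (Eventually.of_forall fun ξ ζ hζ => (hdiff ξ ζ (hδU (Metric.ball_subset_ball
        (by linarith) hζ))).hasDerivAt)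
    · exact ⟨_, key.2⟩
    · refine Complex.norm_deriv_le_of_forall_mem_sphere_norm_le (by positivity)
        (DifferentiableOn.diffContOnCl ?_) ?_
      · rw [closure_ball _ (by positivity)]
        exact fun s hs => (hdiff ξ s (hδU (hsub ζ hζ hs))).differentiableWithinAt
      · intro s hs
        have hs' := hsub ζ hζ (Metric.sphere_subset_closedBall hs)
        exact hbd ξ s (hδU hs') T (hT s hs')
  -- Translation invariance of Lebesgue measure makes `H` constant in real directions. Its complex
  -- derivative therefore vanishes, and `H` is constant on the segment from `0` to `i`. No contour
  -- integral is needed.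
  have htrans : ∀ ζ (τ : ℝ), H (ζ + τ) = H ζ := by
    intro ζ τ
    simp only [H]
    rw [← integral_add_right_eq_self (fun ξ => Φ (L ξ ζ)) (τ • η)]
    congr 1
    funext ξ
    congr 1
    funext i
    simp only [L, PiLp.add_apply, PiLp.smul_apply, smul_eq_mul]
    push_cast
    ring
  have hzero : ∀ ζ ∈ U, HasDerivAt H 0 ζ := by
    intro ζ hζ
    obtain ⟨H', hH'⟩ := hderiv ζ hζ
    have h1 : HasDerivAt (fun τ : ℝ => H (ζ + τ)) H' 0 := by
      have h2 : HasDerivAt (fun τ : ℝ => ζ + (τ : ℂ)) 1 0 :=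
        (Complex.ofRealCLM.hasDerivAt (x := (0 : ℝ))).const_add ζ
      have h3 := HasDerivAt.scomp_of_eq (𝕜 := ℝ) (𝕜' := ℂ) (x := (0 : ℝ)) hH' h2 (by simp)
      simpa [Function.comp_def] using h3
    simp only [htrans] at h1
    have := h1.unique (hasDerivAt_const (0 : ℝ) (H ζ))
    rwa [this] at hH'
  have hIU : ∀ t ∈ Set.Icc (0 : ℝ) 1, Complex.I * t ∈ U := by
    intro t ht
    have : |(Complex.I * (t : ℂ)).im| ≤ 1 := by
      simp [abs_of_nonneg ht.1, ht.2]
    exact (mul_le_of_le_one_left (norm_nonneg _) this).trans_lt hη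
  have hpath : ∀ t ∈ Set.Icc (0 : ℝ) 1, HasDerivAt (fun t : ℝ => H (Complex.I * t)) 0 t := by
    intro t ht
    have h2 : HasDerivAt (fun τ : ℝ => Complex.I * (τ : ℂ)) (Complex.I * 1) t :=
      (Complex.ofRealCLM.hasDerivAt (x := t)).const_mul Complex.I
    have h3 := HasDerivAt.scomp_of_eq (𝕜 := ℝ) (𝕜' := ℂ) (x := t) (hzero _ (hIU t ht)) h2 rfl
    simpa [Function.comp_def] using h3
  have hconst := constant_of_has_deriv_right_zero (f := fun t : ℝ => H (Complex.I * t))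
    (a := 0) (b := 1) (fun t ht => (hpath t ht).continuousAt.continuousWithinAt)
    (fun t ht => (hpath t ⟨ht.1, ht.2.le⟩).hasDerivWithinAt) 1 (by simp)
  have e1 : ∀ ξ, L ξ (Complex.I * (1 : ℝ)) = cpt ξ η := by
    intro ξ; rw [hL]; simp
  have e0 : ∀ ξ, L ξ (Complex.I * (0 : ℝ)) = cpt ξ 0 := by
    intro ξ; rw [hL]; simp
  simpa only [H, e1, e0] using hconst

/-- The bilinear pairing of `ℂ^d` and `ℝ^d`. -/
noncomputable def cdot (z : Fin d → ℂ) (x : EuclideanSpace ℝ (Fin d)) : ℂ := ∑ i, z i * (x i : ℂ)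

/-- The inverse Fourier transform of the restriction of `Φ` to `ℝ^d`. -/
noncomputable def kernel (Φ : (Fin d → ℂ) → ℂ) (x : EuclideanSpace ℝ (Fin d)) : ℂ :=
  ∫ ξ : EuclideanSpace ℝ (Fin d),
    Complex.exp (2 * Real.pi * Complex.I * cdot (cpt ξ 0) x) * Φ (cpt ξ 0)

theorem cdot_cpt (ξ η x : EuclideanSpace ℝ (Fin d)) :
    cdot (cpt ξ η) x = (inner ℝ ξ x : ℝ) + Complex.I * (inner ℝ η x : ℝ) := by
  simp only [cdot, cpt, PiLp.inner_apply, RCLike.inner_apply, conj_trivial]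
  push_cast
  rw [Finset.mul_sum, ← Finset.sum_add_distrib]
  exact Finset.sum_congr rfl fun i _ => by ring

theorem norm_exp_cdot (ξ η x : EuclideanSpace ℝ (Fin d)) :
    ‖Complex.exp (2 * Real.pi * Complex.I * cdot (cpt ξ η) x)‖ =
      Real.exp (-(2 * Real.pi * inner ℝ η x)) := by
  rw [Complex.norm_exp, cdot_cpt]
  congr 1
  simp

theorem norm_exp_cdot_zero (ξ x : EuclideanSpace ℝ (Fin d)) :
    ‖Complex.exp (2 * Real.pi * Complex.I * cdot (cpt ξ 0) x)‖ = 1 := by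
  rw [norm_exp_cdot]; simp

/-- The integral `∫ (1 + |x|)^{-d-1} dx`. -/
noncomputable def japaneseConst (d : ℕ) : ℝ :=
  ∫ x : EuclideanSpace ℝ (Fin d), ((1 + ‖x‖) ^ (d + 1))⁻¹

theorem japaneseConst_nonneg : 0 ≤ japaneseConst d := integral_nonneg fun _ => by positivity

/-- Exponential decay of the kernel of a function that is holomorphic on a strip. -/
theorem StripBound.norm_kernel_le {σ A : ℝ} {Φ : (Fin d → ℂ) → ℂ} (h : StripBound σ A Φ)
    {s : ℝ} (hs : 0 ≤ s) (hsσ : s < σ) (x : EuclideanSpace ℝ (Fin d)) :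
    ‖kernel Φ x‖ ≤ A * japaneseConst d * Real.exp (-(2 * Real.pi * s * ‖x‖)) := by
  have hσ : 0 < σ := hs.trans_lt hsσ
  have hA := h.nonneg hσ
  -- The plane of integration is moved by a vector of length at most `s` parallel to `x`, where the
  -- exponential has modulus `exp(-2π s ‖x‖)`.
  obtain ⟨η, hη, hηx⟩ : ∃ η : EuclideanSpace ℝ (Fin d), ‖η‖ ≤ s ∧ inner ℝ η x = s * ‖x‖ := by
    by_cases hx : x = 0
    · exact ⟨0, by simpa using hs, by simp [hx]⟩
    · have hx' : ‖x‖ ≠ 0 := norm_ne_zero_iff.2 hx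
      refine ⟨(s / ‖x‖) • x, ?_, ?_⟩
      · rw [norm_smul, Real.norm_of_nonneg (by positivity), div_mul_cancel₀ _ hx']
      · rw [real_inner_smul_left, real_inner_self_eq_norm_sq]
        field_simp
  have hησ : ‖η‖ < σ := hη.trans_lt hsσ
  -- This crude constant, which grows with `x`, serves only to justify the shift. The sharp estimate
  -- is made on the shifted plane.
  have h2 : StripBound σ (A * Real.exp (2 * Real.pi * σ * ‖x‖))
      (fun z => Complex.exp (2 * Real.pi * Complex.I * cdot z x) * Φ z) := by
    constructor
    · intro ξ η hη
      refine DifferentiableAt.mul ?_ (h.diff ξ η hη)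
      unfold cdot
      fun_prop
    · intro ξ η hη
      rw [norm_mul, norm_exp_cdot]
      calc _ ≤ Real.exp (2 * Real.pi * σ * ‖x‖) * (A * ((1 + ‖ξ‖) ^ (d + 1))⁻¹) := by
            gcongr
            · have h3 : -(inner ℝ η x) ≤ σ * ‖x‖ := by
                calc -(inner ℝ η x) ≤ |inner ℝ η x| := neg_le_abs _
                  _ ≤ ‖η‖ * ‖x‖ := abs_real_inner_le_norm _ _
                  _ ≤ σ * ‖x‖ := by gcongr
              nlinarith [Real.pi_pos]
            · exact h.bound ξ η hη
        _ = _ := by ring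
  have h3 := h2.integral_shift hησ
  unfold kernel
  rw [← h3]
  have h4 : Integrable fun ξ : EuclideanSpace ℝ (Fin d) =>
      A * Real.exp (-(2 * Real.pi * s * ‖x‖)) * ((1 + ‖ξ‖) ^ (d + 1))⁻¹ :=
    integrable_one_add_norm_pow.const_mul _
  refine (norm_integral_le_of_norm_le h4 (Eventually.of_forall fun ξ => ?_)).trans (le_of_eq ?_)
  · rw [norm_mul, norm_exp_cdot, hηx]
    calc _ ≤ Real.exp (-(2 * Real.pi * (s * ‖x‖))) * (A * ((1 + ‖ξ‖) ^ (d + 1))⁻¹) := by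
          gcongr
          exact h.bound ξ η hησ
      _ = _ := by ring_nf
  · rw [integral_const_mul, japaneseConst]
    ring

theorem continuous_exp_cdot (x : EuclideanSpace ℝ (Fin d)) : Continuous
    fun ξ : EuclideanSpace ℝ (Fin d) =>
      Complex.exp (2 * Real.pi * Complex.I * cdot (cpt ξ 0) x) := by
  unfold cdot cpt
  fun_prop

theorem StripBound.continuous_kernel {σ A : ℝ} {Φ : (Fin d → ℂ) → ℂ} (h : StripBound σ A Φ)
    (hσ : 0 < σ) : Continuous (kernel Φ) := by
  have h0 : ‖(0 : EuclideanSpace ℝ (Fin d))‖ < σ := by simpa using hσ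
  unfold kernel
  refine continuous_of_dominated (bound := fun ξ => ‖Φ (cpt ξ 0)‖)
    (fun x => ((continuous_exp_cdot x).mul (h.continuous h0)).aestronglyMeasurable)
    (fun x => Eventually.of_forall fun ξ => ?_) (h.integrable h0).norm
    (Eventually.of_forall fun ξ => ?_)
  · rw [norm_mul, norm_exp_cdot_zero, one_mul]
  · unfold cdot
    fun_prop

/-- The derivative of a kernel. -/
theorem hasLineDerivAt_kernel {σ A A' : ℝ} {Φ : (Fin d → ℂ) → ℂ} (h : StripBound σ A Φ)
    (hσ : 0 < σ) (i : Fin d)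
    (h' : StripBound σ A' fun z => 2 * Real.pi * Complex.I * z i * Φ z)
    (x : EuclideanSpace ℝ (Fin d)) :
    HasLineDerivAt ℝ (kernel Φ) (kernel (fun z => 2 * Real.pi * Complex.I * z i * Φ z) x) x
      (stdVec i) := by
  have h0 : ‖(0 : EuclideanSpace ℝ (Fin d))‖ < σ := by simpa using hσ
  unfold HasLineDerivAt
  have hc : ∀ ξ : EuclideanSpace ℝ (Fin d), ∀ t : ℝ,
      cdot (cpt ξ 0) (x + t • stdVec i) = cdot (cpt ξ 0) x + t * cpt ξ 0 i := by
    intro ξ t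
    simp only [cdot, PiLp.add_apply, PiLp.smul_apply, smul_eq_mul, Complex.ofReal_add, mul_add,
      Finset.sum_add_distrib]
    congr 1
    rw [Finset.sum_eq_single i]
    · simp; ring
    · intro j _ hj
      simp [hj]
    · simp
  have key := hasDerivAt_integral_of_dominated_loc_of_deriv_le (𝕜 := ℝ) (μ := volume)
    (F := fun (t : ℝ) (ξ : EuclideanSpace ℝ (Fin d)) =>
      Complex.exp (2 * Real.pi * Complex.I * cdot (cpt ξ 0) (x + t • stdVec i)) * Φ (cpt ξ 0))
    (F' := fun (t : ℝ) (ξ : EuclideanSpace ℝ (Fin d)) =>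
      Complex.exp (2 * Real.pi * Complex.I * cdot (cpt ξ 0) (x + t • stdVec i)) *
        (2 * Real.pi * Complex.I * cpt ξ 0 i * Φ (cpt ξ 0)))
    (bound := fun ξ => ‖2 * Real.pi * Complex.I * cpt ξ 0 i * Φ (cpt ξ 0)‖)
    (x₀ := (0 : ℝ)) (s := Set.univ) Filter.univ_mem
    (Eventually.of_forall fun t =>
      ((continuous_exp_cdot _).mul (h.continuous h0)).aestronglyMeasurable)
    ((h.integrable h0).norm.mono'
      ((continuous_exp_cdot _).mul (h.continuous h0)).aestronglyMeasurable
      (Eventually.of_forall fun ξ => by rw [norm_mul, norm_exp_cdot_zero, one_mul]))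
    ((continuous_exp_cdot _).mul (h'.continuous h0)).aestronglyMeasurable
    (Eventually.of_forall fun ξ t _ => by rw [norm_mul, norm_exp_cdot_zero, one_mul])
    (h'.integrable h0).norm
    (Eventually.of_forall fun ξ t _ => ?_)
  · have := key.2
    simpa [kernel] using this
  · simp only [hc]
    have h1 : HasDerivAt (fun t : ℝ => 2 * Real.pi * Complex.I *
        (cdot (cpt ξ 0) x + t * cpt ξ 0 i)) (2 * Real.pi * Complex.I * (1 * cpt ξ 0 i)) t := by
      refine HasDerivAt.const_mul _ (HasDerivAt.const_add _ ?_)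
      exact (Complex.ofRealCLM.hasDerivAt (x := t)).mul_const _
    refine (h1.cexp.mul_const (Φ (cpt ξ 0))).congr_deriv ?_
    ring

end Strip

/-! ### Rapidly decreasing holomorphic functions on strips -/

section Rapid

variable {d : ℕ}

/-- Holomorphic functions on the strip `|Im z| < σ` that decrease rapidly. -/
structure Rapid (σ : ℝ) (Φ : (Fin d → ℂ) → ℂ) : Prop where
  diff : ∀ ξ η : EuclideanSpace ℝ (Fin d), ‖η‖ < σ → DifferentiableAt ℂ Φ (cpt ξ η)
  bound : ∀ n : ℕ, ∃ A, ∀ ξ η : EuclideanSpace ℝ (Fin d), ‖η‖ < σ →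
    ‖Φ (cpt ξ η)‖ ≤ A * ((1 + ‖ξ‖) ^ n)⁻¹

variable {σ : ℝ} {Φ Ψ : (Fin d → ℂ) → ℂ}

theorem Rapid.stripBound (h : Rapid σ Φ) : ∃ A, StripBound σ A Φ := by
  obtain ⟨A, hA⟩ := h.bound (d + 1)
  exact ⟨A, h.diff, hA⟩

theorem Rapid.mono {σ' : ℝ} (h : Rapid σ Φ) (hσ : σ' ≤ σ) : Rapid σ' Φ :=
  ⟨fun ξ η hη => h.diff ξ η (hη.trans_le hσ), fun n => by
    obtain ⟨A, hA⟩ := h.bound n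
    exact ⟨A, fun ξ η hη => hA ξ η (hη.trans_le hσ)⟩⟩

/-- The multiplier only has to be holomorphic on the strip, so the lemma also covers the reciprocals
of polynomials without zeros there. -/
theorem Rapid.mul_poly (h : Rapid σ Φ) {g : (Fin d → ℂ) → ℂ}
    (hg : ∀ ξ η : EuclideanSpace ℝ (Fin d), ‖η‖ < σ → DifferentiableAt ℂ g (cpt ξ η))
    {C : ℝ} {k : ℕ} (hC : ∀ ξ η : EuclideanSpace ℝ (Fin d), ‖η‖ < σ →
      ‖g (cpt ξ η)‖ ≤ C * (1 + ‖ξ‖) ^ k) : Rapid σ fun z => g z * Φ z := by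
  refine ⟨fun ξ η hη => (hg ξ η hη).mul (h.diff ξ η hη), fun n => ?_⟩
  obtain ⟨A, hA⟩ := h.bound (n + k)
  refine ⟨C * A, fun ξ η hη => ?_⟩
  have hp : (0 : ℝ) < 1 + ‖ξ‖ := by positivity
  rw [norm_mul]
  calc ‖g (cpt ξ η)‖ * ‖Φ (cpt ξ η)‖
      ≤ (C * (1 + ‖ξ‖) ^ k) * (A * ((1 + ‖ξ‖) ^ (n + k))⁻¹) :=
        mul_le_mul (hC ξ η hη) (hA ξ η hη) (norm_nonneg _)
          ((norm_nonneg _).trans (hC ξ η hη))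
    _ = C * A * ((1 + ‖ξ‖) ^ n)⁻¹ := by
        rw [pow_add]; field_simp

theorem Rapid.const_mul (h : Rapid σ Φ) (c : ℂ) : Rapid σ fun z => c * Φ z :=
  h.mul_poly (g := fun _ => c) (C := ‖c‖) (k := 0) (fun _ _ _ => differentiableAt_const _)
    (fun _ _ _ => by simp)

theorem differentiable_coord (i : Fin d) : Differentiable ℂ fun z : Fin d → ℂ => z i := by
  fun_prop

theorem norm_cpt_le (ξ η : EuclideanSpace ℝ (Fin d)) (i : Fin d) :
    ‖cpt ξ η i‖ ≤ ‖ξ‖ + ‖η‖ := by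
  unfold cpt
  refine (norm_add_le _ _).trans (add_le_add ?_ ?_)
  · rw [Complex.norm_real]; exact PiLp.norm_apply_le ξ i
  · rw [norm_mul, Complex.norm_I, one_mul, Complex.norm_real]; exact PiLp.norm_apply_le η i

theorem Rapid.coord_mul (h : Rapid σ Φ) (i : Fin d) :
    Rapid σ fun z => 2 * Real.pi * Complex.I * z i * Φ z := by
  have h1 : Rapid σ fun z => z i * Φ z := by
    refine h.mul_poly (k := 1) (C := 1 + σ) (fun ξ η _ => (differentiable_coord i).differentiableAt)
      fun ξ η hη => (norm_cpt_le ξ η i).trans ?_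
    have := norm_nonneg η
    rw [pow_one]
    nlinarith [norm_nonneg ξ]
  simpa only [mul_assoc] using h1.const_mul (2 * Real.pi * Complex.I)

theorem Rapid.add (h : Rapid σ Φ) (h' : Rapid σ Ψ) : Rapid σ fun z => Φ z + Ψ z := by
  refine ⟨fun ξ η hη => (h.diff ξ η hη).add (h'.diff ξ η hη), fun n => ?_⟩
  obtain ⟨A, hA⟩ := h.bound n
  obtain ⟨A', hA'⟩ := h'.bound n
  refine ⟨A + A', fun ξ η hη => (norm_add_le _ _).trans ?_⟩
  rw [add_mul]
  exact add_le_add (hA ξ η hη) (hA' ξ η hη)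

theorem Rapid.sub (h : Rapid σ Φ) (h' : Rapid σ Ψ) : Rapid σ fun z => Φ z - Ψ z := by
  simpa [sub_eq_add_neg] using h.add (h'.const_mul (-1))

theorem Rapid.sum {ι : Type*} (s : Finset ι) {F : ι → (Fin d → ℂ) → ℂ} (h : ∀ i, Rapid σ (F i)) :
    Rapid σ fun z => ∑ i ∈ s, F i z := by
  classical
  induction s using Finset.induction_on with
  | empty =>
    exact ⟨fun ξ η _ => by simp, fun n => ⟨0, by simp⟩⟩
  | insert i s hi ih =>
    simp only [Finset.sum_insert hi]
    exact (h i).add ih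

theorem Rapid.coord_pow_mul (h : Rapid σ Φ) (i : Fin d) (n : ℕ) :
    Rapid σ fun z => (2 * Real.pi * Complex.I * z i) ^ n * Φ z := by
  induction n with
  | zero => simpa using h
  | succ n ih => simpa only [pow_succ', mul_assoc] using ih.coord_mul i

/-- The symbol of `∂^α`. -/
noncomputable def monSymbol (α : Fin d → ℕ) (z : Fin d → ℂ) : ℂ :=
  ∏ i, (2 * Real.pi * Complex.I * z i) ^ α i

theorem monSymbol_add_single (α : Fin d → ℕ) (i : Fin d) (z : Fin d → ℂ) :
    monSymbol (α + Pi.single i 1) z = 2 * Real.pi * Complex.I * z i * monSymbol α z := by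
  unfold monSymbol
  simp only [Pi.add_apply, pow_add, Finset.prod_mul_distrib]
  rw [mul_comm]
  congr 1
  rw [Finset.prod_eq_single i]
  · simp
  · intro j _ hj
    simp [hj]
  · simp

theorem monSymbol_zero (z : Fin d → ℂ) : monSymbol 0 z = 1 := by simp [monSymbol]

theorem Rapid.monSymbol_mul (h : Rapid σ Φ) (α : Fin d → ℕ) :
    Rapid σ fun z => monSymbol α z * Φ z := by
  have : ∀ s : Finset (Fin d), Rapid σ fun z =>
      (∏ i ∈ s, (2 * Real.pi * Complex.I * z i) ^ α i) * Φ z := by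
    intro s
    induction s using Finset.induction_on with
    | empty => simpa using h
    | insert i s hi ih =>
      simp only [Finset.prod_insert hi, mul_assoc]
      simpa only [mul_assoc] using ih.coord_pow_mul i (α i)
  exact this Finset.univ

theorem isPartialFamily_kernel (h : Rapid σ Φ) (hσ : 0 < σ) :
    IsPartialFamily fun α => kernel fun z => monSymbol α z * Φ z := by
  constructor
  · intro α
    obtain ⟨A, hA⟩ := (h.monSymbol_mul α).stripBound
    exact hA.continuous_kernel hσ
  · intro α i x
    obtain ⟨A, hA⟩ := (h.monSymbol_mul α).stripBound
    obtain ⟨A', hA'⟩ := ((h.monSymbol_mul α).coord_mul i).stripBound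
    have := hasLineDerivAt_kernel hA hσ i hA' x
    simpa only [monSymbol_add_single, mul_assoc] using this

/-- A constant in the estimate of the exponential moments of kernels. -/
noncomputable def momentConst (d : ℕ) : ℝ :=
  japaneseConst d * ∫ x : EuclideanSpace ℝ (Fin d), Real.exp (-(1 * ‖x‖))

theorem momentConst_nonneg : 0 ≤ momentConst d :=
  mul_nonneg japaneseConst_nonneg (integral_nonneg fun _ => by positivity)

/-- A shift by `(κ+1)/(2π)` gives the kernel the decay `exp(-(κ+1)‖x‖)`, which leaves an integrable
`exp(-‖x‖)`. The bound is linear in `A`, so a small symbol yields a small operator on functions of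
type `κ`. -/
theorem StripBound.moment {A : ℝ} (h : StripBound σ A Φ) {κ : ℝ} (hκ : 0 ≤ κ)
    (hκσ : κ + 1 < 2 * Real.pi * σ) :
    Integrable (fun x => ‖kernel Φ x‖ * Real.exp (κ * ‖x‖)) ∧
      ∫ x, ‖kernel Φ x‖ * Real.exp (κ * ‖x‖) ≤ A * momentConst d := by
  have hpi := Real.pi_pos
  have hs : (κ + 1) / (2 * Real.pi) < σ := by
    rw [div_lt_iff₀ (by positivity)]; linarith
  have hσ : 0 < σ := lt_of_le_of_lt (by positivity) hs
  have hb : ∀ x, ‖kernel Φ x‖ * Real.exp (κ * ‖x‖) ≤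
      A * japaneseConst d * Real.exp (-(1 * ‖x‖)) := by
    intro x
    have h1 := h.norm_kernel_le (s := (κ + 1) / (2 * Real.pi)) (by positivity) hs x
    have e : 2 * Real.pi * ((κ + 1) / (2 * Real.pi)) * ‖x‖ = (κ + 1) * ‖x‖ := by field_simp
    rw [e] at h1
    calc _ ≤ (A * japaneseConst d * Real.exp (-((κ + 1) * ‖x‖))) * Real.exp (κ * ‖x‖) := by gcongr
      _ = _ := by rw [mul_assoc, ← Real.exp_add]; ring_nf
  have hi := (integrable_exp_neg_norm (d := d) one_pos).const_mul (A * japaneseConst d)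
  have hint : Integrable (fun x => ‖kernel Φ x‖ * Real.exp (κ * ‖x‖)) := by
    refine hi.mono' ?_ (Eventually.of_forall fun x => ?_)
    · have := h.continuous_kernel hσ
      exact Continuous.aestronglyMeasurable (by fun_prop)
    · rw [Real.norm_of_nonneg (by positivity)]
      exact hb x
  refine ⟨hint, (integral_mono hint hi hb).trans (le_of_eq ?_)⟩
  rw [integral_const_mul, momentConst]
  ring

theorem hasExpMoments_kernel (h : ∀ σ, Rapid σ Φ) : HasExpMoments (kernel Φ) := by
  refine ⟨?_, fun κ => ?_⟩
  · obtain ⟨A, hA⟩ := (h 1).stripBound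
    exact (hA.continuous_kernel one_pos).aestronglyMeasurable
  · obtain ⟨A, hA⟩ := (h (|κ| + 2)).stripBound
    have hi := (hA.moment (abs_nonneg κ) (by
      nlinarith [Real.pi_gt_three, abs_nonneg κ])).1
    refine hi.mono' ?_ (Eventually.of_forall fun x => ?_)
    · have := hA.continuous_kernel (by positivity)
      exact Continuous.aestronglyMeasurable (by fun_prop)
    · rw [Real.norm_of_nonneg (by positivity)]
      gcongr
      exact le_abs_self κ

/-! ### Pairing of kernels with families of derivatives -/

/-- Families of derivatives of scalar functions of exponential type `κ`. -/
structure ExpFamily (κ : ℝ) (u : (Fin d → ℕ) → EuclideanSpace ℝ (Fin d) → ℂ) : Prop where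
  family : IsPartialFamily u
  bound : ∀ α, ∃ C, ∀ x, ‖u α x‖ ≤ C * Real.exp (κ * ‖x‖)

/-- The operator `∑ᵢ ∂ᵢ^L` on families indexed by multi-indices. -/
noncomputable def jetOp (d L : ℕ) (X : Type*) [AddCommGroup X] [Module ℝ X] :
    Module.End ℝ ((Fin d → ℕ) → X) where
  toFun u α := ∑ i, u (α + Pi.single i L)
  map_add' u v := by
    funext α
    simp [Finset.sum_add_distrib]
  map_smul' c u := by
    funext α
    simp [Finset.smul_sum]

theorem jetOp_apply (L : ℕ) {X : Type*} [AddCommGroup X] [Module ℝ X] (u : (Fin d → ℕ) → X)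
    (α : Fin d → ℕ) : jetOp d L X u α = ∑ i, u (α + Pi.single i L) := rfl

/-- The symbol of the operator `∑ᵢ ∂ᵢ^L`. -/
noncomputable def symbol (L : ℕ) (z : Fin d → ℂ) : ℂ := ∑ i, (2 * Real.pi * Complex.I * z i) ^ L

variable {κ : ℝ} {u v : (Fin d → ℕ) → EuclideanSpace ℝ (Fin d) → ℂ}

theorem ExpFamily.add (hu : ExpFamily κ u) (hv : ExpFamily κ v) : ExpFamily κ (u + v) := by
  refine ⟨⟨fun α => (hu.family.continuous α).add (hv.family.continuous α), fun α i x =>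
    HasDerivAt.add (hu.family.hasLineDerivAt α i x) (hv.family.hasLineDerivAt α i x)⟩, fun α => ?_⟩
  obtain ⟨C, hC⟩ := hu.bound α
  obtain ⟨C', hC'⟩ := hv.bound α
  refine ⟨C + C', fun x => (norm_add_le _ _).trans ?_⟩
  rw [add_mul]
  exact add_le_add (hC x) (hC' x)

theorem ExpFamily.smul (hu : ExpFamily κ u) (c : ℝ) : ExpFamily κ (c • u) := by
  refine ⟨⟨fun α => (hu.family.continuous α).const_smul c, fun α i x =>
    HasDerivAt.const_smul c (hu.family.hasLineDerivAt α i x)⟩, fun α => ?_⟩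
  obtain ⟨C, hC⟩ := hu.bound α
  refine ⟨|c| * C, fun x => ?_⟩
  rw [Pi.smul_apply, Pi.smul_apply, norm_smul, Real.norm_eq_abs, mul_assoc]
  exact mul_le_mul_of_nonneg_left (hC x) (abs_nonneg c)

theorem ExpFamily.shift (hu : ExpFamily κ u) (β : Fin d → ℕ) :
    ExpFamily κ fun α => u (α + β) := by
  refine ⟨⟨fun α => hu.family.continuous _, fun α i x => ?_⟩, fun α => hu.bound _⟩
  have := hu.family.hasLineDerivAt (α + β) i x
  rwa [add_right_comm] at this

theorem ExpFamily.jetOp (hu : ExpFamily κ u) (L : ℕ) : ExpFamily κ (jetOp d L _ u) := by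
  have h : ∀ s : Finset (Fin d), ExpFamily κ fun α => ∑ i ∈ s, u (α + Pi.single i L) := by
    intro s
    induction s using Finset.induction_on with
    | empty =>
      have := hu.smul 0
      rw [zero_smul] at this
      exact this
    | insert i s hi ih =>
      simp only [Finset.sum_insert hi]
      exact (hu.shift _).add ih
  exact h Finset.univ

theorem ExpFamily.integrable (hu : ExpFamily κ u) (h : Rapid σ Φ) (hκ : 0 ≤ κ)
    (hκσ : κ + 1 < 2 * Real.pi * σ) (α : Fin d → ℕ) :
    Integrable fun x => kernel Φ x * u α x := by
  obtain ⟨A, hA⟩ := h.stripBound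
  obtain ⟨C, hC⟩ := hu.bound α
  have hσ : 0 < σ := by
    by_contra hneg
    nlinarith [Real.pi_pos]
  exact integrable_mul_of_expBound (hA.continuous_kernel hσ).aestronglyMeasurable
    (hA.moment hκ hκσ).1 (hu.family.continuous α) hC

/-- Integration by parts. There are no boundary terms, because the kernels decay faster than the
functions of type `κ` grow. -/
theorem ExpFamily.integral_coord (hu : ExpFamily κ u) (h : Rapid σ Φ) (hκ : 0 ≤ κ)
    (hκσ : κ + 1 < 2 * Real.pi * σ) (α : Fin d → ℕ) (i : Fin d) :
    ∫ x, kernel (fun z => 2 * Real.pi * Complex.I * z i * Φ z) x * u α x =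
      -∫ x, kernel Φ x * u (α + Pi.single i 1) x := by
  have hσ : 0 < σ := by
    by_contra hneg
    nlinarith [Real.pi_pos]
  obtain ⟨A, hA⟩ := h.stripBound
  obtain ⟨A', hA'⟩ := (h.coord_mul i).stripBound
  have := integral_bilinear_hasLineDerivAt_right_eq_neg_left_of_integrable (μ := volume)
    (f := kernel Φ) (f' := kernel (fun z => 2 * Real.pi * Complex.I * z i * Φ z))
    (g := u α) (g' := u (α + Pi.single i 1)) (v := stdVec i)
    (B := ContinuousLinearMap.mul ℝ ℂ)
    (hu.integrable (h.coord_mul i) hκ hκσ α) (hu.integrable h hκ hκσ _)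
    (hu.integrable h hκ hκσ α) (fun x _ => hasLineDerivAt_kernel hA hσ i hA' x)
    (fun x _ => hu.family.hasLineDerivAt α i x)
  simp only [ContinuousLinearMap.mul_apply'] at this
  rw [this, neg_neg]

theorem ExpFamily.integral_coord_pow (hu : ExpFamily κ u) (h : Rapid σ Φ) (hκ : 0 ≤ κ)
    (hκσ : κ + 1 < 2 * Real.pi * σ) (α : Fin d → ℕ) (i : Fin d) (n : ℕ) :
    ∫ x, kernel (fun z => (2 * Real.pi * Complex.I * z i) ^ n * Φ z) x * u α x =
      (-1) ^ n * ∫ x, kernel Φ x * u (α + Pi.single i n) x := by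
  induction n generalizing α with
  | zero => simp
  | succ n ih =>
    have h1 := hu.integral_coord (h.coord_pow_mul i n) hκ hκσ α i
    simp only [pow_succ', ← mul_assoc] at h1 ⊢
    rw [h1, ih, add_assoc, ← Pi.single_add, add_comm 1 n]
    ring

theorem kernel_add {A B : ℝ} (hσ : 0 < σ) (h : StripBound σ A Φ) (h' : StripBound σ B Ψ) :
    kernel (fun z => Φ z + Ψ z) = kernel Φ + kernel Ψ := by
  funext x
  have h0 : ‖(0 : EuclideanSpace ℝ (Fin d))‖ < σ := by simpa using hσ
  have hi : ∀ {A : ℝ} {Φ : (Fin d → ℂ) → ℂ}, StripBound σ A Φ → Integrable fun ξ =>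
      Complex.exp (2 * Real.pi * Complex.I * cdot (cpt ξ 0) x) * Φ (cpt ξ 0) := fun h =>
    (h.integrable h0).norm.mono'
      ((continuous_exp_cdot _).mul (h.continuous h0)).aestronglyMeasurable
      (Eventually.of_forall fun ξ => by rw [norm_mul, norm_exp_cdot_zero, one_mul])
  simp only [kernel, Pi.add_apply, mul_add]
  exact integral_add (hi h) (hi h')

theorem kernel_const_mul (c : ℂ) (x : EuclideanSpace ℝ (Fin d)) :
    kernel (fun z => c * Φ z) x = c * kernel Φ x := by
  simp only [kernel]
  rw [← integral_const_mul]
  congr 1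
  funext ξ
  ring

theorem kernel_sum {ι : Type*} (s : Finset ι) {F : ι → (Fin d → ℂ) → ℂ} (hσ : 0 < σ)
    (h : ∀ i, Rapid σ (F i)) :
    kernel (fun z => ∑ i ∈ s, F i z) = fun x => ∑ i ∈ s, kernel (F i) x := by
  classical
  induction s using Finset.induction_on with
  | empty => funext x; simp [kernel]
  | insert i s hi ih =>
    obtain ⟨A, hA⟩ := (h i).stripBound
    obtain ⟨B, hB⟩ := (Rapid.sum s h).stripBound
    simp only [Finset.sum_insert hi]
    rw [kernel_add hσ hA hB, ih]
    rfl

theorem Rapid.symbol_mul (h : Rapid σ Φ) (L : ℕ) : Rapid σ fun z => symbol L z * Φ z := by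
  simp only [symbol, Finset.sum_mul]
  exact Rapid.sum _ fun i => h.coord_pow_mul i L

/-- The evenness of `L` removes the signs of the `L` integrations by parts, so the symbol on the
kernel side and the operator on the side of the derivatives are the same polynomial. -/
theorem ExpFamily.integral_symbol (hu : ExpFamily κ u) (h : Rapid σ Φ) (hκ : 0 ≤ κ)
    (hκσ : κ + 1 < 2 * Real.pi * σ) {L : ℕ} (hL : Even L) (α : Fin d → ℕ) :
    ∫ x, kernel (fun z => symbol L z * Φ z) x * u α x =
      ∫ x, kernel Φ x * UltraVectors.jetOp d L _ u α x := by
  have hσ : 0 < σ := by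
    by_contra hneg
    nlinarith [Real.pi_pos]
  simp only [symbol, Finset.sum_mul, jetOp_apply, Finset.sum_apply, Finset.mul_sum]
  rw [kernel_sum _ hσ fun i => h.coord_pow_mul i L]
  simp only [Finset.sum_mul]
  rw [integral_finsetSum _ fun i _ => hu.integrable (h.coord_pow_mul i L) hκ hκσ α,
    integral_finsetSum _ fun i _ => hu.integrable h hκ hκσ _]
  refine Finset.sum_congr rfl fun i _ => ?_
  rw [hu.integral_coord_pow h hκ hκσ, hL.neg_one_pow, one_mul]

theorem Rapid.aeval_mul (h : Rapid σ Φ) (L : ℕ) (p : Polynomial ℝ) :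
    Rapid σ fun z => Polynomial.aeval (symbol L z) p * Φ z := by
  induction p using Polynomial.induction_on generalizing Φ with
  | C a => simpa using h.const_mul (a : ℂ)
  | add p q hp hq =>
    simp only [map_add, add_mul]
    exact (hp h).add (hq h)
  | monomial n a ih =>
    simp only [pow_succ, ← mul_assoc, map_mul _ _ Polynomial.X, Polynomial.aeval_X]
    simpa only [mul_assoc] using ih (h.symbol_mul L)

theorem ExpFamily.aeval (hu : ExpFamily κ u) (L : ℕ) (p : Polynomial ℝ) :
    ExpFamily κ (Polynomial.aeval (UltraVectors.jetOp d L _) p u) := by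
  induction p using Polynomial.induction_on generalizing u with
  | C a => simpa [Module.algebraMap_end_apply] using hu.smul a
  | add p q hp hq =>
    simp only [map_add, LinearMap.add_apply]
    exact (hp hu).add (hq hu)
  | monomial n a ih =>
    simp only [pow_succ, ← mul_assoc, map_mul _ _ Polynomial.X, Polynomial.aeval_X,
      Module.End.mul_apply]
    exact ih (hu.jetOp L)

/-- Integration by parts for polynomials in the operator `∑ᵢ ∂ᵢ^L`. -/
theorem ExpFamily.integral_aeval (hu : ExpFamily κ u) (h : Rapid σ Φ) (hκ : 0 ≤ κ)
    (hκσ : κ + 1 < 2 * Real.pi * σ) {L : ℕ} (hL : Even L) (p : Polynomial ℝ) (α : Fin d → ℕ) :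
    ∫ x, kernel (fun z => Polynomial.aeval (symbol L z) p * Φ z) x * u α x =
      ∫ x, kernel Φ x * Polynomial.aeval (UltraVectors.jetOp d L _) p u α x := by
  have hσ : 0 < σ := by
    by_contra hneg
    nlinarith [Real.pi_pos]
  induction p using Polynomial.induction_on generalizing u Φ with
  | C a =>
    simp only [Polynomial.aeval_C, Complex.coe_algebraMap, kernel_const_mul,
      Module.algebraMap_end_apply, Pi.smul_apply]
    congr 1
    funext x
    rw [Complex.real_smul]
    ring
  | add p q hp hq =>
    obtain ⟨A, hA⟩ := (h.aeval_mul L p).stripBound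
    obtain ⟨B, hB⟩ := (h.aeval_mul L q).stripBound
    simp only [map_add, add_mul, LinearMap.add_apply, Pi.add_apply, mul_add]
    rw [kernel_add hσ hA hB, integral_add ((hu.aeval L p).integrable h hκ hκσ α)
      ((hu.aeval L q).integrable h hκ hκσ α), ← hp hu h, ← hq hu h]
    simp only [Pi.add_apply, add_mul]
    exact integral_add (hu.integrable (h.aeval_mul L p) hκ hκσ α)
      (hu.integrable (h.aeval_mul L q) hκ hκσ α)
  | monomial n a ih =>
    simp only [pow_succ, ← mul_assoc, map_mul _ _ Polynomial.X, Polynomial.aeval_X,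
      Module.End.mul_apply]
    rw [← ih (hu.jetOp L) h, ← ExpFamily.integral_symbol hu (h.aeval_mul L _) hκ hκσ hL]
    congr 1
    funext x
    congr 2
    funext z
    ring

end Rapid

/-! ### Inversion, convolution and dilation of kernels -/

section Inversion

variable {d : ℕ} {Φ Ψ : (Fin d → ℂ) → ℂ}

open FourierTransform in
theorem kernel_eq_fourierInv (Φ : (Fin d → ℂ) → ℂ) :
    kernel Φ = 𝓕⁻ (fun ξ : EuclideanSpace ℝ (Fin d) => Φ (cpt ξ 0)) := by
  funext x
  rw [Real.fourierInv_eq', kernel]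
  congr 1
  funext ξ
  rw [cdot_cpt, smul_eq_mul]
  congr 2
  simp
  ring

open FourierTransform in
/-- Fourier inversion for kernels. -/
theorem integral_exp_kernel (h : ∀ σ, Rapid σ Φ) (ξ : EuclideanSpace ℝ (Fin d)) :
    ∫ x, Complex.exp (-(2 * Real.pi * Complex.I * cdot (cpt ξ 0) x)) * kernel Φ x =
      Φ (cpt ξ 0) := by
  obtain ⟨A, hA⟩ := (h 1).stripBound
  have h0 : ‖(0 : EuclideanSpace ℝ (Fin d))‖ < 1 := by simp
  have hi := (hasExpMoments_kernel h).norm_integrable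
  have hF : Integrable (𝓕 fun ξ : EuclideanSpace ℝ (Fin d) => Φ (cpt ξ 0)) := by
    rw [kernel_eq_fourierInv] at hi
    have := hi.comp_neg
    refine this.congr (Eventually.of_forall fun x => ?_)
    simp only [Real.fourierInv_eq_fourier_neg, neg_neg]
  have key := (hA.continuous h0).fourier_fourierInv_eq (hA.integrable h0) hF
  have := congrFun key ξ
  rw [← kernel_eq_fourierInv, Real.fourier_eq'] at this
  rw [← this]
  congr 1
  funext x
  rw [cdot_cpt, smul_eq_mul]
  congr 2
  simp [real_inner_comm]
  ring

theorem integral_kernel (h : ∀ σ, Rapid σ Φ) : ∫ x, kernel Φ x = Φ 0 := by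
  have h1 := integral_exp_kernel h 0
  have h2 : cpt (0 : EuclideanSpace ℝ (Fin d)) 0 = 0 := by funext i; simp [cpt]
  simpa [h2, cdot] using h1

/-- Insert the Fourier integral of the second kernel, interchange the integrals, and recognize the
inversion formula for `Ψ`. -/
theorem kernel_convolution (hΨ : ∀ σ, Rapid σ Ψ) (hΦ : ∀ σ, Rapid σ Φ)
    (w : EuclideanSpace ℝ (Fin d)) :
    ∫ x, kernel Ψ x * kernel Φ (w - x) = kernel (fun z => Ψ z * Φ z) w := by
  obtain ⟨A, hA⟩ := (hΦ 1).stripBound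
  have h0 : ‖(0 : EuclideanSpace ℝ (Fin d))‖ < 1 := by simp
  have hΨi := (hasExpMoments_kernel hΨ).norm_integrable
  have hsplit : ∀ ξ x : EuclideanSpace ℝ (Fin d),
      Complex.exp (2 * Real.pi * Complex.I * cdot (cpt ξ 0) (w - x)) =
        Complex.exp (2 * Real.pi * Complex.I * cdot (cpt ξ 0) w) *
          Complex.exp (-(2 * Real.pi * Complex.I * cdot (cpt ξ 0) x)) := by
    intro ξ x
    rw [← Complex.exp_add, cdot_cpt, cdot_cpt, cdot_cpt, inner_sub_right, inner_sub_right]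
    push_cast
    ring_nf
  have hint : Integrable (Function.uncurry fun (x ξ : EuclideanSpace ℝ (Fin d)) =>
      kernel Ψ x * (Complex.exp (2 * Real.pi * Complex.I * cdot (cpt ξ 0) (w - x)) *
        Φ (cpt ξ 0))) (volume.prod volume) := by
    have h1 := hΨi.mul_prod (hA.integrable h0)
    refine h1.norm.mono' ?_ (Eventually.of_forall fun p => ?_)
    · have h2 : Continuous fun p : EuclideanSpace ℝ (Fin d) × EuclideanSpace ℝ (Fin d) =>
          Complex.exp (2 * Real.pi * Complex.I * cdot (cpt p.2 0) (w - p.1)) := by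
        unfold cdot cpt
        fun_prop
      have := h1.aestronglyMeasurable.mul h2.aestronglyMeasurable
      refine this.congr (Eventually.of_forall fun p => ?_)
      simp only [Function.uncurry, Pi.mul_apply]
      ring
    · simp only [Function.uncurry]
      rw [norm_mul, norm_mul, norm_mul, norm_exp_cdot_zero, one_mul]
  have e1 : ∀ x, kernel Ψ x * kernel Φ (w - x) = ∫ ξ : EuclideanSpace ℝ (Fin d),
      kernel Ψ x * (Complex.exp (2 * Real.pi * Complex.I * cdot (cpt ξ 0) (w - x)) *
        Φ (cpt ξ 0)) := by
    intro x
    rw [integral_const_mul, kernel.eq_1 Φ]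
  simp only [e1]
  rw [integral_integral_swap hint, kernel]
  congr 1
  funext ξ
  rw [← integral_exp_kernel hΨ ξ, ← integral_mul_const, ← integral_const_mul]
  congr 1
  funext x
  rw [hsplit]
  ring

/-- Fubini's theorem applies because `exp(κ‖w‖) ≤ exp(κ‖x‖) exp(κ‖w - x‖)` dominates the integrand
by a convolution of integrable functions. -/
theorem integral_integral_shift {f g u : EuclideanSpace ℝ (Fin d) → ℂ} (hf : HasExpMoments f)
    (hg : HasExpMoments g) (hu : Continuous u) {C κ : ℝ} (hκ : 0 ≤ κ)
    (hC : ∀ x, ‖u x‖ ≤ C * Real.exp (κ * ‖x‖)) :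
    ∫ x, f x * ∫ y, g y * u (x + y) = ∫ w, (∫ x, f x * g (w - x)) * u w := by
  have hC0 : 0 ≤ C := by
    have := (norm_nonneg _).trans (hC 0)
    simpa using this
  have e1 : ∀ x, f x * ∫ y, g y * u (x + y) = ∫ w, f x * (g (w - x) * u w) := by
    intro x
    rw [← integral_sub_right_eq_self (fun y => g y * u (x + y)) x, integral_const_mul]
    simp only [add_sub_cancel]
  simp only [e1]
  have hm := (hf.norm_integrable.convolution_integrand (ContinuousLinearMap.mul ℝ ℂ)
    hg.norm_integrable).aestronglyMeasurable
  have hb := ((hf.integrable κ).convolution_integrand (ContinuousLinearMap.mul ℝ ℝ)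
    (hg.integrable κ)).const_mul C
  have hint : Integrable (fun p : EuclideanSpace ℝ (Fin d) × EuclideanSpace ℝ (Fin d) =>
      f p.2 * (g (p.1 - p.2) * u p.1)) (volume.prod volume) := by
    refine hb.mono' ?_ (Eventually.of_forall fun p => ?_)
    · refine (hm.mul (hu.comp continuous_fst).aestronglyMeasurable).congr
        (Eventually.of_forall fun p => ?_)
      simp [mul_assoc]
    · simp only [ContinuousLinearMap.mul_apply', norm_mul]
      have h1 : Real.exp (κ * ‖p.1‖) ≤
          Real.exp (κ * ‖p.2‖) * Real.exp (κ * ‖p.1 - p.2‖) := by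
        rw [← Real.exp_add]
        refine Real.exp_le_exp.2 ?_
        have := norm_add_le p.2 (p.1 - p.2)
        rw [add_sub_cancel] at this
        nlinarith
      calc ‖f p.2‖ * (‖g (p.1 - p.2)‖ * ‖u p.1‖)
          ≤ ‖f p.2‖ * (‖g (p.1 - p.2)‖ * (C * (Real.exp (κ * ‖p.2‖) *
              Real.exp (κ * ‖p.1 - p.2‖)))) := by
            gcongr
            exact (hC p.1).trans (mul_le_mul_of_nonneg_left h1 hC0)
        _ = _ := by ring
  rw [integral_integral_swap (f := fun x w => f x * (g (w - x) * u w)) hint.swap]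
  congr 1
  funext w
  rw [← integral_mul_const]
  simp only [mul_assoc]

/-- Tested weakly, this is the rule that composing operators `Π` multiplies their symbols. -/
theorem integral_kernel_kernel (hΨ : ∀ σ, Rapid σ Ψ) (hΦ : ∀ σ, Rapid σ Φ)
    {u : EuclideanSpace ℝ (Fin d) → ℂ} (hu : Continuous u) {C κ : ℝ} (hκ : 0 ≤ κ)
    (hC : ∀ x, ‖u x‖ ≤ C * Real.exp (κ * ‖x‖)) :
    ∫ x, kernel Ψ x * ∫ y, kernel Φ y * u (x + y) =
      ∫ w, kernel (fun z => Ψ z * Φ z) w * u w := by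
  rw [integral_integral_shift (hasExpMoments_kernel hΨ) (hasExpMoments_kernel hΦ) hu hκ hC]
  simp only [kernel_convolution hΨ hΦ]

theorem kernel_dilation {s : ℝ} (hs : 0 < s) (x : EuclideanSpace ℝ (Fin d)) :
    kernel (fun z => Φ fun i => s * z i) x = (s ^ d)⁻¹ * kernel Φ (s⁻¹ • x) := by
  have h1 := Measure.integral_comp_smul (volume : Measure (EuclideanSpace ℝ (Fin d)))
    (fun ξ => Complex.exp (2 * Real.pi * Complex.I * cdot (cpt ξ 0) (s⁻¹ • x)) * Φ (cpt ξ 0)) s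
  rw [finrank_euclideanSpace_fin, abs_of_pos (by positivity), Complex.real_smul] at h1
  rw [kernel, kernel]
  rw [← h1]
  congr 1
  funext ξ
  have hs' : (s : ℂ) ≠ 0 := Complex.ofReal_ne_zero.2 hs.ne'
  congr 3
  · simp only [cdot_cpt, inner_smul_left, inner_smul_right, inner_zero_left]
    push_cast
    simp
    field_simp
  · funext i
    simp [cpt]

theorem integral_kernel_dilation {s : ℝ} (hs : 0 < s) (u : EuclideanSpace ℝ (Fin d) → ℂ) :
    ∫ x, kernel (fun z => Φ fun i => s * z i) x * u x = ∫ y, kernel Φ y * u (s • y) := by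
  have h1 := Measure.integral_comp_smul (volume : Measure (EuclideanSpace ℝ (Fin d)))
    (fun y => kernel Φ y * u (s • y)) s⁻¹
  rw [finrank_euclideanSpace_fin, abs_of_pos (by positivity), Complex.real_smul] at h1
  have hsd : (s : ℂ) ^ d ≠ 0 := pow_ne_zero _ (Complex.ofReal_ne_zero.2 hs.ne')
  have h2 : ∫ x, kernel (fun z => Φ fun i => s * z i) x * u x =
      ((s : ℂ) ^ d)⁻¹ * ∫ x, kernel Φ (s⁻¹ • x) * u x := by
    rw [← integral_const_mul]
    simp only [kernel_dilation hs, mul_assoc]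
    push_cast
    rfl
  rw [h2]
  simp only [smul_smul, mul_inv_cancel₀ hs.ne', one_smul] at h1
  rw [h1, ← mul_assoc]
  push_cast
  rw [inv_pow, inv_inv, inv_mul_cancel₀ hsd, one_mul]

/-- Approximate identities formed by dilations of a kernel. -/
theorem tendsto_integral_kernel_dilation (h : ∀ σ, Rapid σ Φ)
    {u : EuclideanSpace ℝ (Fin d) → ℂ} (hu : Continuous u) {C κ : ℝ} (hκ : 0 ≤ κ)
    (hC : ∀ x, ‖u x‖ ≤ C * Real.exp (κ * ‖x‖)) {s : ℕ → ℝ} (hs : ∀ n, 0 < s n)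
    (hs0 : Tendsto s atTop (𝓝 0)) :
    Tendsto (fun n => ∫ x, kernel (fun z => Φ fun i => s n * z i) x * u x) atTop
      (𝓝 (Φ 0 * u 0)) := by
  have hC0 : 0 ≤ C := by
    have := (norm_nonneg _).trans (hC 0)
    simpa using this
  have hm := hasExpMoments_kernel h
  simp only [integral_kernel_dilation (hs _), ← integral_kernel h]
  rw [← integral_mul_const]
  refine tendsto_integral_filter_of_dominated_convergence
    (fun y => C * (‖kernel Φ y‖ * Real.exp (κ * ‖y‖)))
    (Eventually.of_forall fun n => hm.meas.mul
      (hu.comp (continuous_const_smul (s n))).aestronglyMeasurable)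
    ?_ ((hm.integrable κ).const_mul C) (Eventually.of_forall fun y => ?_)
  · filter_upwards [hs0.eventually (gt_mem_nhds one_pos)] with n hn
    refine Eventually.of_forall fun y => ?_
    rw [norm_mul]
    have h1 : ‖s n • y‖ ≤ ‖y‖ := by
      rw [norm_smul, Real.norm_of_nonneg (hs n).le]
      exact mul_le_of_le_one_left (norm_nonneg _) hn.le
    calc ‖kernel Φ y‖ * ‖u (s n • y)‖ ≤ ‖kernel Φ y‖ * (C * Real.exp (κ * ‖y‖)) := by
          gcongr
          exact (hC _).trans (by gcongr)
      _ = _ := by ring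
  · refine Tendsto.const_mul _ ?_
    have h1 : Tendsto (fun n => s n • y) atTop (𝓝 ((0 : ℝ) • y)) := hs0.smul_const y
    rw [zero_smul] at h1
    exact (hu.tendsto 0).comp h1

end Inversion

/-! ### Regular weight sequences -/

section Weights

/-- The quotients `N_{j+1} / N_j`. -/
noncomputable def ratio (N : ℕ → ℝ) (j : ℕ) : ℝ := N (j + 1) / N j

theorem quotSeq_succ (N : ℕ → ℝ) (j : ℕ) : quotSeq N (j + 1) = ratio N j := rfl

/-- Log-convex weight sequences with `(M.2)` and `(M.2)^*`. -/
structure RegularWeight (N : ℕ → ℝ) : Prop where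
  pos : ∀ n, 0 < N n
  zero : N 0 = 1
  mono : Monotone (ratio N)
  m2 : CondM2 N
  star : CondM2Star N

theorem IsWeightSequence.regularWeight {M : ℕ → ℝ} (hM : IsWeightSequence M)
    (h2 : CondM2 M) (h2' : CondM2Star M) : RegularWeight M := by
  refine ⟨hM.pos, hM.zero, monotone_nat_of_le_succ fun n => ?_, h2, h2'⟩
  rw [ratio, ratio, div_le_div_iff₀ (hM.pos _) (hM.pos _), ← sq, mul_comm]
  exact hM.logConvex n

theorem eq_prod_ratio {N : ℕ → ℝ} (h : ∀ n, 0 < N n) (h0 : N 0 = 1) (n : ℕ) :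
    N n = ∏ j ∈ Finset.range n, ratio N j := by
  induction n with
  | zero => simpa using h0
  | succ n ih => rw [Finset.prod_range_succ, ← ih, ratio, mul_div_cancel₀ _ (h n).ne']

/-- Past a certain index every factor `r j` exceeds `R`, and the finitely many earlier quotients are
absorbed by the constant. -/
theorem pow_le_prod_of_tendsto {r : ℕ → ℝ} (hr : ∀ j, 0 < r j) (h : Tendsto r atTop atTop)
    {R : ℝ} (hR : 0 ≤ R) :
    ∃ C : ℝ, 0 < C ∧ ∀ n, R ^ n ≤ C * ∏ j ∈ Finset.range n, r j := by
  obtain ⟨n₀, hn₀⟩ := eventually_atTop.1 (h.eventually_ge_atTop R)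
  have hp : ∀ n, 0 < ∏ j ∈ Finset.range n, r j := fun n => Finset.prod_pos fun j _ => hr j
  let C := 1 + ∑ n ∈ Finset.range (n₀ + 1), R ^ n / ∏ j ∈ Finset.range n, r j
  have hnn : ∀ n, 0 ≤ R ^ n / ∏ j ∈ Finset.range n, r j := fun n =>
    div_nonneg (pow_nonneg hR n) (hp n).le
  have hC : 0 < C := by
    have := Finset.sum_nonneg fun n (_ : n ∈ Finset.range (n₀ + 1)) => hnn n
    simp only [C]; linarith
  refine ⟨C, hC, fun n => ?_⟩
  by_cases hn : n ≤ n₀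
  · rw [← div_le_iff₀ (hp n)]
    have := Finset.single_le_sum (fun n (_ : n ∈ Finset.range (n₀ + 1)) => hnn n)
      (Finset.mem_range.2 (Nat.lt_succ_of_le hn))
    simp only [C]; linarith
  · push Not at hn
    induction n, hn.le using Nat.le_induction with
    | base => exact absurd hn (lt_irrefl _)
    | succ n hn' ih =>
      have h1 : R ^ n ≤ C * ∏ j ∈ Finset.range n, r j := by
        rcases hn'.eq_or_lt with h | h
        · subst h
          rw [← div_le_iff₀ (hp n₀)]
          have := Finset.single_le_sum (fun n (_ : n ∈ Finset.range (n₀ + 1)) => hnn n)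
            (Finset.mem_range.2 (Nat.lt_succ_self n₀))
          simp only [C]; linarith
        · exact ih h
      rw [pow_succ, Finset.prod_range_succ, ← mul_assoc]
      exact mul_le_mul h1 (hn₀ n hn') hR (by have := hp n; positivity)

variable {N : ℕ → ℝ}

theorem RegularWeight.ratio_pos (h : RegularWeight N) (j : ℕ) : 0 < ratio N j :=
  div_pos (h.pos _) (h.pos _)

/-- Iteration of `(M.2)^*`. Enlarging its integer by one makes the base at least `2`, as needed to
count scales by a logarithm. The shift `p - 1` translates `m_p` into `ratio N (p - 1)`. -/
theorem RegularWeight.exists_two_pow_mul_ratio_le (h : RegularWeight N) :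
    ∃ p₀ k : ℕ, 1 ≤ p₀ ∧ 2 ≤ k ∧ ∀ i p : ℕ, p₀ ≤ p →
      2 ^ i * ratio N (p - 1) ≤ ratio N (k ^ i * p - 1) := by
  obtain ⟨p₀, k, hp₀, hk, hs⟩ := h.star
  have key : ∀ p, 1 ≤ p → quotSeq N p = ratio N (p - 1) := by
    intro p hp
    obtain ⟨q, rfl⟩ := Nat.exists_eq_add_of_le' hp
    rfl
  refine ⟨p₀, k + 1, hp₀, by omega, fun i => ?_⟩
  induction i with
  | zero => intro p _; simp
  | succ i ih =>
    intro p hp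
    have hp1 : 1 ≤ p := hp₀.trans hp
    have h1 := hs p hp
    rw [key p hp1, key (k * p) (Nat.mul_pos hk hp1)] at h1
    have h2 : ratio N (k * p - 1) ≤ ratio N ((k + 1) * p - 1) :=
      h.mono (Nat.sub_le_sub_right (Nat.mul_le_mul_right _ (Nat.le_succ k)) 1)
    have h3 := ih ((k + 1) * p) (hp.trans (Nat.le_mul_of_pos_left _ (Nat.succ_pos k)))
    rw [← mul_assoc, ← pow_succ] at h3
    refine le_trans ?_ h3
    rw [pow_succ, mul_assoc]
    exact mul_le_mul_of_nonneg_left (h1.trans h2) (by positivity)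

theorem RegularWeight.tendsto_ratio (h : RegularWeight N) : Tendsto (ratio N) atTop atTop := by
  obtain ⟨p₀, k, hp₀, hk, hs⟩ := h.exists_two_pow_mul_ratio_le
  refine tendsto_atTop_atTop_of_monotone h.mono fun b => ?_
  have h0 := h.ratio_pos (p₀ - 1)
  obtain ⟨i, hi⟩ := pow_unbounded_of_one_lt (b / ratio N (p₀ - 1)) one_lt_two
  refine ⟨_, le_trans ?_ (hs i p₀ le_rfl)⟩
  exact ((div_lt_iff₀ h0).1 hi).le

/-- The quotients of a regular weight sequence grow so fast that a power of them is summable, with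
good control of the tails. -/
theorem RegularWeight.exists_ratio_pow_le (h : RegularWeight N) :
    ∃ L₀ : ℕ, ∃ K : ℝ, 0 < K ∧ ∀ L, L₀ ≤ L → ∀ k j, k ≤ j →
      (ratio N k / ratio N j) ^ L ≤ K * ((k + 1) / (j + 1)) ^ 2 := by
  obtain ⟨p₀, b, hp₀, hb, hs⟩ := h.exists_two_pow_mul_ratio_le
  -- Per factor `b` in the index the quotients gain a factor `2`. With `2^L ≥ b²` the `L`-th powers
  -- gain at least the square of the change of index.
  obtain ⟨L₀, hL₀⟩ := pow_unbounded_of_one_lt ((b : ℝ) ^ 2) one_lt_two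
  have hbr : (2 : ℝ) ≤ b := by exact_mod_cast hb
  have hp₀r : (1 : ℝ) ≤ p₀ := by exact_mod_cast hp₀
  have main : ∀ L, L₀ ≤ L → ∀ k j, k ≤ j → p₀ ≤ k + 1 →
      (ratio N k / ratio N j) ^ L ≤ (b : ℝ) ^ 2 * ((k + 1) / (j + 1)) ^ 2 := by
    intro L hL k j hkj hk
    -- The number of `b`-adic scales between `k + 1` and `j + 1`.
    obtain ⟨i, hi⟩ : ∃ i, i = Nat.log b ((j + 1) / (k + 1)) := ⟨_, rfl⟩
    have hq : (j + 1) / (k + 1) ≠ 0 := (Nat.div_pos (by omega) (by omega)).ne'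
    have h1 : b ^ i * (k + 1) ≤ j + 1 := by
      rw [← Nat.le_div_iff_mul_le (by omega), hi]
      exact Nat.pow_log_le_self b hq
    have h2 : j + 1 < b ^ (i + 1) * (k + 1) := by
      rw [← Nat.div_lt_iff_lt_mul (by omega), hi]
      exact Nat.lt_pow_succ_log_self (by omega) _
    have h3 : 2 ^ i * ratio N k ≤ ratio N j := by
      refine (hs i (k + 1) hk).trans (h.mono ?_)
      omega
    have hk0 := h.ratio_pos k
    have hj0 := h.ratio_pos j
    have h4 : ratio N k / ratio N j ≤ (2 ^ i)⁻¹ := by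
      rw [div_le_iff₀ hj0, le_inv_mul_iff₀ (by positivity)]
      exact h3
    have h2' : ((j : ℝ) + 1) ≤ b ^ (i + 1) * (k + 1) := by exact_mod_cast h2.le
    calc (ratio N k / ratio N j) ^ L ≤ ((2 ^ i)⁻¹) ^ L := by gcongr
      _ = ((2 ^ L) ^ i)⁻¹ := by rw [inv_pow, ← pow_mul, ← pow_mul, mul_comm]
      _ ≤ (((b : ℝ) ^ 2) ^ i)⁻¹ := by
          gcongr
          exact hL₀.le.trans (pow_le_pow_right₀ one_le_two hL)
      _ = (b : ℝ) ^ 2 * (((b : ℝ) ^ (i + 1))⁻¹) ^ 2 := by field_simp; ring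
      _ ≤ (b : ℝ) ^ 2 * ((k + 1) / (j + 1)) ^ 2 := by
          gcongr
          rw [inv_le_iff_one_le_mul₀ (by positivity), div_mul_eq_mul_div, one_le_div (by positivity)]
          linarith
  refine ⟨L₀, (b : ℝ) ^ 2 * p₀ ^ 2, by positivity, fun L hL k j hkj => ?_⟩
  have hle1 : ratio N k / ratio N j ≤ 1 := (div_le_one (h.ratio_pos j)).2 (h.mono hkj)
  have hnn : 0 ≤ ratio N k / ratio N j := (div_pos (h.ratio_pos k) (h.ratio_pos j)).le
  -- Indices below `p₀`, where `(M.2)^*` says nothing, cost a factor `p₀²`: `k` is replaced by `p₀ -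
  -- 1`, or else both indices are small and the quotient is at most `1`.
  by_cases hk : p₀ ≤ k + 1
  · refine (main L hL k j hkj hk).trans ?_
    refine mul_le_mul_of_nonneg_right ?_ (by positivity)
    exact le_mul_of_one_le_right (by positivity) (one_le_pow₀ hp₀r)
  · push Not at hk
    by_cases hj : p₀ ≤ j + 1
    · obtain ⟨q, rfl⟩ := Nat.exists_eq_add_of_le' hp₀
      have h1 := main L hL q j (by omega) (by omega)
      calc (ratio N k / ratio N j) ^ L ≤ (ratio N q / ratio N j) ^ L := by
            have := h.ratio_pos j
            gcongr
            exact h.mono (by omega)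
        _ ≤ _ := h1
        _ = (b : ℝ) ^ 2 * (q + 1) ^ 2 * (1 / (j + 1)) ^ 2 := by ring
        _ ≤ _ := by
            push_cast
            gcongr
            linarith [(Nat.cast_nonneg k : (0 : ℝ) ≤ k)]
    · push Not at hj
      have hjr : (j : ℝ) + 1 ≤ p₀ := by exact_mod_cast hj.le
      have h5 : (1 : ℝ) ≤ b * p₀ * ((k + 1) / (j + 1)) := by
        rw [mul_div_assoc', one_le_div (by positivity)]
        have : (0 : ℝ) ≤ k := Nat.cast_nonneg k
        nlinarith [mul_nonneg this (by positivity : (0 : ℝ) ≤ b * p₀)]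
      calc (ratio N k / ratio N j) ^ L ≤ 1 := pow_le_one₀ hnn hle1
        _ ≤ (b * p₀ * ((k + 1) / (j + 1)) : ℝ) ^ 2 := one_le_pow₀ h5
        _ = _ := by ring

/-- Telescoping, from `1/x² ≤ 2/x - 2/(x+1)` for `x ≥ 1`. -/
theorem sum_inv_sq_le (k n : ℕ) :
    ∑ j ∈ Finset.range n, (1 / ((k + j : ℕ) + 1 : ℝ)) ^ 2 ≤
      2 / ((k : ℝ) + 1) - 2 / (k + n + 1) := by
  induction n with
  | zero => simp
  | succ n ih =>
    rw [Finset.sum_range_succ]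
    have hx : (0 : ℝ) < (k : ℝ) + n + 1 := by positivity
    have h1 : (1 / ((k + n : ℕ) + 1 : ℝ)) ^ 2 ≤ 2 / ((k : ℝ) + n + 1) - 2 / (k + (n + 1 : ℕ) + 1) := by
      push_cast
      have h2 : 2 / ((k : ℝ) + n + 1) - 2 / (k + (n + 1) + 1) =
          2 / (((k : ℝ) + n + 1) * (k + (n + 1) + 1)) := by
        field_simp; ring
      rw [h2, one_div, inv_pow, inv_eq_one_div, div_le_div_iff₀ (by positivity) (by positivity)]
      have : (0 : ℝ) ≤ (k : ℝ) + n := by positivity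
      nlinarith
    linarith

theorem RegularWeight.pow_le (h : RegularWeight N) {R : ℝ} (hR : 0 ≤ R) :
    ∃ C, 0 < C ∧ ∀ n, R ^ n ≤ C * N n := by
  obtain ⟨C, hC, hCn⟩ := pow_le_prod_of_tendsto h.ratio_pos h.tendsto_ratio hR
  refine ⟨C, hC, fun n => ?_⟩
  rw [eq_prod_ratio h.pos h.zero]
  exact hCn n

theorem RegularWeight.ratio_pow_le (h : RegularWeight N) (k n : ℕ) :
    ratio N k ^ n * N k ≤ N (k + n) := by
  induction n with
  | zero => simp
  | succ n ih =>
    have h1 : N (k + (n + 1)) = ratio N (k + n) * N (k + n) := by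
      rw [ratio, div_mul_cancel₀ _ (h.pos _).ne']; rfl
    rw [h1, pow_succ', mul_assoc]
    exact mul_le_mul (h.mono (by omega)) ih
      (by have := h.ratio_pos k; have := h.pos k; positivity) (h.ratio_pos _).le

theorem RegularWeight.exists_mul_le (h : RegularWeight N) (L : ℕ) :
    ∃ C B : ℝ, 1 ≤ C ∧ 1 ≤ B ∧ ∀ n, N (L * n) ≤ C * B ^ n * N n ^ L := by
  obtain ⟨C₀, H, hC₀, hH, h2⟩ := h.m2
  induction L with
  | zero => exact ⟨1, 1, le_rfl, le_rfl, fun n => by simp [h.zero]⟩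
  | succ L ih =>
    obtain ⟨C, B, hC, hB, hb⟩ := ih
    refine ⟨C₀ * C, H ^ (L + 1) * B, one_le_mul_of_one_le_of_one_le hC₀ hC,
      one_le_mul_of_one_le_of_one_le (one_le_pow₀ hH) hB, fun n => ?_⟩
    have h1 := h2 (L * n) n
    have hn := h.pos n
    rw [add_mul, one_mul]
    calc N (L * n + n) ≤ C₀ * H ^ (L * n + n) * N (L * n) * N n := h1
      _ ≤ C₀ * H ^ (L * n + n) * (C * B ^ n * N n ^ L) * N n := by
          have : 0 < C₀ := by linarith
          have : 0 < H := by linarith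
          gcongr
          exact hb n
      _ = _ := by
          rw [mul_pow, ← pow_mul, pow_succ (N n) L]
          ring

/-- Compare `νₖ^n Nₖ ≤ N_{k+n}`, from log-convexity, with `(M.2)` and cancel `Nₖ`. The loss `H^k` is
what the decay of `exp(-G)` has to make up for. -/
theorem RegularWeight.exists_ratio_pow_le_mul (h : RegularWeight N) :
    ∃ C H : ℝ, 1 ≤ C ∧ 1 ≤ H ∧ ∀ k n, ratio N k ^ n ≤ C * H ^ (k + n) * N n := by
  obtain ⟨C₀, H, hC₀, hH, h2⟩ := h.m2
  refine ⟨C₀, H, hC₀, hH, fun k n => ?_⟩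
  have h1 := (h.ratio_pow_le k n).trans (h2 k n)
  have hk := h.pos k
  refine le_of_mul_le_mul_right (h1.trans (le_of_eq ?_)) hk
  ring

/-! ### Bounds by all sequences of the class, and domination by a smaller weight -/

/-- The projective description of Roumieu classes. If no geometric bound holds, `a` exceeds
`(k+1)^{n+1}` at arbitrarily late `n` for each `k`. A sequence of `ℜ` that grows only after these
indices is then too small to bound `a`. -/
theorem exists_geometric_bound {a : ℕ → ℝ}
    (h : ∀ r : ℕ → ℝ, IsRSequence r → ∃ C, ∀ n, a n ≤ C * ∏ j ∈ Finset.range (n + 1), r j) :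
    ∃ C A : ℝ, 0 < C ∧ 1 ≤ A ∧ ∀ n, a n ≤ C * A ^ n := by
  by_contra hcon
  push Not at hcon
  have hfreq : ∀ k : ℕ, ∃ᶠ n in atTop, ((k : ℝ) + 1) ^ (n + 1) < a n := by
    intro k
    rw [frequently_atTop]
    intro n₀
    -- Adding `S` to the base of the power forces the witness `n` beyond the first `n₀` indices.
    let S := ∑ i ∈ Finset.range n₀, |a i|
    have hS : 0 ≤ S := Finset.sum_nonneg fun _ _ => abs_nonneg _
    obtain ⟨n, hn⟩ := hcon (k + 1 + S) (k + 1 + S) (by positivity) (by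
      have : (0 : ℝ) ≤ k := Nat.cast_nonneg k
      linarith)
    rw [← pow_succ'] at hn
    have hk1 : (1 : ℝ) ≤ k + 1 + S := by
      have : (0 : ℝ) ≤ k := Nat.cast_nonneg k
      linarith
    refine ⟨n, ?_, lt_of_le_of_lt ?_ hn⟩
    · by_contra hlt
      push Not at hlt
      have h1 := Finset.single_le_sum (fun i (_ : i ∈ Finset.range n₀) => abs_nonneg (a i))
        (Finset.mem_range.2 hlt)
      have h2 : k + 1 + S ≤ (k + 1 + S) ^ (n + 1) := le_self_pow₀ hk1 (by omega)
      have h3 := le_abs_self (a n)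
      have : (0 : ℝ) ≤ k := Nat.cast_nonneg k
      simp only [S] at *
      linarith
    · exact pow_le_pow_left₀ (by positivity) (by linarith) _
  obtain ⟨φ, hφ, hφa⟩ := extraction_forall_of_frequently hfreq
  -- The sequence counts the indices `φ i` already passed, with a delay that secures `r 0 = r 1 = 1`
  -- and `r j ≤ k + 1` for all `j ≤ φ k`.
  let r : ℕ → ℝ := fun j => 1 + ((Finset.range j).filter fun i => φ i + 1 < j).card
  have hr1 : ∀ j, 1 ≤ r j := fun j => by simp [r]
  have hr : IsRSequence r := by
    refine ⟨fun j => one_pos.trans_le (hr1 j), by simp [r], by simp [r], ?_, ?_⟩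
    · intro i j hij
      simp only [r]
      gcongr
      intro s hs
      simp only [Finset.mem_filter, Finset.mem_range] at hs ⊢
      omega
    · refine tendsto_atTop_atTop.2 fun b => ?_
      obtain ⟨m, hm⟩ := exists_nat_ge b
      refine ⟨φ m + 2, fun j hj => hm.trans ?_⟩
      have : Finset.range m ⊆ (Finset.range j).filter fun i => φ i + 1 < j := by
        intro s hs
        simp only [Finset.mem_filter, Finset.mem_range] at hs ⊢
        have h1 := hφ hs
        have h2 := hφ.id_le m
        simp only [id] at h2
        constructor <;> omega
      have h3 := Finset.card_le_card this
      rw [Finset.card_range] at h3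
      have h4 : (m : ℝ) ≤ _ := Nat.cast_le.2 h3
      simp only [r]
      linarith
  obtain ⟨C, hC⟩ := h r hr
  obtain ⟨k, hk⟩ := exists_nat_ge C
  have h1 := hφa k
  have h2 := hC (φ k)
  have hrk : ∀ j < φ k, r (j + 1) ≤ (k : ℝ) + 1 := by
    intro j hj
    have : ((Finset.range (j + 1)).filter fun i => φ i + 1 < j + 1) ⊆ Finset.range k := by
      intro s hs
      simp only [Finset.mem_filter, Finset.mem_range] at hs ⊢
      exact hφ.lt_iff_lt.1 (by omega)
    have h4 := Finset.card_le_card this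
    rw [Finset.card_range] at h4
    have h5 : ((_ : ℕ) : ℝ) ≤ k := Nat.cast_le.2 h4
    simp only [r]
    linarith
  clear_value r
  have h3 : ∏ j ∈ Finset.range (φ k + 1), r j ≤ ((k : ℝ) + 1) ^ φ k := by
    rw [Finset.prod_range_succ', hr.zero, mul_one]
    calc ∏ j ∈ Finset.range (φ k), r (j + 1) ≤ ∏ j ∈ Finset.range (φ k), ((k : ℝ) + 1) :=
          Finset.prod_le_prod (fun j _ => (hr.pos _).le) fun j hj => hrk j (Finset.mem_range.1 hj)
      _ = ((k : ℝ) + 1) ^ φ k := by rw [Finset.prod_const, Finset.card_range]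
  have h4 : 0 < ∏ j ∈ Finset.range (φ k + 1), r j := Finset.prod_pos fun j _ => hr.pos j
  have h5 : C * ∏ j ∈ Finset.range (φ k + 1), r j ≤ (k + 1) * ((k : ℝ) + 1) ^ φ k :=
    mul_le_mul (by linarith) h3 h4.le (by positivity)
  rw [pow_succ'] at h1
  linarith

/-- From some index `φ k` on, `b n (k+2)^n ≤ 1`. A sequence that reaches the value `k + 2` only from
`φ k` on has products that `b` still compensates. -/
theorem exists_slow_sequence {b : ℕ → ℝ} (hb : ∀ n, 0 ≤ b n)
    (h : ∀ s : ℝ, 0 < s → ∃ C, ∀ n, b n ≤ C * s ^ n) :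
    ∃ (r : ℕ → ℝ) (C : ℝ), (∀ j, 1 ≤ r j) ∧ Monotone r ∧ Tendsto r atTop atTop ∧
      ∀ n, b n * ∏ j ∈ Finset.range n, r j ≤ C := by
  have hev : ∀ k : ℕ, ∀ᶠ m in atTop, ∀ n ≥ m, b n * ((k : ℝ) + 2) ^ n ≤ 1 := by
    intro k
    obtain ⟨C, hC⟩ := h ((2 * ((k : ℝ) + 2))⁻¹) (by positivity)
    have h1 : Tendsto (fun n : ℕ => C * (1 / 2 : ℝ) ^ n) atTop (𝓝 (C * 0)) :=
      (tendsto_pow_atTop_nhds_zero_of_lt_one (by norm_num) (by norm_num)).const_mul C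
    rw [mul_zero] at h1
    refine (eventually_forall_ge_atTop.2 (h1.eventually (gt_mem_nhds one_pos))).mono
      fun m hm n hn => (le_trans ?_ (hm n hn).le)
    calc b n * ((k : ℝ) + 2) ^ n ≤ (C * ((2 * ((k : ℝ) + 2))⁻¹) ^ n) * ((k : ℝ) + 2) ^ n := by
          gcongr
          exact hC n
      _ = _ := by
          rw [mul_assoc, ← mul_pow]
          congr 2
          field_simp
  obtain ⟨φ, hφ, hφb⟩ := extraction_forall_of_eventually hev
  -- If `c n > 0`, then `φ (c n - 1) ≤ n`, which gives `b n (1 + c n)^n ≤ 1` because `(c n - 1) + 2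
  -- = 1 + c n`.
  let c : ℕ → ℕ := fun j => ((Finset.range (j + 1)).filter fun i => φ i ≤ j).card
  have hcmono : Monotone c := by
    intro i j hij
    refine Finset.card_le_card fun s hs => ?_
    simp only [Finset.mem_filter, Finset.mem_range] at hs ⊢
    omega
  obtain ⟨C₁, hC₁⟩ := h 1 one_pos
  refine ⟨fun j => 1 + c j, max C₁ 1, fun j => by simp, fun i j hij => ?_, ?_, fun n => ?_⟩
  · have : (c i : ℝ) ≤ c j := Nat.cast_le.2 (hcmono hij)
    simp only; linarith
  · refine tendsto_atTop_atTop.2 fun x => ?_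
    obtain ⟨m, hm⟩ := exists_nat_ge x
    refine ⟨φ m, fun j hj => hm.trans ?_⟩
    have : Finset.range m ⊆ (Finset.range (j + 1)).filter fun i => φ i ≤ j := by
      intro s hs
      simp only [Finset.mem_filter, Finset.mem_range] at hs ⊢
      have h1 := hφ hs
      have h2 := hφ.id_le m
      simp only [id] at h2
      constructor <;> omega
    have h3 := Finset.card_le_card this
    rw [Finset.card_range] at h3
    have h4 : (m : ℝ) ≤ c j := Nat.cast_le.2 h3
    linarith
  · have hprod : ∏ j ∈ Finset.range n, (1 + (c j : ℝ)) ≤ (1 + (c n : ℝ)) ^ n := by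
      calc _ ≤ ∏ j ∈ Finset.range n, (1 + (c n : ℝ)) := by
            refine Finset.prod_le_prod (fun j _ => by positivity) fun j hj => ?_
            have : (c j : ℝ) ≤ c n := Nat.cast_le.2 (hcmono (Finset.mem_range.1 hj).le)
            linarith
        _ = _ := by simp
    rcases Nat.eq_zero_or_pos (c n) with h0 | h0
    · rw [h0] at hprod
      have := hC₁ n
      rw [one_pow, mul_one] at this
      refine le_trans ?_ (this.trans (le_max_left _ _))
      exact mul_le_of_le_one_right (hb n) (by simpa using hprod)
    · have h1 : φ (c n - 1) ≤ n := by
        by_contra hlt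
        push Not at hlt
        have : ((Finset.range (n + 1)).filter fun i => φ i ≤ n) ⊆ Finset.range (c n - 1) := by
          intro s hs
          simp only [Finset.mem_filter, Finset.mem_range] at hs ⊢
          exact hφ.lt_iff_lt.1 (by omega)
        have h4 := Finset.card_le_card this
        rw [Finset.card_range] at h4
        change c n ≤ _ at h4
        omega
      have h2 := hφb (c n - 1) n h1
      have h3 : ((c n - 1 : ℕ) : ℝ) + 2 = 1 + c n := by
        rw [Nat.cast_sub h0]; push_cast; ring
      rw [h3] at h2
      exact (mul_le_mul_of_nonneg_left hprod (hb n)).trans (h2.trans (le_max_right _ _))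

/-- A sequence that is small compared with `M` is dominated by a regular weight sequence that is
small compared with `M`. -/
theorem RegularWeight.exists_smaller {M : ℕ → ℝ} (hM : RegularWeight M) {D : ℕ → ℝ}
    (hD : ∀ n, 0 ≤ D n) (h : ∀ s : ℝ, 0 < s → ∃ C, ∀ n, D n ≤ C * s ^ n * M n) :
    ∃ N : ℕ → ℝ, RegularWeight N ∧ (∃ C, 0 < C ∧ ∀ n, D n ≤ C * N n) ∧
      ∀ s : ℝ, 0 < s → ∃ C, 0 < C ∧ ∀ n, N n ≤ C * s ^ n * M n := by
  obtain ⟨r₀, C, hr₀1, hr₀m, hr₀t, hC⟩ := exists_slow_sequence (b := fun n => D n / M n)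
    (fun n => div_nonneg (hD n) (hM.pos n).le) fun s hs => by
      obtain ⟨C, hC⟩ := h s hs
      exact ⟨C, fun n => (div_le_iff₀ (hM.pos n)).2 (hC n)⟩
  let ν := ratio M
  have hν : ∀ j, 0 < ν j := hM.ratio_pos
  -- The infimum over `i` regularizes `r₀` from below so that `r j / r i ≤ √(ν j / ν i)` for `i ≤
  -- j`. The quotients `ν j / r j` of the new weight then grow at least like square roots of those
  -- of `M`, which saves log-convexity and `(M.2)^*`.
  let f : ℕ → ℕ → ℝ := fun j i => r₀ i * max 1 (Real.sqrt (ν j / ν i))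
  let r : ℕ → ℝ := fun j => ⨅ i, f j i
  have hf1 : ∀ j i, 1 ≤ f j i := fun j i =>
    one_le_mul_of_one_le_of_one_le (hr₀1 i) (le_max_left _ _)
  have hbdd : ∀ j, BddBelow (Set.range (f j)) := fun j => ⟨1, by rintro _ ⟨i, rfl⟩; exact hf1 j i⟩
  have hr1 : ∀ j, 1 ≤ r j := fun j => le_ciInf (hf1 j)
  have hr0 : ∀ j, 0 < r j := fun j => one_pos.trans_le (hr1 j)
  have hrr₀ : ∀ j, r j ≤ r₀ j := fun j => by
    refine (ciInf_le (hbdd j) j).trans (le_of_eq ?_)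
    simp [f, div_self (hν j).ne']
  have hrm : Monotone r := by
    intro i j hij
    refine ciInf_mono (hbdd i) fun s => ?_
    have := hM.mono hij
    have := hν s
    have := hr₀1 s
    simp only [f]
    gcongr
  have hratio : ∀ i j, i ≤ j → r j ≤ r i * Real.sqrt (ν j / ν i) := by
    intro i j hij
    have hs1 : 1 ≤ Real.sqrt (ν j / ν i) := by
      rw [Real.one_le_sqrt, one_le_div (hν i)]
      exact hM.mono hij
    rw [← div_le_iff₀ (by positivity)]
    refine le_ciInf fun s => ?_
    rw [div_le_iff₀ (by positivity)]
    refine (ciInf_le (hbdd j) s).trans ?_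
    simp only [f]
    rw [mul_assoc]
    refine mul_le_mul_of_nonneg_left ?_ (zero_le_one.trans (hr₀1 s))
    refine max_le ?_ ?_
    · exact one_le_mul_of_one_le_of_one_le (le_max_left _ _) hs1
    · refine le_trans (le_of_eq ?_) (mul_le_mul_of_nonneg_right (le_max_right 1 _) (by positivity))
      rw [← Real.sqrt_mul (div_pos (hν i) (hν s)).le]
      congr 1
      have := (hν i).ne'
      field_simp
  have hrt : Tendsto r atTop atTop := by
    refine tendsto_atTop_atTop_of_monotone hrm fun x => ?_
    obtain ⟨I, hI⟩ := (hr₀t.eventually_ge_atTop x).exists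
    obtain ⟨j, hj⟩ := (hM.tendsto_ratio.eventually_ge_atTop (x ^ 2 * ν I)).exists
    refine ⟨j, le_ciInf fun i => ?_⟩
    rcases le_total I i with hi | hi
    · calc x ≤ r₀ i := hI.trans (hr₀m hi)
        _ ≤ f j i := le_mul_of_one_le_right (zero_le_one.trans (hr₀1 i)) (le_max_left _ _)
    · calc x ≤ Real.sqrt (ν j / ν i) := by
            refine Real.le_sqrt_of_sq_le ?_
            rw [le_div_iff₀ (hν i)]
            exact (mul_le_mul_of_nonneg_left (hM.mono hi) (sq_nonneg x)).trans hj
        _ ≤ max 1 (Real.sqrt (ν j / ν i)) := le_max_right _ _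
        _ ≤ f j i := le_mul_of_one_le_left (by positivity) (hr₀1 i)
  have hP : ∀ n, 0 < ∏ j ∈ Finset.range n, r j := fun n => Finset.prod_pos fun j _ => hr0 j
  let N : ℕ → ℝ := fun n => M n / ∏ j ∈ Finset.range n, r j
  have hNr : ∀ j, ratio N j = ν j / r j := by
    intro j
    simp only [ratio, N, ν, Finset.prod_range_succ]
    have := (hM.pos j).ne'
    have := (hP j).ne'
    have := (hr0 j).ne'
    field_simp
  have hsqrt : ∀ i j, i ≤ j → Real.sqrt (ν j / ν i) * (ν i / r i) ≤ ν j / r j := by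
    intro i j hij
    have h1 : ν j / ν i = Real.sqrt (ν j / ν i) * Real.sqrt (ν j / ν i) :=
      (Real.mul_self_sqrt (div_pos (hν j) (hν i)).le).symm
    have h2 : ν j = Real.sqrt (ν j / ν i) * Real.sqrt (ν j / ν i) * ν i := by
      rw [← h1, div_mul_cancel₀ _ (hν i).ne']
    rw [le_div_iff₀ (hr0 j)]
    have h3 := hratio i j hij
    have hri := hr0 i
    have hνi := hν i
    calc Real.sqrt (ν j / ν i) * (ν i / r i) * r j
        ≤ Real.sqrt (ν j / ν i) * (ν i / r i) * (r i * Real.sqrt (ν j / ν i)) := by gcongr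
      _ = Real.sqrt (ν j / ν i) * Real.sqrt (ν j / ν i) * ν i := by field_simp
      _ = ν j := h2.symm
  have hN : RegularWeight N := by
    refine ⟨fun n => div_pos (hM.pos n) (hP n), by simp [N, hM.zero], ?_, ?_, ?_⟩
    · intro i j hij
      rw [hNr, hNr]
      refine le_trans ?_ (hsqrt i j hij)
      refine le_mul_of_one_le_left (div_pos (hν i) (hr0 i)).le ?_
      rw [Real.one_le_sqrt, one_le_div (hν i)]
      exact hM.mono hij
    · obtain ⟨C₀, H, hC₀, hH, h2⟩ := hM.m2
      refine ⟨C₀, H, hC₀, hH, fun p q => ?_⟩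
      -- Monotonicity of `r` makes the divisor at `p + q` at least the product of the divisors at
      -- `p` and `q`, so `(M.2)` survives with the same constants.
      have h1 : (∏ j ∈ Finset.range p, r j) * ∏ j ∈ Finset.range q, r j ≤
          ∏ j ∈ Finset.range (p + q), r j := by
        rw [Finset.prod_range_add]
        refine mul_le_mul_of_nonneg_left ?_ (hP p).le
        exact Finset.prod_le_prod (fun j _ => (hr0 j).le) fun j _ => hrm (by omega)
      have hp := hP p
      have hq := hP q
      have hMp := hM.pos p
      have hMq := hM.pos q
      have hC0 : 0 < C₀ := by linarith
      have hH0 : 0 < H := by linarith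
      calc N (p + q) ≤ M (p + q) / ((∏ j ∈ Finset.range p, r j) * ∏ j ∈ Finset.range q, r j) := by
            have := hM.pos (p + q)
            simp only [N]
            gcongr
        _ ≤ (C₀ * H ^ (p + q) * M p * M q) /
            ((∏ j ∈ Finset.range p, r j) * ∏ j ∈ Finset.range q, r j) := by
            gcongr
            exact h2 p q
        _ = _ := by
            simp only [N]
            field_simp
    · obtain ⟨p₀, k, hp₀, hk, hs⟩ := hM.exists_two_pow_mul_ratio_le
      -- Two steps of `(M.2)^*` for `M` give a factor `4`, whose square root is the factor `2`
      -- required for `N`.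
      refine ⟨p₀, k ^ 2, hp₀, Nat.one_le_pow _ _ (by omega), fun p hp => ?_⟩
      obtain ⟨q, rfl⟩ := Nat.exists_eq_add_of_le' (hp₀.trans hp)
      have hk1 : 1 ≤ k ^ 2 := Nat.one_le_pow _ _ (by omega)
      obtain ⟨s, hsq⟩ := Nat.exists_eq_add_of_le' (Nat.mul_pos hk1 (Nat.succ_pos q))
      have h1 := hs 2 (q + 1) hp
      rw [hsq, Nat.add_sub_cancel, Nat.add_sub_cancel] at h1
      rw [hsq, quotSeq_succ, quotSeq_succ, hNr, hNr]
      have hqs : q ≤ s := by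
        have : q + 1 ≤ k ^ 2 * (q + 1) := Nat.le_mul_of_pos_left _ hk1
        have h3 : k ^ 2 * (q + 1) = s + 1 := hsq
        omega
      refine le_trans ?_ (hsqrt q s hqs)
      refine mul_le_mul_of_nonneg_right ?_ (div_pos (hν q) (hr0 q)).le
      refine Real.le_sqrt_of_sq_le ?_
      rw [le_div_iff₀ (hν q)]
      exact h1
  refine ⟨N, hN, ⟨max C 1, by positivity, fun n => ?_⟩, fun s hs => ?_⟩
  · have h1 := hC n
    have h2 : ∏ j ∈ Finset.range n, r j ≤ ∏ j ∈ Finset.range n, r₀ j :=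
      Finset.prod_le_prod (fun j _ => (hr0 j).le) fun j _ => hrr₀ j
    have h3 : D n / M n * ∏ j ∈ Finset.range n, r j ≤ max C 1 :=
      (mul_le_mul_of_nonneg_left h2 (div_nonneg (hD n) (hM.pos n).le)).trans
        (h1.trans (le_max_left _ _))
    simp only [N]
    rw [mul_div_assoc', le_div_iff₀ (hP n)]
    rw [div_mul_eq_mul_div, div_le_iff₀ (hM.pos n)] at h3
    exact h3
  · obtain ⟨C', hC', hCn⟩ := pow_le_prod_of_tendsto hr0 hrt (R := s⁻¹) (by positivity)
    refine ⟨C', hC', fun n => ?_⟩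
    have h1 := hCn n
    simp only [N]
    rw [div_le_iff₀ (hP n)]
    have hMn := hM.pos n
    calc M n = (s⁻¹) ^ n * (s ^ n * M n) := by
          rw [inv_pow]; field_simp
      _ ≤ (C' * ∏ j ∈ Finset.range n, r j) * (s ^ n * M n) := by gcongr
      _ = _ := by ring

end Weights

/-! ### The exponential series -/

section Tau

theorem norm_cexp_sub_cexp_le {a b : ℂ} {m : ℝ} (ha : a.re ≤ m) (hb : b.re ≤ m) :
    ‖Complex.exp a - Complex.exp b‖ ≤ Real.exp m * ‖a - b‖ := by
  have hs : Convex ℝ {z : ℂ | z.re ≤ m} := convex_halfSpace_re_le m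
  refine hs.norm_image_sub_le_of_norm_hasDerivWithin_le (f := Complex.exp) (f' := Complex.exp)
    (fun z _ => (Complex.hasDerivAt_exp z).hasDerivWithinAt) (fun z hz => ?_) hb ha
  rw [Complex.norm_exp]
  exact Real.exp_le_exp.2 hz

theorem norm_one_sub_cexp_neg_le {v : ℂ} {b : ℝ} (hb : 0 ≤ b) (hv : -b ≤ v.re) :
    ‖1 - Complex.exp (-v)‖ ≤ Real.exp b * ‖v‖ := by
  have := norm_cexp_sub_cexp_le (a := 0) (b := -v) (m := b) (by simpa using hb)
    (by simp; linarith)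
  simpa using this

/-- Positive non-increasing summable sequences with controlled tails. -/
structure TauSeq (τ : ℕ → ℝ) (K : ℝ) : Prop where
  pos : ∀ j, 0 < τ j
  anti : Antitone τ
  summable : Summable τ
  tail : ∀ k, ∑' j, τ (k + j) ≤ K * (k + 1) * τ k

/-- The tails are compared with `∑ (j+1)^{-2}`. The constant `K` depends neither on `L` nor on `Λ`,
since only quotients of the `τⱼ` enter; later `Λ` is chosen in terms of `K`. -/
theorem RegularWeight.exists_tauSeq {N : ℕ → ℝ} (h : RegularWeight N) :
    ∃ L₀ : ℕ, ∃ K : ℝ, 0 < K ∧ ∀ L, L₀ ≤ L → ∀ Λ : ℝ, 0 < Λ →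
      TauSeq (fun j => ((Λ * ratio N j) ^ L)⁻¹) K := by
  obtain ⟨L₀, K, hK, hb⟩ := h.exists_ratio_pow_le
  refine ⟨L₀, 2 * K, by positivity, fun L hL Λ hΛ => ?_⟩
  have hpos : ∀ j, 0 < ((Λ * ratio N j) ^ L)⁻¹ := fun j => by
    have := h.ratio_pos j
    positivity
  have hle : ∀ k n, ∑ j ∈ Finset.range n, ((Λ * ratio N (k + j)) ^ L)⁻¹ ≤
      2 * K * (k + 1) * ((Λ * ratio N k) ^ L)⁻¹ := by
    intro k n
    have h1 : ∀ j, ((Λ * ratio N (k + j)) ^ L)⁻¹ ≤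
        K * (k + 1) ^ 2 * ((Λ * ratio N k) ^ L)⁻¹ * (1 / ((k + j : ℕ) + 1 : ℝ)) ^ 2 := by
      intro j
      have h2 := hb L hL k (k + j) (by omega)
      have hk := h.ratio_pos k
      have hj := h.ratio_pos (k + j)
      calc ((Λ * ratio N (k + j)) ^ L)⁻¹ =
          (ratio N k / ratio N (k + j)) ^ L * ((Λ * ratio N k) ^ L)⁻¹ := by
            rw [div_pow, mul_pow, mul_pow]
            field_simp
        _ ≤ (K * ((k + 1) / ((k + j : ℕ) + 1)) ^ 2) * ((Λ * ratio N k) ^ L)⁻¹ := by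
            have := hpos k
            gcongr
        _ = _ := by ring
    have h3 := sum_inv_sq_le k n
    have h4 : 2 / ((k : ℝ) + 1) - 2 / (k + n + 1) ≤ 2 / ((k : ℝ) + 1) := by
      have : (0 : ℝ) ≤ 2 / (k + n + 1) := by positivity
      linarith
    have hk := hpos k
    calc _ ≤ ∑ j ∈ Finset.range n, K * (k + 1) ^ 2 * ((Λ * ratio N k) ^ L)⁻¹ *
          (1 / ((k + j : ℕ) + 1 : ℝ)) ^ 2 := Finset.sum_le_sum fun j _ => h1 j
      _ ≤ K * (k + 1) ^ 2 * ((Λ * ratio N k) ^ L)⁻¹ * (2 / ((k : ℝ) + 1)) := by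
          rw [← Finset.mul_sum]
          exact mul_le_mul_of_nonneg_left (h3.trans h4) (by positivity)
      _ = _ := by
          have : (k : ℝ) + 1 ≠ 0 := by positivity
          field_simp
  refine ⟨hpos, fun i j hij => ?_, ?_, fun k => ?_⟩
  · have := h.ratio_pos i
    have := h.mono hij
    change ((Λ * ratio N j) ^ L)⁻¹ ≤ ((Λ * ratio N i) ^ L)⁻¹
    gcongr
  · have h0 := hle 0
    simp only [zero_add] at h0
    exact summable_of_sum_range_le (fun j => (hpos j).le) h0
  · exact Real.tsum_le_of_sum_range_le (fun j => (hpos _).le) (hle k)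

/-- The partial sums of the exponential series. -/
noncomputable def gPart (τ : ℕ → ℝ) (η : ℝ) (J : ℕ) (q : ℂ) : ℂ :=
  η * ∑ j ∈ Finset.range J, (1 - Complex.exp (-(q * τ j)))

/-- The exponential series `η ∑ⱼ (1 - exp(-q τⱼ))`. -/
noncomputable def gTot (τ : ℕ → ℝ) (η : ℝ) (q : ℂ) : ℂ :=
  η * ∑' j, (1 - Complex.exp (-(q * τ j)))

/-- The regularized exponentials of the partial sums. -/
noncomputable def expPart (τ : ℕ → ℝ) (η : ℝ) (J : ℕ) (q : ℂ) : ℂ :=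
  Complex.exp (gPart τ η J q - q * τ J)

/-- The polynomials that dominate the exponentials of the partial sums. -/
noncomputable def growPoly (τ : ℕ → ℝ) (c R : ℝ) (J : ℕ) : Polynomial ℝ :=
  ∏ j ∈ Finset.range J, (1 + Polynomial.C (c * τ j) * (Polynomial.X + Polynomial.C R))

/-- The region `|q| ≤ 4 (Re q + R)`. -/
def InSector (R : ℝ) (q : ℂ) : Prop := ‖q‖ ≤ 4 * (q.re + R)

variable {τ : ℕ → ℝ} {K η R : ℝ}

theorem InSector.nonneg {q : ℂ} (h : InSector R q) : 0 ≤ q.re + R := by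
  have := (norm_nonneg q).trans h
  linarith

theorem aeval_growPoly (c : ℝ) (J : ℕ) (q : ℂ) : Polynomial.aeval q (growPoly τ c R J) =
    ∏ j ∈ Finset.range J, (1 + (c * τ j : ℝ) * (q + R)) := by
  simp [growPoly, map_prod]

theorem eval_growPoly (c : ℝ) (J : ℕ) (s : ℝ) : Polynomial.eval s (growPoly τ c R J) =
    ∏ j ∈ Finset.range J, (1 + c * τ j * (s + R)) := by
  simp [growPoly, Polynomial.eval_prod]

theorem one_le_norm_factor (t : ℝ) (q : ℂ) :
    1 + t * (q.re + R) ≤ ‖1 + (t : ℂ) * (q + R)‖ := by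
  refine le_trans (le_of_eq ?_) ((le_abs_self _).trans (Complex.abs_re_le_norm _))
  simp

/-- Each factor has real part at least `1`, so division by these polynomials is harmless on the
sector. -/
theorem TauSeq.one_le_norm_aeval (h : TauSeq τ K) {c : ℝ} (hc : 0 ≤ c) (J : ℕ) {q : ℂ}
    (hq : InSector R q) : 1 ≤ ‖Polynomial.aeval q (growPoly τ c R J)‖ := by
  rw [aeval_growPoly, norm_prod]
  refine Finset.one_le_prod fun j _ => le_trans ?_ (one_le_norm_factor _ q)
  have := mul_nonneg (mul_nonneg hc (h.pos j).le) hq.nonneg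
  linarith

theorem re_mul_tau {q : ℂ} {t : ℝ} : (q * t).re = q.re * t := by simp

theorem neg_le_re_mul {t b : ℝ} (ht : 0 ≤ t) (hR : 0 ≤ R) (htb : t ≤ b) {q : ℂ}
    (hq : InSector R q) : -(R * b) ≤ (q * t).re := by
  rw [re_mul_tau]
  have := hq.nonneg
  nlinarith [mul_nonneg this ht, mul_le_mul_of_nonneg_left htb hR]

theorem norm_factor_le {t b : ℝ} (ht : 0 ≤ t) (hR : 0 ≤ R) (htb : t ≤ b) (hη : 0 ≤ η) {q : ℂ}
    (hq : InSector R q) : ‖Complex.exp (η * (1 - Complex.exp (-(q * t))))‖ ≤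
      Real.exp (η * (1 + Real.exp (R * b))) := by
  rw [Complex.norm_exp]
  refine Real.exp_le_exp.2 ?_
  rw [Complex.re_ofReal_mul]
  refine mul_le_mul_of_nonneg_left ?_ hη
  refine (Complex.re_le_norm _).trans ((norm_sub_le _ _).trans ?_)
  rw [norm_one, Complex.norm_exp]
  gcongr
  rw [Complex.neg_re]
  linarith [neg_le_re_mul ht hR htb hq]

/-- Here `|1 - exp(-qt)|` is bounded both by `4` and by `12 t (Re q + R)`, where `12` combines `e ≤
3` with the constant `4` of the sector. Then `exp s ≤ 1 + s exp s` turns the exponential into a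
linear factor. -/
theorem norm_factor_le_of_small {t : ℝ} (ht : 0 ≤ t) (hR : 0 ≤ R) (hRt : R * t ≤ 1) (hη : 0 ≤ η)
    {q : ℂ} (hq : InSector R q) : ‖Complex.exp (η * (1 - Complex.exp (-(q * t))))‖ ≤
      1 + 12 * η * Real.exp (4 * η) * t * (q.re + R) := by
  have hre := neg_le_re_mul ht hR le_rfl hq
  have hy := hq.nonneg
  have he : Real.exp 1 ≤ 3 := by linarith [Real.exp_one_lt_d9]
  have h1 : ‖1 - Complex.exp (-(q * t))‖ ≤ 4 := by
    refine (norm_sub_le _ _).trans ?_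
    rw [norm_one, Complex.norm_exp]
    have : Real.exp ((-(q * t)).re) ≤ Real.exp 1 := by
      refine Real.exp_le_exp.2 ?_
      rw [Complex.neg_re]; linarith
    linarith
  have h2 : ‖1 - Complex.exp (-(q * t))‖ ≤ 12 * (t * (q.re + R)) := by
    refine (norm_one_sub_cexp_neg_le zero_le_one (by linarith)).trans ?_
    rw [norm_mul, Complex.norm_real, Real.norm_of_nonneg ht]
    calc Real.exp 1 * (‖q‖ * t) ≤ 3 * ((4 * (q.re + R)) * t) := by gcongr; exact hq
      _ = _ := by ring
  set s := η * ‖1 - Complex.exp (-(q * t))‖ with hs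
  have hs0 : 0 ≤ s := by positivity
  have hs4 : s ≤ 4 * η := by
    rw [hs, mul_comm 4]; gcongr
  have h3 : ‖Complex.exp (η * (1 - Complex.exp (-(q * t))))‖ ≤ Real.exp s := by
    rw [Complex.norm_exp]
    refine Real.exp_le_exp.2 ?_
    rw [Complex.re_ofReal_mul]
    exact mul_le_mul_of_nonneg_left (Complex.re_le_norm _) hη
  have h4 : Real.exp s ≤ 1 + s * Real.exp s := by
    have h5 := Real.add_one_le_exp (-s)
    have h6 : Real.exp (-s) * Real.exp s = 1 := by rw [← Real.exp_add]; simp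
    have h7 := mul_le_mul_of_nonneg_right h5 (Real.exp_pos s).le
    nlinarith
  calc _ ≤ Real.exp s := h3
    _ ≤ 1 + s * Real.exp s := h4
    _ ≤ 1 + (η * (12 * (t * (q.re + R)))) * Real.exp (4 * η) := by
        gcongr
        exact mul_le_mul_of_nonneg_left h2 hη
    _ = _ := by ring

/-- A constant in the growth polynomials. -/
noncomputable def growConst (η : ℝ) : ℝ := 12 * η * Real.exp (4 * η)

theorem growConst_nonneg (hη : 0 ≤ η) : 0 ≤ growConst η := by unfold growConst; positivity

theorem cexp_gPart (J : ℕ) (q : ℂ) : Complex.exp (gPart τ η J q) =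
    ∏ j ∈ Finset.range J, Complex.exp (η * (1 - Complex.exp (-(q * τ j)))) := by
  rw [gPart, Finset.mul_sum, Complex.exp_sum]

/-- The comparison is made factor by factor. The finitely many indices where `R τⱼ ≤ 1` may fail are
bounded crudely and produce the constant, which does not depend on `J`. -/
theorem TauSeq.exists_norm_cexp_gPart_le (h : TauSeq τ K) (hη : 0 ≤ η) (hR : 0 ≤ R) :
    ∃ C : ℝ, 1 ≤ C ∧ ∀ (J : ℕ) (q : ℂ), InSector R q →
      ‖Complex.exp (gPart τ η J q)‖ ≤
        C * ‖Polynomial.aeval q (growPoly τ (growConst η) R J)‖ := by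
  obtain ⟨j₀, hj₀⟩ : ∃ j₀, ∀ j ≥ j₀, R * τ j ≤ 1 := by
    have h1 := h.summable.tendsto_atTop_zero.const_mul R
    rw [mul_zero] at h1
    exact eventually_atTop.1 ((h1.eventually (gt_mem_nhds one_pos)).mono fun _ h => h.le)
  let D := Real.exp (η * (1 + Real.exp (R * τ 0)))
  have hD : 1 ≤ D := Real.one_le_exp (by positivity)
  have hc := growConst_nonneg hη
  refine ⟨D ^ j₀, one_le_pow₀ hD, fun J q hq => ?_⟩
  rw [cexp_gPart, aeval_growPoly, norm_prod, norm_prod]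
  have h1 : ∀ j, ‖Complex.exp (η * (1 - Complex.exp (-(q * τ j))))‖ ≤
      (if j < j₀ then D else 1) * ‖1 + ((growConst η * τ j : ℝ) : ℂ) * (q + R)‖ := by
    intro j
    have h2 := one_le_norm_factor (R := R) (growConst η * τ j) q
    have h3 := mul_nonneg (mul_nonneg hc (h.pos j).le) hq.nonneg
    split_ifs with hj
    · refine (norm_factor_le (h.pos j).le hR (h.anti (Nat.zero_le j)) hη hq).trans ?_
      exact le_mul_of_one_le_right (by positivity) (by linarith)
    · rw [one_mul]
      refine le_trans ?_ h2
      have := norm_factor_le_of_small (h.pos j).le hR (hj₀ j (not_lt.1 hj)) hη hq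
      simpa only [growConst] using this
  calc _ ≤ ∏ j ∈ Finset.range J, (if j < j₀ then D else 1) *
        ‖1 + ((growConst η * τ j : ℝ) : ℂ) * (q + R)‖ :=
        Finset.prod_le_prod (fun j _ => norm_nonneg _) fun j _ => h1 j
    _ ≤ _ := by
        rw [Finset.prod_mul_distrib]
        refine mul_le_mul_of_nonneg_right ?_ (Finset.prod_nonneg fun j _ => norm_nonneg _)
        rw [Finset.prod_ite, Finset.prod_const, Finset.prod_const_one, mul_one]
        refine pow_le_pow_right₀ hD ?_
        have : (Finset.range J).filter (fun j => j < j₀) ⊆ Finset.range j₀ := by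
          intro s hs
          simp only [Finset.mem_filter, Finset.mem_range] at hs ⊢
          exact hs.2
        simpa using Finset.card_le_card this

theorem gPart_succ (J : ℕ) (q : ℂ) :
    gPart τ η (J + 1) q = gPart τ η J q + η * (1 - Complex.exp (-(q * τ J))) := by
  rw [gPart, gPart, Finset.sum_range_succ, mul_add]

/-- After `exp(G_J)` is factored out, two exponentials remain. Their exponents have real parts
bounded above and differ by `O(‖q‖ τ_J)`, so the mean value inequality applies. -/
theorem TauSeq.exists_norm_expPart_sub_le (h : TauSeq τ K) (hη : 0 ≤ η) (hR : 0 ≤ R) :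
    ∃ C : ℝ, 0 ≤ C ∧ ∀ (J : ℕ) (q : ℂ), InSector R q →
      ‖expPart τ η (J + 1) q - expPart τ η J q‖ ≤
        C * ‖Polynomial.aeval q (growPoly τ (growConst η) R J)‖ * (‖q‖ * τ J) := by
  obtain ⟨C, hC, hCb⟩ := h.exists_norm_cexp_gPart_le hη hR
  let b := R * τ 0
  have hb : 0 ≤ b := mul_nonneg hR (h.pos 0).le
  let m := η * (1 + Real.exp b) + b
  refine ⟨C * (Real.exp m * (η * Real.exp b + 1)), by positivity, fun J q hq => ?_⟩
  have hJ := h.anti (Nat.zero_le J)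
  have hJ1 := h.anti (Nat.zero_le (J + 1))
  have hreJ := neg_le_re_mul (h.pos J).le hR hJ hq
  have hreJ1 := neg_le_re_mul (h.pos (J + 1)).le hR hJ1 hq
  have hn := norm_one_sub_cexp_neg_le hb hreJ
  have e1 : expPart τ η (J + 1) q - expPart τ η J q = Complex.exp (gPart τ η J q) *
      (Complex.exp (η * (1 - Complex.exp (-(q * τ J))) - q * τ (J + 1)) -
        Complex.exp (-(q * τ J))) := by
    rw [expPart, expPart, gPart_succ, mul_sub (Complex.exp _), ← Complex.exp_add,
      ← Complex.exp_add]
    ring_nf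
  have h2 : ‖Complex.exp (η * (1 - Complex.exp (-(q * τ J))) - q * τ (J + 1)) -
      Complex.exp (-(q * τ J))‖ ≤ Real.exp m * ((η * Real.exp b + 1) * (‖q‖ * τ J)) := by
    refine (norm_cexp_sub_cexp_le (m := m) ?_ ?_).trans
      (mul_le_mul_of_nonneg_left ?_ (Real.exp_pos m).le)
    · rw [Complex.sub_re, Complex.re_ofReal_mul]
      have h3 : (1 - Complex.exp (-(q * τ J))).re ≤ 1 + Real.exp b := by
        refine (Complex.re_le_norm _).trans ((norm_sub_le _ _).trans ?_)
        rw [norm_one, Complex.norm_exp]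
        gcongr
        rw [Complex.neg_re]; linarith
      have := mul_le_mul_of_nonneg_left h3 hη
      simp only [m]; linarith
    · rw [Complex.neg_re]
      have : 0 ≤ η * (1 + Real.exp b) := by positivity
      simp only [m]; linarith
    · have e2 : (η : ℂ) * (1 - Complex.exp (-(q * τ J))) - q * τ (J + 1) - -(q * τ J) =
          η * (1 - Complex.exp (-(q * τ J))) + q * ((τ J - τ (J + 1) : ℝ) : ℂ) := by
        push_cast; ring
      rw [e2]
      refine (norm_add_le _ _).trans ?_
      rw [norm_mul, norm_mul, Complex.norm_real, Complex.norm_real, Real.norm_of_nonneg hη,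
        Real.norm_of_nonneg (sub_nonneg.2 (h.anti (Nat.le_succ J)))]
      rw [norm_mul, Complex.norm_real, Real.norm_of_nonneg (h.pos J).le] at hn
      have h4 : τ J - τ (J + 1) ≤ τ J := by linarith [h.pos (J + 1)]
      calc _ ≤ η * (Real.exp b * (‖q‖ * τ J)) + ‖q‖ * τ J := by gcongr
        _ = _ := by ring
  rw [e1, norm_mul]
  calc _ ≤ (C * ‖Polynomial.aeval q (growPoly τ (growConst η) R J)‖) *
        (Real.exp m * ((η * Real.exp b + 1) * (‖q‖ * τ J))) :=
        mul_le_mul (hCb J q hq) h2 (norm_nonneg _) (by positivity)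
    _ = _ := by ring

theorem TauSeq.norm_term_le (h : TauSeq τ K) {r : ℝ} {q : ℂ} (hq : ‖q‖ ≤ r) (j : ℕ) :
    ‖1 - Complex.exp (-(q * τ j))‖ ≤ Real.exp (r * τ 0) * r * τ j := by
  have hr : 0 ≤ r := (norm_nonneg q).trans hq
  have h1 : ‖q * τ j‖ ≤ r * τ j := by
    rw [norm_mul, Complex.norm_real, Real.norm_of_nonneg (h.pos j).le]
    exact mul_le_mul_of_nonneg_right hq (h.pos j).le
  have h2 : r * τ j ≤ r * τ 0 := mul_le_mul_of_nonneg_left (h.anti (Nat.zero_le j)) hr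
  have h3 := (abs_le.1 (Complex.abs_re_le_norm (q * τ j))).1
  refine (norm_one_sub_cexp_neg_le (b := r * τ 0) (mul_nonneg hr (h.pos 0).le)
    (by linarith)).trans ?_
  rw [mul_assoc]
  gcongr

theorem TauSeq.summable_term (h : TauSeq τ K) (q : ℂ) :
    Summable fun j => 1 - Complex.exp (-(q * τ j)) :=
  Summable.of_norm_bounded (h.summable.mul_left (Real.exp (‖q‖ * τ 0) * ‖q‖))
    fun j => h.norm_term_le le_rfl j

theorem TauSeq.differentiable_gTot (h : TauSeq τ K) : Differentiable ℂ (gTot τ η) := by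
  intro q
  have h1 : DifferentiableOn ℂ (fun q => ∑' j, (1 - Complex.exp (-(q * τ j))))
      (Metric.ball 0 (‖q‖ + 1)) := by
    refine Complex.differentiableOn_tsum_of_summable_norm
      (h.summable.mul_left (Real.exp ((‖q‖ + 1) * τ 0) * (‖q‖ + 1))) (fun j => ?_)
      Metric.isOpen_ball fun j w hw => ?_
    · fun_prop
    · rw [mem_ball_zero_iff] at hw
      exact h.norm_term_le hw.le j
  have h2 := h1.differentiableAt (Metric.isOpen_ball.mem_nhds (by simp : q ∈ Metric.ball 0 (‖q‖ + 1)))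
  exact h2.const_mul _

theorem differentiable_expPart (J : ℕ) : Differentiable ℂ (expPart τ η J) := by
  unfold expPart gPart
  fun_prop

theorem TauSeq.gTot_sub_gPart (h : TauSeq τ K) (J : ℕ) (q : ℂ) :
    gTot τ η q - gPart τ η J q = η * ∑' j, (1 - Complex.exp (-(q * τ (J + j)))) := by
  rw [gTot, gPart, ← mul_sub, ← (h.summable_term q).sum_add_tsum_nat_add J, add_sub_cancel_left]
  simp only [add_comm]

theorem re_one_sub_cexp_neg_ge {b : ℝ} {v : ℂ} {t : ℝ} (ht : 0 ≤ t) (htb : t ≤ b)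
    (hv : -t ≤ v.re) :
    -(Real.exp b * t) ≤ (1 - Complex.exp (-v)).re := by
  have h1 : (Complex.exp (-v)).re ≤ Real.exp t := by
    refine (Complex.re_le_norm _).trans ?_
    rw [Complex.norm_exp]
    refine Real.exp_le_exp.2 ?_
    rw [Complex.neg_re]; linarith
  have h2 : Real.exp t ≤ 1 + Real.exp b * t := by
    have h5 := Real.add_one_le_exp (-t)
    have h6 : Real.exp (-t) * Real.exp t = 1 := by rw [← Real.exp_add]; simp
    have h7 := mul_le_mul_of_nonneg_right h5 (Real.exp_pos t).le
    have h8 := mul_le_mul_of_nonneg_right (Real.exp_le_exp.2 htb) ht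
    nlinarith
  rw [Complex.sub_re, Complex.one_re]
  linarith

theorem TauSeq.summable_shift (h : TauSeq τ K) (J : ℕ) : Summable fun j => τ (J + j) := by
  simpa only [add_comm] using (summable_nat_add_iff J).2 h.summable

/-- On the sector `Re q ≥ -R`, hence the `j`-th term has real part at least `-C τⱼ`, and summability
bounds all tails at once. -/
theorem TauSeq.exists_re_tail_ge (h : TauSeq τ K) (hR : 0 ≤ R) :
    ∃ C : ℝ, 0 ≤ C ∧ ∀ (J : ℕ) (q : ℂ), InSector R q →
      -C ≤ (∑' j, (1 - Complex.exp (-(q * τ (J + j))))).re := by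
  have hS : 0 ≤ ∑' j, τ j := tsum_nonneg fun j => (h.pos j).le
  refine ⟨Real.exp (R * τ 0) * (R * ∑' j, τ j), by positivity, fun J q hq => ?_⟩
  have hsum : Summable fun j => 1 - Complex.exp (-(q * τ (J + j))) := by
    simpa only [add_comm] using (summable_nat_add_iff J).2 (h.summable_term q)
  have h1 := Complex.hasSum_re hsum.hasSum
  have h2 : ∀ j, -(Real.exp (R * τ 0) * (R * τ (J + j))) ≤
      (1 - Complex.exp (-(q * τ (J + j)))).re := fun j => by
    have hj := h.anti (Nat.zero_le (J + j))
    exact re_one_sub_cexp_neg_ge (mul_nonneg hR (h.pos _).le)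
      (mul_le_mul_of_nonneg_left hj hR) (neg_le_re_mul (h.pos _).le hR le_rfl hq)
  have h3 := (((h.summable_shift J).hasSum.mul_left R).mul_left (Real.exp (R * τ 0))).neg
  refine le_trans ?_ (hasSum_le h2 h3 h1)
  have h4 : ∑' j, τ (J + j) ≤ ∑' j, τ j := by
    have := h.summable.sum_add_tsum_nat_add J
    have h5 : 0 ≤ ∑ j ∈ Finset.range J, τ j := Finset.sum_nonneg fun j _ => (h.pos j).le
    simp only [add_comm J]
    linarith
  have := mul_le_mul_of_nonneg_left (mul_le_mul_of_nonneg_left h4 hR) (Real.exp_pos (R * τ 0)).le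
  linarith

/-- In the product the partial sum cancels and `exp(-q τ_J)` times the exponential of minus the tail
of `G` remains. The tail is `O(‖q‖ ∑_{j≥J} τⱼ)` with real part bounded below. -/
theorem TauSeq.exists_norm_exp_mul_expPart_sub_le (h : TauSeq τ K) (hη : 0 ≤ η) (hR : 0 ≤ R) :
    ∃ C : ℝ, 0 ≤ C ∧ ∀ (J : ℕ) (q : ℂ), InSector R q →
      ‖Complex.exp (-gTot τ η q) * expPart τ η J q - Complex.exp (-(q * τ J))‖ ≤
        C * (‖q‖ * ∑' j, τ (J + j)) := by
  obtain ⟨C, hC, hCb⟩ := h.exists_re_tail_ge hR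
  let b := R * τ 0
  have hb : 0 ≤ b := mul_nonneg hR (h.pos 0).le
  refine ⟨Real.exp b * (Real.exp (η * C) * (η * Real.exp b)), by positivity, fun J q hq => ?_⟩
  set T := ∑' j, (1 - Complex.exp (-(q * τ (J + j)))) with hT
  have e1 : Complex.exp (-gTot τ η q) * expPart τ η J q - Complex.exp (-(q * τ J)) =
      Complex.exp (-(q * τ J)) * (Complex.exp (-(η * T)) - Complex.exp 0) := by
    rw [hT, ← h.gTot_sub_gPart, expPart, mul_sub, ← Complex.exp_add, ← Complex.exp_add,
      ← Complex.exp_add]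
    ring_nf
  have h1 : ‖T‖ ≤ Real.exp b * (‖q‖ * ∑' j, τ (J + j)) := by
    have hs := ((h.summable_shift J).hasSum.mul_left ‖q‖).mul_left (Real.exp b)
    refine tsum_of_norm_bounded hs fun j => ?_
    have := norm_one_sub_cexp_neg_le hb
      (neg_le_re_mul (h.pos (J + j)).le hR (h.anti (Nat.zero_le (J + j))) hq)
    rwa [norm_mul, Complex.norm_real, Real.norm_of_nonneg (h.pos _).le] at this
  have h2 : ‖Complex.exp (-(η * T)) - Complex.exp 0‖ ≤ Real.exp (η * C) * ‖-(η * T) - 0‖ := by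
    refine norm_cexp_sub_cexp_le ?_ ?_
    · rw [Complex.neg_re, Complex.re_ofReal_mul]
      nlinarith [mul_le_mul_of_nonneg_left (hCb J q hq) hη]
    · simp only [Complex.zero_re]; positivity
  rw [sub_zero, norm_neg, norm_mul, Complex.norm_real, Real.norm_of_nonneg hη] at h2
  rw [e1, norm_mul]
  have h3 : ‖Complex.exp (-(q * τ J))‖ ≤ Real.exp b := by
    rw [Complex.norm_exp]
    refine Real.exp_le_exp.2 ?_
    rw [Complex.neg_re]
    linarith [neg_le_re_mul (h.pos J).le hR (h.anti (Nat.zero_le J)) hq]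
  calc _ ≤ Real.exp b * (Real.exp (η * C) * (η * (Real.exp b * (‖q‖ * ∑' j, τ (J + j))))) := by
        refine mul_le_mul h3 (h2.trans ?_) (norm_nonneg _) (by positivity)
        gcongr
    _ = _ := by ring

/-- Each index with `Re q τⱼ ≥ 1` contributes at least `1 - e⁻¹ ≥ 1/2`, and the remaining tail costs
only a constant. -/
theorem TauSeq.exists_re_gTot_ge (h : TauSeq τ K) (hη : 0 ≤ η) (hR : 0 ≤ R) :
    ∃ C : ℝ, 0 ≤ C ∧ ∀ (k : ℕ) (q : ℂ), InSector R q → (∀ j < k, 1 ≤ q.re * τ j) →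
      η / 2 * k - C ≤ (gTot τ η q).re := by
  obtain ⟨C, hC, hCb⟩ := h.exists_re_tail_ge hR
  refine ⟨η * C, by positivity, fun k q hq hk => ?_⟩
  have e1 : gTot τ η q = gPart τ η k q + η * ∑' j, (1 - Complex.exp (-(q * τ (k + j)))) := by
    rw [← h.gTot_sub_gPart]; ring
  have h1 : η / 2 * k ≤ (gPart τ η k q).re := by
    rw [gPart, Complex.re_ofReal_mul, Complex.re_sum, div_mul_eq_mul_div, mul_div_assoc]
    refine mul_le_mul_of_nonneg_left ?_ hη
    have h2 : ∀ j ∈ Finset.range k, (1 / 2 : ℝ) ≤ (1 - Complex.exp (-(q * τ j))).re := by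
      intro j hj
      have h3 : (Complex.exp (-(q * τ j))).re ≤ Real.exp (-1) := by
        refine (Complex.re_le_norm _).trans ?_
        rw [Complex.norm_exp]
        refine Real.exp_le_exp.2 ?_
        rw [Complex.neg_re, re_mul_tau]
        linarith [hk j (Finset.mem_range.1 hj)]
      have h4 : Real.exp (-1) ≤ 1 / 2 := by
        have := Real.exp_neg_one_lt_d9
        linarith
      rw [Complex.sub_re, Complex.one_re]
      linarith
    have := Finset.card_nsmul_le_sum _ _ _ h2
    rw [Finset.card_range, nsmul_eq_mul] at this
    linarith
  rw [e1, Complex.add_re, Complex.re_ofReal_mul]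
  have := mul_le_mul_of_nonneg_left (hCb k q hq) hη
  linarith

/-! ### Coefficients of the dominating polynomials -/

theorem coeff_mul_pow_le_eval {p : Polynomial ℝ} (hp : ∀ n, 0 ≤ p.coeff n) {s : ℝ} (hs : 0 ≤ s)
    (n : ℕ) : p.coeff n * s ^ n ≤ p.eval s := by
  by_cases hn : n ≤ p.natDegree
  · rw [Polynomial.eval_eq_sum_range]
    exact Finset.single_le_sum (f := fun i => p.coeff i * s ^ i)
      (fun i _ => mul_nonneg (hp i) (pow_nonneg hs i)) (Finset.mem_range.2 (Nat.lt_succ_of_le hn))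
  · rw [Polynomial.coeff_eq_zero_of_natDegree_lt (not_le.1 hn), zero_mul,
      Polynomial.eval_eq_sum_range]
    exact Finset.sum_nonneg fun i _ => mul_nonneg (hp i) (pow_nonneg hs i)

theorem coeff_mul_nonneg {p q : Polynomial ℝ} (hp : ∀ n, 0 ≤ p.coeff n)
    (hq : ∀ n, 0 ≤ q.coeff n) (n : ℕ) : 0 ≤ (p * q).coeff n := by
  rw [Polynomial.coeff_mul]
  exact Finset.sum_nonneg fun i _ => mul_nonneg (hp _) (hq _)

theorem coeff_linear_nonneg {a b : ℝ} (ha : 0 ≤ a) (hb : 0 ≤ b) (n : ℕ) :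
    0 ≤ (Polynomial.C a * Polynomial.X + Polynomial.C b).coeff n := by
  rw [Polynomial.coeff_add, Polynomial.coeff_C_mul, Polynomial.coeff_X, Polynomial.coeff_C]
  refine add_nonneg (mul_nonneg ha ?_) ?_ <;> split_ifs <;> simp [hb]

theorem TauSeq.coeff_growPoly_nonneg (h : TauSeq τ K) {c : ℝ} (hc : 0 ≤ c) (hR : 0 ≤ R) (J n : ℕ) :
    0 ≤ (growPoly τ c R J).coeff n := by
  induction J generalizing n with
  | zero =>
    rw [growPoly, Finset.prod_range_zero, Polynomial.coeff_one]
    split_ifs <;> simp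
  | succ J ih =>
    rw [growPoly, Finset.prod_range_succ, ← growPoly]
    refine coeff_mul_nonneg ih (fun n => ?_) n
    have e : (1 + Polynomial.C (c * τ J) * (Polynomial.X + Polynomial.C R) : Polynomial ℝ) =
        Polynomial.C (c * τ J) * Polynomial.X + Polynomial.C (1 + c * τ J * R) := by
      simp only [Polynomial.C_add, Polynomial.C_mul, Polynomial.C_1]
      ring
    rw [e]
    have := mul_nonneg hc (h.pos J).le
    exact coeff_linear_nonneg this (by positivity) n

theorem prod_one_add_le_exp_tsum {a : ℕ → ℝ} (ha : ∀ j, 0 ≤ a j) (hs : Summable a) (J : ℕ) :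
    ∏ j ∈ Finset.range J, (1 + a j) ≤ Real.exp (∑' j, a j) := by
  calc _ ≤ ∏ j ∈ Finset.range J, Real.exp (a j) :=
        Finset.prod_le_prod (fun j _ => by linarith [ha j]) fun j _ => by
          linarith [Real.add_one_le_exp (a j)]
    _ = Real.exp (∑ j ∈ Finset.range J, a j) := (Real.exp_sum _ _).symm
    _ ≤ _ := Real.exp_le_exp.2 (hs.sum_le_tsum _ fun j _ => ha j)

/-- Cauchy's estimate at the point `1/τₙ`, for a polynomial with non-negative coefficients. Each
factor with `j < n`, multiplied by `τₙ/τⱼ ≤ 1`, is at most `1 + 2c`. The factors with `j ≥ n` are at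
most `exp(2c ∑_{j≥n} τⱼ/τₙ)`, which the tail condition controls. The `2` comes from `R ≤ 1/τₙ`. -/
theorem TauSeq.coeff_growPoly_mul_le (h : TauSeq τ K) {c : ℝ} (hc : 0 ≤ c) (hR : 0 ≤ R) {n : ℕ}
    (hn : R * τ n ≤ 1) (J : ℕ) :
    (growPoly τ c R J).coeff n * ∏ j ∈ Finset.range n, (τ j)⁻¹ ≤
      (1 + 2 * c) ^ n * Real.exp (2 * c * K * (n + 1)) := by
  have hτ := h.pos
  have h1 := coeff_mul_pow_le_eval (h.coeff_growPoly_nonneg hc hR J) (inv_nonneg.2 (hτ n).le) n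
  rw [eval_growPoly] at h1
  have hRn : R ≤ (τ n)⁻¹ := by rwa [← one_div, le_div_iff₀ (hτ n)]
  have h2 : ∏ j ∈ Finset.range J, (1 + c * τ j * ((τ n)⁻¹ + R)) ≤
      (∏ j ∈ Finset.range n, (1 + 2 * c * τ j * (τ n)⁻¹)) * Real.exp (2 * c * K * (n + 1)) := by
    have hin := inv_pos.2 (hτ n)
    calc _ ≤ ∏ j ∈ Finset.range J, (1 + 2 * c * τ j * (τ n)⁻¹) := by
          refine Finset.prod_le_prod (fun j _ => ?_) fun j _ => ?_
          · have := hτ j; positivity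
          · have := mul_nonneg hc (hτ j).le
            nlinarith
      _ ≤ ∏ j ∈ Finset.range (n + J), (1 + 2 * c * τ j * (τ n)⁻¹) := by
          rw [add_comm n J, Finset.prod_range_add]
          refine le_mul_of_one_le_right (Finset.prod_nonneg fun j _ => ?_)
            (Finset.one_le_prod fun j _ => ?_)
          · have := hτ j; positivity
          · have := hτ (J + j)
            have : 0 ≤ 2 * c * τ (J + j) * (τ n)⁻¹ := by positivity
            linarith
      _ ≤ _ := by
          rw [Finset.prod_range_add]
          refine mul_le_mul_of_nonneg_left ?_ (Finset.prod_nonneg fun j _ => ?_)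
          · refine (prod_one_add_le_exp_tsum (a := fun j => 2 * c * τ (n + j) * (τ n)⁻¹)
              (fun j => ?_) (((h.summable_shift n).mul_left _).mul_right _) J).trans
              (Real.exp_le_exp.2 ?_)
            · have := hτ (n + j); positivity
            · rw [tsum_mul_right, tsum_mul_left]
              have h3 := h.tail n
              calc 2 * c * (∑' j, τ (n + j)) * (τ n)⁻¹
                  ≤ 2 * c * (K * (n + 1) * τ n) * (τ n)⁻¹ := by gcongr
                _ = _ := by
                    have := (hτ n).ne'
                    field_simp
          · have := hτ j; positivity
  have h4 : (∏ j ∈ Finset.range n, (1 + 2 * c * τ j * (τ n)⁻¹)) *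
      (τ n ^ n * ∏ j ∈ Finset.range n, (τ j)⁻¹) ≤ (1 + 2 * c) ^ n := by
    have e : τ n ^ n = ∏ j ∈ Finset.range n, τ n := by simp
    rw [e, ← Finset.prod_mul_distrib, ← Finset.prod_mul_distrib]
    calc _ ≤ ∏ j ∈ Finset.range n, (1 + 2 * c) := by
          refine Finset.prod_le_prod (fun j _ => ?_) fun j hj => ?_
          · have := hτ j; have := hτ n; positivity
          · have hj' := hτ j
            have hn' := hτ n
            have h5 : τ n ≤ τ j := h.anti (Finset.mem_range.1 hj).le
            have h6 : (1 + 2 * c * τ j * (τ n)⁻¹) * (τ n * (τ j)⁻¹) = τ n / τ j + 2 * c := by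
              field_simp
            rw [h6]
            have := (div_le_one hj').2 h5
            linarith
      _ = _ := by simp
  have h7 : 0 ≤ τ n ^ n * ∏ j ∈ Finset.range n, (τ j)⁻¹ := by
    have h8 : 0 ≤ ∏ j ∈ Finset.range n, (τ j)⁻¹ :=
      Finset.prod_nonneg fun j _ => inv_nonneg.2 (hτ j).le
    have := hτ n
    positivity
  calc _ = ((growPoly τ c R J).coeff n * (τ n)⁻¹ ^ n) *
        (τ n ^ n * ∏ j ∈ Finset.range n, (τ j)⁻¹) := by
        have := (hτ n).ne'
        rw [inv_pow]
        field_simp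
    _ ≤ ((∏ j ∈ Finset.range n, (1 + 2 * c * τ j * (τ n)⁻¹)) * Real.exp (2 * c * K * (n + 1))) *
        (τ n ^ n * ∏ j ∈ Finset.range n, (τ j)⁻¹) :=
        mul_le_mul_of_nonneg_right (h1.trans h2) h7
    _ = ((∏ j ∈ Finset.range n, (1 + 2 * c * τ j * (τ n)⁻¹)) *
        (τ n ^ n * ∏ j ∈ Finset.range n, (τ j)⁻¹)) * Real.exp (2 * c * K * (n + 1)) := by ring
    _ ≤ _ := mul_le_mul_of_nonneg_right h4 (Real.exp_pos _).le

/-- Beyond the index where `R τₙ ≤ 1` the terms are dominated by a geometric series of ratio `1/2`.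
The earlier coefficients are bounded by the value of the polynomial at `1`. Neither bound depends on
`J`. -/
theorem TauSeq.exists_sum_coeff_le (h : TauSeq τ K) {c : ℝ} (hc : 0 ≤ c) (hR : 0 ≤ R)
    {W : ℕ → ℝ} (hW : ∀ n, 0 ≤ W n) {β : ℝ} (hβ : 0 ≤ β)
    (hWβ : ∀ n, W n ≤ β ^ n * ∏ j ∈ Finset.range n, (τ j)⁻¹)
    (hsmall : β * ((1 + 2 * c) * Real.exp (2 * c * K)) ≤ 1 / 2) :
    ∃ C : ℝ, 0 ≤ C ∧ ∀ J m, ∑ n ∈ Finset.range m, (growPoly τ c R J).coeff n * W n ≤ C := by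
  obtain ⟨n₀, hn₀⟩ : ∃ j₀, ∀ j ≥ j₀, R * τ j ≤ 1 := by
    have h1 := h.summable.tendsto_atTop_zero.const_mul R
    rw [mul_zero] at h1
    exact eventually_atTop.1 ((h1.eventually (gt_mem_nhds one_pos)).mono fun _ h => h.le)
  let E := Real.exp (∑' j, c * τ j * (1 + R))
  have hWs : 0 ≤ ∑ n ∈ Finset.range n₀, E * W n :=
    Finset.sum_nonneg fun n _ => mul_nonneg (Real.exp_pos _).le (hW n)
  refine ⟨Real.exp (2 * c * K) * 2 + ∑ n ∈ Finset.range n₀, E * W n, by positivity,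
    fun J m => ?_⟩
  have hterm : ∀ n, (growPoly τ c R J).coeff n * W n ≤
      Real.exp (2 * c * K) * (1 / 2) ^ n + if n < n₀ then E * W n else 0 := by
    intro n
    have hcn := h.coeff_growPoly_nonneg hc hR J n
    split_ifs with hn
    · refine le_add_of_nonneg_of_le (by positivity) (mul_le_mul_of_nonneg_right ?_ (hW n))
      have h1 := coeff_mul_pow_le_eval (h.coeff_growPoly_nonneg hc hR J) zero_le_one n
      rw [one_pow, mul_one, eval_growPoly] at h1
      refine h1.trans (prod_one_add_le_exp_tsum (fun j => ?_)
        ((h.summable.mul_left c).mul_right _) J)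
      have := h.pos j
      positivity
    · rw [add_zero]
      have h1 := h.coeff_growPoly_mul_le hc hR (hn₀ n (not_lt.1 hn)) J
      calc _ ≤ (growPoly τ c R J).coeff n * (β ^ n * ∏ j ∈ Finset.range n, (τ j)⁻¹) :=
            mul_le_mul_of_nonneg_left (hWβ n) hcn
        _ = β ^ n * ((growPoly τ c R J).coeff n * ∏ j ∈ Finset.range n, (τ j)⁻¹) := by ring
        _ ≤ β ^ n * ((1 + 2 * c) ^ n * Real.exp (2 * c * K * (n + 1))) := by gcongr
        _ = Real.exp (2 * c * K) * (β * ((1 + 2 * c) * Real.exp (2 * c * K))) ^ n := by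
            rw [mul_pow, mul_pow, ← Real.exp_nat_mul, mul_add, Real.exp_add]
            ring_nf
        _ ≤ _ := by
            gcongr
  calc _ ≤ ∑ n ∈ Finset.range m, (Real.exp (2 * c * K) * (1 / 2) ^ n +
        if n < n₀ then E * W n else 0) := Finset.sum_le_sum fun n _ => hterm n
    _ ≤ _ := by
        rw [Finset.sum_add_distrib, ← Finset.mul_sum]
        refine add_le_add (mul_le_mul_of_nonneg_left ?_ (Real.exp_pos _).le) ?_
        · have h1 : Summable fun n : ℕ => (1 / 2 : ℝ) ^ n := summable_geometric_two
          exact (h1.sum_le_tsum _ fun n _ => by positivity).trans_eq tsum_geometric_two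
        · rw [← Finset.sum_filter]
          refine Finset.sum_le_sum_of_subset_of_nonneg ?_ fun n _ _ =>
            mul_nonneg (Real.exp_pos _).le (hW n)
          intro n hn
          simp only [Finset.mem_filter, Finset.mem_range] at hn ⊢
          exact hn.2

end Tau

/-! ### The symbol on strips -/

section SymbolStrip

variable {d : ℕ}

/-- A leading constant below `2` is what matters: it makes the error caused by the imaginary part on
a strip at most half of the main term of the symbol. -/
theorem exists_add_pow_le (L : ℕ) {b : ℝ} (hb : 0 ≤ b) :
    ∃ C : ℝ, 0 ≤ C ∧ ∀ a : ℝ, 0 ≤ a → (a + b) ^ L ≤ 3 / 2 * a ^ L + C := by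
  have hc : ContinuousAt (fun t : ℝ => (1 + t) ^ L) 0 := by fun_prop
  have h1 : ∀ᶠ t in 𝓝 (0 : ℝ), (1 + t) ^ L < 3 / 2 := by
    refine hc.eventually (gt_mem_nhds ?_)
    norm_num
  obtain ⟨ε, hε, hεt⟩ := Metric.eventually_nhds_iff.1 h1
  have h2 : (1 + ε / 2) ^ L ≤ 3 / 2 := (hεt (by
    rw [dist_zero_right, Real.norm_of_nonneg (by positivity)]; linarith)).le
  refine ⟨(b / (ε / 2) + b) ^ L, by positivity, fun a ha => ?_⟩
  by_cases h : b ≤ ε / 2 * a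
  · have : (a + b) ^ L ≤ ((1 + ε / 2) * a) ^ L := by
      gcongr
      linarith
    rw [mul_pow] at this
    have h3 := mul_le_mul_of_nonneg_right h2 (pow_nonneg ha L)
    have : 0 ≤ (b / (ε / 2) + b) ^ L := by positivity
    linarith
  · have h3 : a ≤ b / (ε / 2) := by
      rw [le_div_iff₀ (by positivity)]; linarith
    have : (a + b) ^ L ≤ (b / (ε / 2) + b) ^ L := by gcongr
    have : 0 ≤ 3 / 2 * a ^ L := by positivity
    linarith

theorem norm_add_pow_sub_pow_le (x y : ℂ) (n : ℕ) :
    ‖(x + y) ^ n - x ^ n‖ ≤ (‖x‖ + ‖y‖) ^ n - ‖x‖ ^ n := by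
  induction n with
  | zero => simp
  | succ n ih =>
    have e : (x + y) ^ (n + 1) - x ^ (n + 1) = ((x + y) ^ n - x ^ n) * x + (x + y) ^ n * y := by
      ring
    rw [e]
    refine (norm_add_le _ _).trans ?_
    rw [norm_mul, norm_mul, norm_pow]
    have h1 : ‖x + y‖ ^ n ≤ (‖x‖ + ‖y‖) ^ n := by gcongr; exact norm_add_le x y
    calc _ ≤ ((‖x‖ + ‖y‖) ^ n - ‖x‖ ^ n) * ‖x‖ + (‖x‖ + ‖y‖) ^ n * ‖y‖ := by gcongr
      _ = _ := by ring

/-- The bounds of the symbol of `∑ᵢ ∂ᵢ^L` on the strip of width `σ`. -/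
structure SymbolBound (d L : ℕ) (σ R C : ℝ) : Prop where
  nonneg : 0 ≤ R
  sector : ∀ ξ η : EuclideanSpace ℝ (Fin d), ‖η‖ < σ → InSector R (symbol L (cpt ξ η))
  growth : ∀ ξ η : EuclideanSpace ℝ (Fin d), ‖η‖ < σ →
    (1 + ‖ξ‖ + ‖η‖) ^ L ≤ C * ((symbol L (cpt ξ η)).re + R)

theorem norm_pow_le_sum (L : ℕ) (ξ : EuclideanSpace ℝ (Fin d)) (hd : 0 < d) :
    ‖ξ‖ ^ L ≤ d ^ L * ∑ i, |ξ i| ^ L := by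
  have : Nonempty (Fin d) := ⟨⟨0, hd⟩⟩
  obtain ⟨j, -, hj⟩ := Finset.exists_max_image Finset.univ (fun i => |ξ i|) Finset.univ_nonempty
  have h1 : ‖ξ‖ ≤ d * |ξ j| := by
    have h2 : ‖ξ‖ ≤ ∑ i, |ξ i| := by
      have h3 : ξ = ∑ i, ξ i • stdVec i := by
        ext k
        simp [Finset.sum_apply, Pi.single_apply]
      calc ‖ξ‖ = ‖∑ i, ξ i • stdVec i‖ := by rw [← h3]
        _ ≤ ∑ i, ‖ξ i • stdVec i‖ := norm_sum_le _ _
        _ = _ := by simp [norm_smul]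
    refine h2.trans ((Finset.sum_le_card_nsmul _ _ _ fun i hi => hj i hi).trans ?_)
    simp
  calc ‖ξ‖ ^ L ≤ (d * |ξ j|) ^ L := by gcongr
    _ = d ^ L * |ξ j| ^ L := mul_pow _ _ _
    _ ≤ _ := by
        gcongr
        exact Finset.single_le_sum (f := fun i => |ξ i| ^ L) (fun i _ => by positivity)
          (Finset.mem_univ j)

/-- On a strip the symbol is a bounded relative perturbation of `∑ᵢ |2πξᵢ|^L`, up to an additive
constant. Only `R` depends on the width; with `C` uniform, one step `h` serves for all exponential
decay rates of the test function. -/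
theorem exists_symbolBound (d : ℕ) {L : ℕ} (hL : 4 ∣ L) (hL0 : 0 < L) :
    ∃ C : ℝ, 1 ≤ C ∧ ∀ σ : ℝ, 0 < σ → ∃ R, SymbolBound d L σ R C := by
  have hpi := Real.pi_gt_three
  refine ⟨3 * d ^ L + 1, le_add_of_nonneg_left (by positivity), fun σ hσ => ?_⟩
  obtain ⟨D, hD, hDb⟩ := exists_add_pow_le L (b := 2 * Real.pi * σ) (by positivity)
  obtain ⟨D', hD', hDb'⟩ := exists_add_pow_le L (b := 1 + σ) (by positivity)
  -- Divisibility by `4` makes the symbol non-negative on real points.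
  have hIL : Complex.I ^ L = 1 := by
    obtain ⟨m, rfl⟩ := hL
    rw [pow_mul, Complex.I_pow_four, one_pow]
  have hLe : Even L := by
    obtain ⟨m, rfl⟩ := hL
    exact ⟨2 * m, by ring⟩
  have key : ∀ ξ η : EuclideanSpace ℝ (Fin d), ‖η‖ < σ →
      ‖symbol L (cpt ξ η) - ((∑ i, |2 * Real.pi * ξ i| ^ L : ℝ) : ℂ)‖ ≤
        1 / 2 * ∑ i, |2 * Real.pi * ξ i| ^ L + d * D := by
    intro ξ η hη
    have h1 : ∀ i, ‖(2 * Real.pi * Complex.I * cpt ξ η i) ^ L -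
        ((|2 * Real.pi * ξ i| ^ L : ℝ) : ℂ)‖ ≤ 1 / 2 * |2 * Real.pi * ξ i| ^ L + D := by
      intro i
      have e1 : (2 * Real.pi * Complex.I * cpt ξ η i) ^ L =
          (((2 * Real.pi * ξ i : ℝ) : ℂ) + (2 * Real.pi * Complex.I * η i)) ^ L := by
        rw [show (2 * Real.pi * Complex.I * cpt ξ η i) = Complex.I *
          (((2 * Real.pi * ξ i : ℝ) : ℂ) + (2 * Real.pi * Complex.I * η i)) by
            simp only [cpt]; push_cast; ring, mul_pow, hIL, one_mul]
      have e2 : ((|2 * Real.pi * ξ i| ^ L : ℝ) : ℂ) = ((2 * Real.pi * ξ i : ℝ) : ℂ) ^ L := by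
        rw [hLe.pow_abs]; push_cast; rfl
      rw [e1, e2]
      refine (norm_add_pow_sub_pow_le _ _ L).trans ?_
      rw [Complex.norm_real, Real.norm_eq_abs]
      have h2 : ‖(2 * Real.pi * Complex.I * (η i : ℂ) : ℂ)‖ ≤ 2 * Real.pi * σ := by
        simp only [norm_mul, Complex.norm_I, mul_one, Complex.norm_real, Complex.norm_ofNat,
          Real.norm_of_nonneg Real.pi_pos.le]
        gcongr
        exact (PiLp.norm_apply_le η i).trans hη.le
      have h3 : (|2 * Real.pi * ξ i| + ‖(2 * Real.pi * Complex.I * (η i : ℂ) : ℂ)‖) ^ L ≤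
          (|2 * Real.pi * ξ i| + 2 * Real.pi * σ) ^ L := by gcongr
      have h4 := hDb _ (abs_nonneg (2 * Real.pi * ξ i))
      linarith
    rw [symbol, Complex.ofReal_sum, ← Finset.sum_sub_distrib]
    refine (norm_sum_le _ _).trans ((Finset.sum_le_sum fun i _ => h1 i).trans (le_of_eq ?_))
    rw [Finset.sum_add_distrib, ← Finset.mul_sum]
    simp
  have hS : ∀ ξ : EuclideanSpace ℝ (Fin d), 0 ≤ ∑ i, |2 * Real.pi * ξ i| ^ L := fun ξ =>
    Finset.sum_nonneg fun i _ => by positivity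
  have hre : ∀ ξ η : EuclideanSpace ℝ (Fin d), ‖η‖ < σ →
      1 / 2 * ∑ i, |2 * Real.pi * ξ i| ^ L - d * D ≤ (symbol L (cpt ξ η)).re := by
    intro ξ η hη
    have h1 := (abs_le.1 (Complex.abs_re_le_norm _)).1.trans' (neg_le_neg (key ξ η hη))
    rw [Complex.sub_re, Complex.ofReal_re] at h1
    linarith
  have hdD : 0 ≤ d * D := by positivity
  -- The first part of `R` compensates the additive error of the symbol, the second the error in
  -- replacing `(1 + ‖ξ‖ + ‖η‖)^L` by `‖ξ‖^L`.
  refine ⟨2 * (d * D) + D', by positivity, fun ξ η hη => ?_, fun ξ η hη => ?_⟩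
  · have h1 := hre ξ η hη
    have h2 : ‖symbol L (cpt ξ η)‖ ≤ 3 / 2 * ∑ i, |2 * Real.pi * ξ i| ^ L + d * D := by
      have h3 := norm_add_le (symbol L (cpt ξ η) - ((∑ i, |2 * Real.pi * ξ i| ^ L : ℝ) : ℂ))
        ((∑ i, |2 * Real.pi * ξ i| ^ L : ℝ) : ℂ)
      rw [sub_add_cancel, Complex.norm_real, Real.norm_of_nonneg (hS ξ)] at h3
      linarith [key ξ η hη]
    have := hS ξ
    simp only [InSector]
    linarith
  · have h1 := hre ξ η hη
    have h2 : (1 + ‖ξ‖ + ‖η‖) ^ L ≤ 3 / 2 * ‖ξ‖ ^ L + D' := by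
      exact (pow_le_pow_left₀ (by positivity) (by linarith) L).trans (hDb' ‖ξ‖ (norm_nonneg ξ))
    have hr : 0 ≤ (symbol L (cpt ξ η)).re + d * D := by linarith [hS ξ]
    have h3 : 3 / 2 * ‖ξ‖ ^ L ≤ 3 * d ^ L * ((symbol L (cpt ξ η)).re + d * D) := by
      rcases Nat.eq_zero_or_pos d with h0 | hd
      · subst h0
        have : ξ = 0 := Subsingleton.elim _ _
        simp [this, hL0.ne']
      · have h4 := norm_pow_le_sum L ξ hd
        have h5 : ∑ i, |ξ i| ^ L ≤ ∑ i, |2 * Real.pi * ξ i| ^ L := by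
          refine Finset.sum_le_sum fun i _ => ?_
          refine pow_le_pow_left₀ (abs_nonneg _) ?_ L
          rw [abs_mul, abs_of_pos (by positivity : (0 : ℝ) < 2 * Real.pi)]
          exact le_mul_of_one_le_left (abs_nonneg _) (by linarith)
        have hdL : (0 : ℝ) ≤ d ^ L := by positivity
        calc 3 / 2 * ‖ξ‖ ^ L ≤ 3 / 2 * (d ^ L * ∑ i, |2 * Real.pi * ξ i| ^ L) := by
              have := mul_le_mul_of_nonneg_left h5 hdL
              linarith
          _ = 3 * d ^ L * (1 / 2 * ∑ i, |2 * Real.pi * ξ i| ^ L) := by ring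
          _ ≤ _ := by
              refine mul_le_mul_of_nonneg_left ?_ (by positivity)
              linarith
    have hdL : (0 : ℝ) ≤ 3 * d ^ L := by positivity
    calc _ ≤ 3 * d ^ L * ((symbol L (cpt ξ η)).re + d * D) + D' := by linarith
      _ ≤ 3 * d ^ L * ((symbol L (cpt ξ η)).re + (2 * (d * D) + D')) +
          ((symbol L (cpt ξ η)).re + (2 * (d * D) + D')) := by
          have : 3 * d ^ L * ((symbol L (cpt ξ η)).re + d * D) ≤
              3 * d ^ L * ((symbol L (cpt ξ η)).re + (2 * (d * D) + D')) :=
            mul_le_mul_of_nonneg_left (by linarith) hdL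
          linarith
      _ = _ := by ring

theorem differentiable_symbol (L : ℕ) : Differentiable ℂ (symbol (d := d) L) := by
  unfold symbol
  fun_prop

variable {L : ℕ} {σ R C₁ : ℝ}

theorem SymbolBound.rapid_of_exp_bound (h : SymbolBound d L σ R C₁) (hL0 : 0 < L) (hC₁ : 0 ≤ C₁)
    {Φ : (Fin d → ℂ) → ℂ} (hΦ : Differentiable ℂ Φ) {D t : ℝ} (ht : 0 < t)
    (hb : ∀ ξ η : EuclideanSpace ℝ (Fin d), ‖η‖ < σ →
      ‖Φ (cpt ξ η)‖ ≤ D * Real.exp (-(t * ((symbol L (cpt ξ η)).re + R)))) : Rapid σ Φ := by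
  refine ⟨fun ξ η _ => hΦ.differentiableAt, fun n => ⟨D * (C₁ ^ n * (n.factorial / t ^ n)),
    fun ξ η hη => ?_⟩⟩
  have hy := (h.sector ξ η hη).nonneg
  set y := (symbol L (cpt ξ η)).re + R with hydef
  have hD : 0 ≤ D := by
    have := (norm_nonneg _).trans (hb ξ η hη)
    exact nonneg_of_mul_nonneg_left this (Real.exp_pos _)
  rw [← div_eq_mul_inv, le_div_iff₀ (by positivity)]
  have h1 : (1 + ‖ξ‖) ^ n ≤ C₁ ^ n * y ^ n := by
    rw [← mul_pow]
    gcongr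
    calc 1 + ‖ξ‖ ≤ 1 + ‖ξ‖ + ‖η‖ := le_add_of_nonneg_right (norm_nonneg _)
      _ ≤ (1 + ‖ξ‖ + ‖η‖) ^ L := le_self_pow₀ (by
          linarith [norm_nonneg ξ, norm_nonneg η]) hL0.ne'
      _ ≤ _ := h.growth ξ η hη
  have h2 : Real.exp (-(t * y)) * y ^ n ≤ n.factorial / t ^ n := by
    have h3 := Real.pow_div_factorial_le_exp (t * y) (by positivity) n
    rw [Real.exp_neg, inv_mul_le_iff₀ (Real.exp_pos _), mul_div_assoc', le_div_iff₀ (by positivity)]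
    rw [div_le_iff₀ (by positivity), mul_pow] at h3
    linarith
  calc ‖Φ (cpt ξ η)‖ * (1 + ‖ξ‖) ^ n ≤ (D * Real.exp (-(t * y))) * (C₁ ^ n * y ^ n) := by
        gcongr
        exact hb ξ η hη
    _ = D * (C₁ ^ n * (Real.exp (-(t * y)) * y ^ n)) := by ring
    _ ≤ _ := by gcongr

theorem SymbolBound.rapid_cexp (h : SymbolBound d L σ R C₁) (hL0 : 0 < L) (hC₁ : 0 ≤ C₁)
    {t : ℝ} (ht : 0 < t) : Rapid (d := d) σ fun z => Complex.exp (-(symbol L z * t)) := by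
  refine h.rapid_of_exp_bound hL0 hC₁ (D := Real.exp (t * R)) ?_ ht fun ξ η hη => ?_
  · have := differentiable_symbol (d := d) L
    fun_prop
  · rw [Complex.norm_exp, ← Real.exp_add, Complex.neg_re, re_mul_tau]
    refine Real.exp_le_exp.2 (le_of_eq (by ring))

variable {τ : ℕ → ℝ} {K ε : ℝ}

/-- The finitely many factors of `exp(G_J)` are merely bounded on the strip. All the decay comes
from the regularizing factor `exp(-q τ_J)`. -/
theorem SymbolBound.rapid_expPart (h : SymbolBound d L σ R C₁) (hL0 : 0 < L) (hC₁ : 0 ≤ C₁)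
    (hτ : TauSeq τ K) (hε : 0 ≤ ε) (J : ℕ) :
    Rapid (d := d) σ fun z => expPart τ ε J (symbol L z) := by
  refine h.rapid_of_exp_bound hL0 hC₁
    (D := (Real.exp (ε * (1 + Real.exp (R * τ 0)))) ^ J * Real.exp (τ J * R))
    ((differentiable_expPart J).comp (differentiable_symbol L)) (hτ.pos J) fun ξ η hη => ?_
  have hq := h.sector ξ η hη
  rw [expPart, sub_eq_add_neg, Complex.exp_add, norm_mul, cexp_gPart, norm_prod, mul_assoc]
  refine mul_le_mul ?_ ?_ (norm_nonneg _) (by positivity)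
  · calc _ ≤ ∏ j ∈ Finset.range J, Real.exp (ε * (1 + Real.exp (R * τ 0))) :=
          Finset.prod_le_prod (fun j _ => norm_nonneg _) fun j _ =>
            norm_factor_le (hτ.pos j).le h.nonneg (hτ.anti (Nat.zero_le j)) hε hq
      _ = _ := by simp
  · rw [Complex.norm_exp, ← Real.exp_add, Complex.neg_re, re_mul_tau]
    refine Real.exp_le_exp.2 (le_of_eq (by ring))

theorem one_le_norm_add (R : ℝ) (q : ℂ) : q.re + R + 1 ≤ ‖q + R + 1‖ := by
  refine le_trans (le_of_eq ?_) (Complex.re_le_norm _)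
  simp

/-- Division by `(q + R + 1)²` in estimates on strips. -/
theorem SymbolBound.norm_div_sq_le (h : SymbolBound d L σ R C₁) (hLd : d + 1 ≤ L) (hC₁ : 0 ≤ C₁)
    {ξ η : EuclideanSpace ℝ (Fin d)} (hη : ‖η‖ < σ) {v : ℂ} {D : ℝ} (hD : 0 ≤ D)
    (hv : ‖v‖ ≤ D * ‖symbol L (cpt ξ η)‖) :
    ‖v / (symbol L (cpt ξ η) + R + 1) ^ 2‖ ≤ 4 * C₁ * D * ((1 + ‖ξ‖) ^ (d + 1))⁻¹ := by
  have hq := h.sector ξ η hη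
  have hy := hq.nonneg
  have h1 := one_le_norm_add R (symbol L (cpt ξ η))
  set q := symbol L (cpt ξ η)
  set y := q.re + R
  -- One of the two factors `q + R + 1` absorbs `‖q‖`. The other, thanks to `L ≥ d + 1`, supplies
  -- the decay that is integrable on planes.
  have h2 : ‖q‖ ≤ 4 * ‖q + R + 1‖ := hq.trans (by
    change 4 * y ≤ _
    linarith)
  have h3 : (1 + ‖ξ‖) ^ (d + 1) ≤ C₁ * ‖q + R + 1‖ := by
    calc (1 + ‖ξ‖) ^ (d + 1) ≤ (1 + ‖ξ‖) ^ L :=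
          pow_le_pow_right₀ (by linarith [norm_nonneg ξ]) hLd
      _ ≤ (1 + ‖ξ‖ + ‖η‖) ^ L := pow_le_pow_left₀ (by positivity)
          (le_add_of_nonneg_right (norm_nonneg _)) L
      _ ≤ C₁ * y := h.growth ξ η hη
      _ ≤ _ := by gcongr; linarith
  have hpos : 0 < ‖q + R + 1‖ := by linarith
  rw [norm_div, norm_pow, div_le_iff₀ (by positivity), ← div_eq_mul_inv, div_mul_eq_mul_div,
    le_div_iff₀ (by positivity)]
  calc ‖v‖ * (1 + ‖ξ‖) ^ (d + 1) ≤ (D * (4 * ‖q + R + 1‖)) * (C₁ * ‖q + R + 1‖) := by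
        gcongr
        exact hv.trans (by gcongr)
    _ = _ := by ring

theorem SymbolBound.rapid_div_sq (h : SymbolBound d L σ R C₁) {Φ : (Fin d → ℂ) → ℂ}
    (hΦ : Rapid σ Φ) : Rapid σ fun z => Φ z / (symbol L z + R + 1) ^ 2 := by
  have := hΦ.mul_poly (g := fun z => ((symbol L z + R + 1) ^ 2)⁻¹) (C := 1) (k := 0)
    (fun ξ η hη => ?_) (fun ξ η hη => ?_)
  · simpa only [div_eq_inv_mul] using this
  · have h1 := one_le_norm_add R (symbol L (cpt ξ η))
    have h0 : symbol L (cpt ξ η) + R + 1 ≠ 0 := by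
      rw [← norm_pos_iff]
      linarith [(h.sector ξ η hη).nonneg]
    have := (differentiable_symbol (d := d) L)
    exact DifferentiableAt.inv (by fun_prop) (pow_ne_zero 2 h0)
  · have h1 := one_le_norm_add R (symbol L (cpt ξ η))
    have h2 : 1 ≤ ‖symbol L (cpt ξ η) + R + 1‖ := by linarith [(h.sector ξ η hη).nonneg]
    rw [norm_inv, norm_pow, pow_zero, mul_one]
    exact inv_le_one_of_one_le₀ (one_le_pow₀ h2)

/-- The differences of the regularized exponentials, divided by the dominating polynomials. -/
theorem SymbolBound.exists_stripBound_expPart_sub (h : SymbolBound d L σ R C₁) (hL0 : 0 < L)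
    (hLd : d + 1 ≤ L) (hC₁ : 0 ≤ C₁) (hτ : TauSeq τ K) (hε : 0 ≤ ε) :
    ∃ C : ℝ, 0 ≤ C ∧ ∀ J, ∃ Θ : (Fin d → ℂ) → ℂ, Rapid σ Θ ∧ StripBound σ (C * τ J) Θ ∧
      ∀ ξ η : EuclideanSpace ℝ (Fin d), ‖η‖ < σ →
        expPart τ ε (J + 1) (symbol L (cpt ξ η)) - expPart τ ε J (symbol L (cpt ξ η)) =
        Polynomial.aeval (symbol L (cpt ξ η)) (growPoly τ (growConst ε) R J) *
          ((symbol L (cpt ξ η) + R + 1) ^ 2 * Θ (cpt ξ η)) := by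
  obtain ⟨C, hC, hCb⟩ := hτ.exists_norm_expPart_sub_le hε h.nonneg
  refine ⟨4 * C₁ * C, by positivity, fun J => ?_⟩
  let P : (Fin d → ℂ) → ℂ := fun z =>
    Polynomial.aeval (symbol L z) (growPoly τ (growConst ε) R J)
  let F : (Fin d → ℂ) → ℂ := fun z =>
    expPart τ ε (J + 1) (symbol L z) - expPart τ ε J (symbol L z)
  have hP1 : ∀ ξ η : EuclideanSpace ℝ (Fin d), ‖η‖ < σ → 1 ≤ ‖P (cpt ξ η)‖ := fun ξ η hη =>
    hτ.one_le_norm_aeval (growConst_nonneg hε) J (h.sector ξ η hη)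
  have hP0 : ∀ ξ η : EuclideanSpace ℝ (Fin d), ‖η‖ < σ → P (cpt ξ η) ≠ 0 := fun ξ η hη =>
    norm_pos_iff.1 (one_pos.trans_le (hP1 ξ η hη))
  have hPd : Differentiable ℂ P := by
    exact (Polynomial.differentiable_aeval (𝕜 := ℂ) _).comp (differentiable_symbol L)
  have hF : Rapid σ F :=
    (h.rapid_expPart hL0 hC₁ hτ hε (J + 1)).sub (h.rapid_expPart hL0 hC₁ hτ hε J)
  have hFP : Rapid σ fun z => F z / P z := by
    have := hF.mul_poly (g := fun z => (P z)⁻¹) (C := 1) (k := 0)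
      (fun ξ η hη => (hPd.differentiableAt).inv (hP0 ξ η hη)) (fun ξ η hη => by
        rw [norm_inv, pow_zero, mul_one]
        exact inv_le_one_of_one_le₀ (hP1 ξ η hη))
    simpa only [div_eq_inv_mul] using this
  -- The quotient has size `τ_J` on the strip. The two divisors are polynomials in the symbol, so
  -- they can later be transferred to the orbit by integration by parts.
  refine ⟨fun z => F z / P z / (symbol L z + R + 1) ^ 2, h.rapid_div_sq hFP,
    ⟨(h.rapid_div_sq hFP).diff, fun ξ η hη => ?_⟩, fun ξ η hη => ?_⟩
  · have := h.norm_div_sq_le hLd hC₁ hη (v := F (cpt ξ η) / P (cpt ξ η)) (D := C * τ J)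
      (mul_nonneg hC (hτ.pos J).le) (by
        rw [norm_div, div_le_iff₀ (one_pos.trans_le (hP1 ξ η hη))]
        refine (hCb J _ (h.sector ξ η hη)).trans (le_of_eq ?_)
        simp only [P]
        ring)
    simpa only [mul_assoc] using this
  · have h1 := one_le_norm_add R (symbol L (cpt ξ η))
    have h0 : symbol L (cpt ξ η) + R + 1 ≠ 0 := by
      rw [← norm_pos_iff]
      linarith [(h.sector ξ η hη).nonneg]
    have := hP0 ξ η hη
    change F (cpt ξ η) = P (cpt ξ η) * _
    field_simp

/-- No growth polynomial is needed here, because `exp(-G)` cancels the growth of `exp(G_J)`. This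
estimate identifies the limit, not the convergence to it. -/
theorem SymbolBound.exists_stripBound_exp_mul_expPart_sub (h : SymbolBound d L σ R C₁)
    (hL0 : 0 < L) (hLd : d + 1 ≤ L) (hC₁ : 0 ≤ C₁) (hτ : TauSeq τ K) (hε : 0 ≤ ε)
    (hΨ : Rapid (d := d) σ fun z => Complex.exp (-gTot τ ε (symbol L z))) :
    ∃ C : ℝ, 0 ≤ C ∧ ∀ J, ∃ Θ : (Fin d → ℂ) → ℂ, Rapid σ Θ ∧
      StripBound σ (C * ∑' j, τ (J + j)) Θ ∧
      ∀ ξ η : EuclideanSpace ℝ (Fin d), ‖η‖ < σ →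
        Complex.exp (-gTot τ ε (symbol L (cpt ξ η))) * expPart τ ε J (symbol L (cpt ξ η)) -
          Complex.exp (-(symbol L (cpt ξ η) * τ J)) =
        (symbol L (cpt ξ η) + R + 1) ^ 2 * Θ (cpt ξ η) := by
  obtain ⟨C, hC, hCb⟩ := hτ.exists_norm_exp_mul_expPart_sub_le hε h.nonneg
  refine ⟨4 * C₁ * C, by positivity, fun J => ?_⟩
  let F : (Fin d → ℂ) → ℂ := fun z => Complex.exp (-gTot τ ε (symbol L z)) *
    expPart τ ε J (symbol L z) - Complex.exp (-(symbol L z * τ J))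
  have hF : Rapid σ F := by
    refine Rapid.sub ?_ (h.rapid_cexp hL0 hC₁ (hτ.pos J))
    obtain ⟨A, hA⟩ := hΨ.bound 0
    simp only [pow_zero, inv_one, mul_one] at hA
    exact (h.rapid_expPart hL0 hC₁ hτ hε J).mul_poly (C := A) (k := 0) hΨ.diff
      fun ξ η hη => by simpa using hA ξ η hη
  refine ⟨fun z => F z / (symbol L z + R + 1) ^ 2, h.rapid_div_sq hF,
    ⟨(h.rapid_div_sq hF).diff, fun ξ η hη => ?_⟩, fun ξ η hη => ?_⟩
  · have := h.norm_div_sq_le hLd hC₁ hη (v := F (cpt ξ η)) (D := C * ∑' j, τ (J + j))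
      (mul_nonneg hC (tsum_nonneg fun j => (hτ.pos _).le)) (by
        refine (hCb J _ (h.sector ξ η hη)).trans (le_of_eq ?_)
        ring)
    simpa only [mul_assoc] using this
  · have h1 := one_le_norm_add R (symbol L (cpt ξ η))
    have h0 : symbol L (cpt ξ η) + R + 1 ≠ 0 := by
      rw [← norm_pos_iff]
      linarith [(h.sector ξ η hη).nonneg]
    change F (cpt ξ η) = _
    field_simp

/-! ### The kernel of the exponential of the series -/

/-- With `k` the first index such that `Re q < (Λ νₖ)^L`, the frequency is at most a multiple of
`νₖ`, while `Re G ≥ k log H - c`. The choice `ε = 2 log H` thus yields the factor `H^{-k}` that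
cancels the loss in `νₖ^n ≤ C H^{k+n} N_n`. -/
theorem SymbolBound.exists_exp_gTot_bound {N : ℕ → ℝ} (hN : RegularWeight N)
    (h : SymbolBound d L σ R C₁) (hL0 : 0 < L) (hC₁ : 1 ≤ C₁) {Λ : ℝ} (hΛ : 0 < Λ)
    (hτ : TauSeq (fun j => ((Λ * ratio N j) ^ L)⁻¹) K) {C H : ℝ} (hC : 1 ≤ C) (hH : 1 ≤ H)
    (hCH : ∀ k n, ratio N k ^ n ≤ C * H ^ (k + n) * N n) :
    ∃ D : ℝ, 0 ≤ D ∧ ∀ n, ∀ ξ η : EuclideanSpace ℝ (Fin d), ‖η‖ < σ →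
      (1 + ‖ξ‖ + ‖η‖) ^ n * ‖Complex.exp (-gTot (fun j => ((Λ * ratio N j) ^ L)⁻¹)
        (2 * Real.log H) (symbol L (cpt ξ η)))‖ ≤ D * (2 * C₁ * (Λ + 1) * H) ^ n * N n := by
  set τ : ℕ → ℝ := fun j => ((Λ * ratio N j) ^ L)⁻¹ with hτdef
  have hlog : 0 ≤ 2 * Real.log H := mul_nonneg zero_le_two (Real.log_nonneg hH)
  obtain ⟨c, hc, hcb⟩ := hτ.exists_re_gTot_ge hlog h.nonneg
  have hR := h.nonneg
  have hC₁0 : 0 < C₁ := by linarith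
  have hH0 : 0 < H := by linarith
  obtain ⟨D', hD', hDb'⟩ := hN.pow_le (R := C₁ * (2 * R)) (by positivity)
  refine ⟨Real.exp c * (D' + C), by positivity, fun n ξ η hη => ?_⟩
  have hq := h.sector ξ η hη
  have hg := h.growth ξ η hη
  set q := symbol L (cpt ξ η)
  set ρ := 1 + ‖ξ‖ + ‖η‖ with hρ
  have hρ1 : 1 ≤ ρ := by rw [hρ]; linarith [norm_nonneg ξ, norm_nonneg η]
  have hNn := hN.pos n
  have hA1 : 1 ≤ 2 * C₁ * (Λ + 1) * H := by
    have h2 : 1 ≤ 2 * C₁ := by linarith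
    exact one_le_mul_of_one_le_of_one_le (one_le_mul_of_one_le_of_one_le h2 (by linarith)) hH
  rw [Complex.norm_exp, Complex.neg_re]
  -- For `Re q < R` the frequency is bounded, and its powers are dominated by the weight alone.
  rcases lt_or_ge q.re R with hqR | hqR
  · have h1 := hcb 0 q hq (by simp)
    have h2 : ρ ≤ C₁ * (2 * R) := by
      calc ρ ≤ ρ ^ L := le_self_pow₀ hρ1 hL0.ne'
        _ ≤ C₁ * (q.re + R) := hg
        _ ≤ _ := by gcongr; linarith
    calc ρ ^ n * Real.exp (-(gTot τ (2 * Real.log H) q).re) ≤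
        (D' * N n) * Real.exp c := by
          gcongr
          · exact (pow_le_pow_left₀ (by linarith) h2 n).trans (hDb' n)
          · simp only [Nat.cast_zero, mul_zero, zero_sub] at h1
            linarith
      _ = Real.exp c * D' * 1 * N n := by ring
      _ ≤ _ := by
          gcongr
          · linarith
          · exact one_le_pow₀ hA1
  · have hex : ∃ k, q.re < (Λ * ratio N k) ^ L := by
      have h1 : Tendsto (fun k => (Λ * ratio N k) ^ L) atTop atTop :=
        (tendsto_pow_atTop hL0.ne').comp (hN.tendsto_ratio.const_mul_atTop hΛ)
      exact (h1.eventually_gt_atTop q.re).exists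
    classical
    let k := Nat.find hex
    have hk : q.re < (Λ * ratio N k) ^ L := Nat.find_spec hex
    have hkj : ∀ j < k, 1 ≤ q.re * τ j := by
      intro j hj
      have h2 := not_lt.1 (Nat.find_min hex hj)
      have := hN.ratio_pos j
      simp only [hτdef]
      rw [← div_eq_mul_inv, one_le_div (by positivity)]
      exact h2
    have hνk := hN.ratio_pos k
    have h1 := hcb k q hq hkj
    have h2 : ρ ≤ 2 * C₁ * (Λ + 1) * ratio N k := by
      refine le_of_pow_le_pow_left₀ hL0.ne' (by positivity) (hg.trans ?_)
      calc C₁ * (q.re + R) ≤ 2 * C₁ * (Λ * ratio N k) ^ L := by nlinarith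
        _ ≤ (2 * C₁) ^ L * ((Λ + 1) * ratio N k) ^ L := by
            gcongr
            · exact le_self_pow₀ (by linarith) hL0.ne'
            · linarith
        _ = _ := by rw [← mul_pow, ← mul_assoc]
    have h3 : Real.exp (-(gTot τ (2 * Real.log H) q).re) ≤ Real.exp c * (H ^ k)⁻¹ := by
      have h4 : (H ^ k)⁻¹ = Real.exp (-(Real.log H * k)) := by
        rw [Real.exp_neg, mul_comm, Real.exp_nat_mul, Real.exp_log hH0]
      rw [h4, ← Real.exp_add]
      refine Real.exp_le_exp.2 ?_
      linarith
    calc ρ ^ n * Real.exp (-(gTot τ (2 * Real.log H) q).re)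
        ≤ (2 * C₁ * (Λ + 1) * ratio N k) ^ n * (Real.exp c * (H ^ k)⁻¹) := by gcongr
      _ = Real.exp c * (2 * C₁ * (Λ + 1)) ^ n * (H ^ k)⁻¹ * ratio N k ^ n := by
          rw [mul_pow _ (ratio N k)]; ring
      _ ≤ Real.exp c * (2 * C₁ * (Λ + 1)) ^ n * (H ^ k)⁻¹ * (C * H ^ (k + n) * N n) := by
          gcongr
          exact hCH k n
      _ = Real.exp c * C * (2 * C₁ * (Λ + 1) * H) ^ n * N n := by
          rw [pow_add, mul_pow _ H]
          field_simp
      _ ≤ _ := by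
          gcongr
          linarith

theorem norm_monSymbol_le (α : Fin d → ℕ) (ξ η : EuclideanSpace ℝ (Fin d)) :
    ‖monSymbol α (cpt ξ η)‖ ≤ (2 * Real.pi * (1 + ‖ξ‖ + ‖η‖)) ^ multiLength α := by
  rw [monSymbol, norm_prod, multiLength, ← Finset.prod_pow_eq_pow_sum]
  refine Finset.prod_le_prod (fun i _ => norm_nonneg _) fun i _ => ?_
  rw [norm_pow]
  gcongr
  simp only [norm_mul, Complex.norm_I, mul_one, Complex.norm_real, Complex.norm_ofNat,
    Real.norm_of_nonneg Real.pi_pos.le]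
  gcongr
  linarith [norm_cpt_le ξ η i]

/-- Kernels of functions that are bounded by the weights on all strips are test functions. -/
theorem exists_kernel_mem_KSpaceH {N : ℕ → ℝ} (hN : RegularWeight N) {Ψ : (Fin d → ℂ) → ℂ}
    (hΨ : Differentiable ℂ Ψ) {A : ℝ} (hA : 0 < A)
    (hb : ∀ σ : ℝ, 0 < σ → ∃ D : ℝ, 0 ≤ D ∧ ∀ n, ∀ ξ η : EuclideanSpace ℝ (Fin d), ‖η‖ < σ →
      (1 + ‖ξ‖ + ‖η‖) ^ n * ‖Ψ (cpt ξ η)‖ ≤ D * A ^ n * N n) :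
    (∀ σ, Rapid σ Ψ) ∧ ∃ h : ℝ, 0 < h ∧ kernel Ψ ∈ KSpaceH N h d := by
  have hpi := Real.pi_pos
  have hrap : ∀ σ, Rapid σ Ψ := by
    intro σ
    refine Rapid.mono ?_ (le_max_left σ 1)
    refine ⟨fun ξ η _ => hΨ.differentiableAt, fun n => ?_⟩
    obtain ⟨D, hD, hDb⟩ := hb (max σ 1) (by positivity)
    refine ⟨D * A ^ n * N n, fun ξ η hη => ?_⟩
    rw [← div_eq_mul_inv, le_div_iff₀ (by positivity), mul_comm]
    refine le_trans (mul_le_mul_of_nonneg_right ?_ (norm_nonneg _)) (hDb n ξ η hη)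
    exact pow_le_pow_left₀ (by positivity) (le_add_of_nonneg_right (norm_nonneg _)) n
  refine ⟨hrap, ?_⟩
  obtain ⟨C₀, H, hC₀, hH, h2⟩ := hN.m2
  have hH0 : 0 < H := by linarith
  refine ⟨(2 * Real.pi * A * H)⁻¹, by positivity, ?_⟩
  have hfam := isPartialFamily_kernel (hrap 1) one_pos
  have e0 : (fun z => monSymbol (0 : Fin d → ℕ) z * Ψ z) = Ψ := by
    funext z; rw [monSymbol_zero, one_mul]
  have hmd : ∀ α, multiDeriv α (kernel Ψ) = kernel fun z => monSymbol α z * Ψ z := by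
    intro α
    have := hfam.multiDeriv_eq α
    simpa only [e0] using this
  refine ⟨by simpa only [e0] using hfam.contDiff 0, fun n => ?_⟩
  -- A strip of width `n + 1` admits a shift by `n`, hence decay `exp(-2πn‖x‖)`. By `(M.2)` the
  -- additional power `d + 1`, spent on integrability, splits off from `N_{|α|}`.
  obtain ⟨D, hD, hDb⟩ := hb (n + 1) (by positivity)
  refine ⟨D * (A * H) ^ (d + 1) * C₀ * N (d + 1) * japaneseConst d, fun α x => ?_⟩
  rw [hmd]
  set l := multiLength α
  have hNl := hN.pos l
  have hNd := hN.pos (d + 1)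
  have hsb : StripBound (n + 1) (D * (A * H) ^ (d + 1) * C₀ * N (d + 1) *
      ((2 * Real.pi * A * H) ^ l * N l)) fun z => monSymbol α z * Ψ z := by
    refine ⟨((hrap (n + 1)).monSymbol_mul α).diff, fun ξ η hη => ?_⟩
    rw [← div_eq_mul_inv, le_div_iff₀ (by positivity), norm_mul]
    calc ‖monSymbol α (cpt ξ η)‖ * ‖Ψ (cpt ξ η)‖ * (1 + ‖ξ‖) ^ (d + 1)
        ≤ (2 * Real.pi * (1 + ‖ξ‖ + ‖η‖)) ^ l * ‖Ψ (cpt ξ η)‖ * (1 + ‖ξ‖ + ‖η‖) ^ (d + 1) := by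
          refine mul_le_mul (mul_le_mul_of_nonneg_right (norm_monSymbol_le α ξ η)
            (norm_nonneg _)) ?_ (by positivity) (by positivity)
          exact pow_le_pow_left₀ (by positivity) (le_add_of_nonneg_right (norm_nonneg _)) _
      _ = (2 * Real.pi) ^ l * ((1 + ‖ξ‖ + ‖η‖) ^ (l + (d + 1)) * ‖Ψ (cpt ξ η)‖) := by
          rw [mul_pow, pow_add]; ring
      _ ≤ (2 * Real.pi) ^ l * (D * A ^ (l + (d + 1)) * (C₀ * H ^ (l + (d + 1)) * N l *
            N (d + 1))) := by
          refine mul_le_mul_of_nonneg_left ((hDb _ ξ η hη).trans ?_) (by positivity)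
          exact mul_le_mul_of_nonneg_left (h2 l (d + 1)) (by positivity)
      _ = _ := by
          simp only [mul_pow, pow_add]
          ring
  have hk := hsb.norm_kernel_le (s := n) (by positivity) (by linarith) x
  have hexp : Real.exp (-(2 * Real.pi * n * ‖x‖)) * Real.exp (n * ‖x‖) ≤ 1 := by
    rw [← Real.exp_add, Real.exp_le_one_iff]
    have h3 : 0 ≤ n * ‖x‖ := by positivity
    nlinarith [Real.pi_gt_three]
  rw [div_le_iff₀ hNl]
  have hJ := japaneseConst_nonneg (d := d)
  calc _ ≤ ((2 * Real.pi * A * H)⁻¹) ^ l * (D * (A * H) ^ (d + 1) * C₀ * N (d + 1) *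
      ((2 * Real.pi * A * H) ^ l * N l) * japaneseConst d * Real.exp (-(2 * Real.pi * n * ‖x‖))) *
        Real.exp (n * ‖x‖) := by gcongr
    _ = (D * (A * H) ^ (d + 1) * C₀ * N (d + 1) * japaneseConst d * N l) *
        (Real.exp (-(2 * Real.pi * n * ‖x‖)) * Real.exp (n * ‖x‖)) := by
        rw [inv_pow]
        have : (2 * Real.pi * A * H) ^ l ≠ 0 := by positivity
        field_simp
    _ ≤ (D * (A * H) ^ (d + 1) * C₀ * N (d + 1) * japaneseConst d * N l) * 1 := by
        gcongr
    _ = _ := mul_one _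

end SymbolStrip

/-! ### Weighted families of derivatives -/

section Scalar

variable {d : ℕ}

/-- Families of derivatives of scalar functions of exponential type with bounds by weights. -/
structure WeightedFamily (N : ℕ → ℝ) (κ C A : ℝ)
    (u : (Fin d → ℕ) → EuclideanSpace ℝ (Fin d) → ℂ) : Prop where
  family : IsPartialFamily u
  bound : ∀ α x, ‖u α x‖ ≤ C * Real.exp (κ * ‖x‖) * (A ^ multiLength α * N (multiLength α))

variable {N : ℕ → ℝ} {κ C A : ℝ} {u : (Fin d → ℕ) → EuclideanSpace ℝ (Fin d) → ℂ}

theorem WeightedFamily.expFamily (hu : WeightedFamily N κ C A u) : ExpFamily κ u :=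
  ⟨hu.family, fun α => ⟨C * (A ^ multiLength α * N (multiLength α)), fun x =>
    (hu.bound α x).trans (le_of_eq (by ring))⟩⟩

theorem WeightedFamily.nonneg (hu : WeightedFamily N κ C A u) (hN : 0 < N 0) : 0 ≤ C := by
  have h := (norm_nonneg _).trans (hu.bound 0 0)
  simp only [multiLength, Pi.zero_apply, Finset.sum_const_zero, pow_zero, one_mul, norm_zero,
    mul_zero, Real.exp_zero, mul_one] at h
  exact nonneg_of_mul_nonneg_left h hN

theorem WeightedFamily.translate (hu : WeightedFamily N κ C A u) (hN : ∀ n, 0 < N n)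
    (hA : 0 ≤ A) (hκ : 0 ≤ κ) (x : EuclideanSpace ℝ (Fin d)) :
    WeightedFamily N κ (C * Real.exp (κ * ‖x‖)) A fun α y => u α (x + y) := by
  have hC := hu.nonneg (hN 0)
  refine ⟨⟨fun α => (hu.family.continuous α).comp (continuous_const.add continuous_id),
    fun α i y => ?_⟩, fun α y => (hu.bound α (x + y)).trans ?_⟩
  · have := hu.family.hasLineDerivAt α i (x + y)
    unfold HasLineDerivAt at this ⊢
    simpa only [add_assoc] using this
  · have := hN (multiLength α)
    rw [mul_assoc C (Real.exp (κ * ‖x‖)), ← Real.exp_add]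
    gcongr
    rw [← mul_add]
    exact mul_le_mul_of_nonneg_left (norm_add_le x y) hκ

theorem norm_jetOp_pow_le (L : ℕ) {x : EuclideanSpace ℝ (Fin d)} {E : ℝ} {w : ℕ → ℝ}
    (h : ∀ α, ‖u α x‖ ≤ E * w (multiLength α)) (n : ℕ) (α : Fin d → ℕ) :
    ‖(jetOp d L _ ^ n) u α x‖ ≤ E * (d ^ n * w (multiLength α + L * n)) := by
  induction n generalizing α with
  | zero => simpa using h α
  | succ n ih =>
    rw [pow_succ', Module.End.mul_apply, jetOp_apply, Finset.sum_apply]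
    refine (norm_sum_le _ _).trans ?_
    have h1 : ∀ i ∈ (Finset.univ : Finset (Fin d)),
        ‖(jetOp d L _ ^ n) u (α + Pi.single i L) x‖ ≤
          E * (d ^ n * w (multiLength α + L * (n + 1))) := by
      intro i _
      have := ih (α + Pi.single i L)
      rwa [multiLength_add_single, add_assoc, show L + L * n = L * (n + 1) by ring] at this
    refine (Finset.sum_le_card_nsmul _ _ _ h1).trans (le_of_eq ?_)
    simp only [Finset.card_univ, Fintype.card_fin, nsmul_eq_mul, pow_succ]
    ring

theorem norm_aeval_jetOp_le (L : ℕ) {x : EuclideanSpace ℝ (Fin d)} {E : ℝ} {w : ℕ → ℝ}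
    (h : ∀ α, ‖u α x‖ ≤ E * w (multiLength α)) {p : Polynomial ℝ} (hp : ∀ n, 0 ≤ p.coeff n)
    (α : Fin d → ℕ) : ‖Polynomial.aeval (jetOp d L _) p u α x‖ ≤
      E * ∑ n ∈ Finset.range (p.natDegree + 1),
        p.coeff n * (d ^ n * w (multiLength α + L * n)) := by
  rw [Polynomial.aeval_eq_sum_range, LinearMap.sum_apply, Finset.sum_apply, Finset.sum_apply,
    Finset.mul_sum]
  refine (norm_sum_le _ _).trans (Finset.sum_le_sum fun n _ => ?_)
  rw [LinearMap.smul_apply, Pi.smul_apply, Pi.smul_apply, norm_smul, Real.norm_of_nonneg (hp n)]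
  have := mul_le_mul_of_nonneg_left (norm_jetOp_pow_le L h n α) (hp n)
  linarith

/-- By `(M.2)` the weight at `|α| + Ln` splits, at the cost of one factor `H` in the step. The
coefficients then enter only through the new constant, which is to be bounded uniformly in `J`. -/
theorem WeightedFamily.aeval (hu : WeightedFamily N κ C A u) (hN : ∀ n, 0 < N n) (hA : 0 ≤ A)
    {C₀ H : ℝ} (h2 : ∀ p q, N (p + q) ≤ C₀ * H ^ (p + q) * N p * N q) (L : ℕ)
    {p : Polynomial ℝ} (hp : ∀ n, 0 ≤ p.coeff n) :
    WeightedFamily N κ (C * (C₀ * ∑ n ∈ Finset.range (p.natDegree + 1),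
      p.coeff n * (d ^ n * ((A * H) ^ (L * n) * N (L * n))))) (A * H)
      (Polynomial.aeval (jetOp d L _) p u) := by
  refine ⟨(hu.expFamily.aeval L p).family, fun α x => ?_⟩
  have hC := hu.nonneg (hN 0)
  refine (norm_aeval_jetOp_le L (E := C * Real.exp (κ * ‖x‖)) (w := fun k => A ^ k * N k)
    (fun α => hu.bound α x) hp α).trans ?_
  have h1 : ∀ n, A ^ (multiLength α + L * n) * N (multiLength α + L * n) ≤
      C₀ * ((A * H) ^ (L * n) * N (L * n)) * ((A * H) ^ multiLength α * N (multiLength α)) := by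
    intro n
    calc _ ≤ A ^ (multiLength α + L * n) * (C₀ * H ^ (multiLength α + L * n) *
          N (multiLength α) * N (L * n)) :=
          mul_le_mul_of_nonneg_left (h2 _ _) (pow_nonneg hA _)
      _ = _ := by simp only [pow_add, mul_pow]; ring
  calc _ ≤ C * Real.exp (κ * ‖x‖) * ∑ n ∈ Finset.range (p.natDegree + 1), p.coeff n * (d ^ n *
        (C₀ * ((A * H) ^ (L * n) * N (L * n)) *
          ((A * H) ^ multiLength α * N (multiLength α)))) := by
        refine mul_le_mul_of_nonneg_left (Finset.sum_le_sum fun n _ => ?_) (by positivity)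
        exact mul_le_mul_of_nonneg_left (mul_le_mul_of_nonneg_left (h1 n) (by positivity)) (hp n)
    _ = _ := by
        simp only [Finset.mul_sum, Finset.sum_mul]
        refine Finset.sum_congr rfl fun n _ => ?_
        ring

theorem kernel_congr {Φ Ψ : (Fin d → ℂ) → ℂ}
    (h : ∀ ξ : EuclideanSpace ℝ (Fin d), Φ (cpt ξ 0) = Ψ (cpt ξ 0)) : kernel Φ = kernel Ψ := by
  funext x
  simp only [kernel, h]

theorem WeightedFamily.norm_integral_kernel_le (hu : WeightedFamily N κ C A u)
    (hN : ∀ n, 0 < N n) (hA : 0 ≤ A) (hκ : 0 ≤ κ) {σ D : ℝ} (hκσ : κ + 1 < 2 * Real.pi * σ)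
    {Φ : (Fin d → ℂ) → ℂ} (hΦ : StripBound σ D Φ) (α : Fin d → ℕ) :
    ‖∫ x, kernel Φ x * u α x‖ ≤
      D * momentConst d * C * (A ^ multiLength α * N (multiLength α)) := by
  have hC := hu.nonneg (hN 0)
  have h1 := hΦ.moment hκ hκσ
  refine (norm_integral_mul_le (C := C * (A ^ multiLength α * N (multiLength α))) h1.1
    fun x => (hu.bound α x).trans (le_of_eq (by ring))).trans ?_
  have := hN (multiLength α)
  calc _ ≤ C * (A ^ multiLength α * N (multiLength α)) * (D * momentConst d) := by
        gcongr
        exact h1.2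
    _ = _ := by ring

/-- The data of an entire function `G(q) = ε ∑ⱼ (1 - exp(-q τⱼ))` of `q = ∑ᵢ ∂ᵢ^L` that is adapted to
families of derivatives bounded by `A^n N_n`. -/
structure SeriesData (d : ℕ) (N : ℕ → ℝ) (A : ℝ) where
  L : ℕ
  τ : ℕ → ℝ
  s : ℕ → ℝ
  C₁ : ℝ
  K : ℝ
  ε : ℝ
  C₀ : ℝ
  H : ℝ
  D : ℝ
  β : ℝ
  weight_pos : ∀ n, 0 < N n
  A_nonneg : 0 ≤ A
  L_pos : 0 < L
  L_even : Even L
  L_large : d + 1 ≤ L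
  C₁_nonneg : 0 ≤ C₁
  sym : ∀ σ : ℝ, 0 < σ → ∃ R, SymbolBound d L σ R C₁
  tau : TauSeq τ K
  s_pos : ∀ J, 0 < s J
  s_pow : ∀ J, s J ^ L = τ J
  s_tendsto : Tendsto s atTop (𝓝 0)
  ε_nonneg : 0 ≤ ε
  C₀_nonneg : 0 ≤ C₀
  one_le_H : 1 ≤ H
  m2 : ∀ p q, N (p + q) ≤ C₀ * H ^ (p + q) * N p * N q
  D_nonneg : 0 ≤ D
  β_nonneg : 0 ≤ β
  -- The step `A H²` results from applying `(M.2)` twice, once for `(X + R + 1)²` and once for the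
  -- growth polynomial. The factor `d^n` counts the terms of the `n`-th power of the operator.
  weight_le : ∀ n, d ^ n * ((A * H * H) ^ (L * n) * N (L * n)) ≤
    D * (β ^ n * ∏ j ∈ Finset.range n, (τ j)⁻¹)
  small : β * ((1 + 2 * growConst ε) * Real.exp (2 * growConst ε * K)) ≤ 1 / 2
  rapid_exp : ∀ σ, Rapid (d := d) σ fun z => Complex.exp (-gTot τ ε (symbol L z))

namespace SeriesData

variable (S : SeriesData d N A)

theorem H_nonneg : 0 ≤ S.H := zero_le_one.trans S.one_le_H

/-- The symbol of the `J`-th approximation of `exp(G)`. -/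
noncomputable def appr (J : ℕ) (z : Fin d → ℂ) : ℂ := expPart S.τ S.ε J (symbol S.L z)

/-- The symbol `exp(-G)`. -/
noncomputable def expNeg (z : Fin d → ℂ) : ℂ := Complex.exp (-gTot S.τ S.ε (symbol S.L z))

theorem rapid_appr (J : ℕ) (σ : ℝ) : Rapid σ (S.appr J) := by
  obtain ⟨R, hR⟩ := S.sym (max σ 1) (by positivity)
  exact (hR.rapid_expPart S.L_pos S.C₁_nonneg S.tau S.ε_nonneg J).mono (le_max_left _ _)

theorem exists_sum_growPoly_le {R : ℝ} (hR : 0 ≤ R) : ∃ C : ℝ, 0 ≤ C ∧ ∀ J,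
    ∑ n ∈ Finset.range ((growPoly S.τ (growConst S.ε) R J).natDegree + 1),
      (growPoly S.τ (growConst S.ε) R J).coeff n *
        (d ^ n * ((A * S.H * S.H) ^ (S.L * n) * N (S.L * n))) ≤ C := by
  have hc := growConst_nonneg S.ε_nonneg
  have hprod : ∀ n, 0 ≤ ∏ j ∈ Finset.range n, (S.τ j)⁻¹ := fun n =>
    Finset.prod_nonneg fun j _ => inv_nonneg.2 (S.tau.pos j).le
  obtain ⟨C, hC, hCb⟩ := S.tau.exists_sum_coeff_le hc hR
    (W := fun n => S.β ^ n * ∏ j ∈ Finset.range n, (S.τ j)⁻¹)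
    (fun n => mul_nonneg (pow_nonneg S.β_nonneg n) (hprod n)) S.β_nonneg (fun n => le_rfl) S.small
  refine ⟨S.D * C, mul_nonneg S.D_nonneg hC, fun J => ?_⟩
  refine le_trans ?_ (mul_le_mul_of_nonneg_left
    (hCb J ((growPoly S.τ (growConst S.ε) R J).natDegree + 1)) S.D_nonneg)
  rw [Finset.mul_sum]
  refine Finset.sum_le_sum fun n _ => ?_
  have := mul_le_mul_of_nonneg_left (S.weight_le n) (S.tau.coeff_growPoly_nonneg hc hR J n)
  linarith

/-- The polynomial `(X + R + 1)²`. -/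
noncomputable def sqPoly (R : ℝ) : Polynomial ℝ :=
  (Polynomial.C 1 * Polynomial.X + Polynomial.C (R + 1)) ^ 2

theorem sqPoly_coeff_nonneg {R : ℝ} (hR : 0 ≤ R) (n : ℕ) : 0 ≤ (sqPoly R).coeff n := by
  rw [sqPoly, sq]
  exact coeff_mul_nonneg (coeff_linear_nonneg zero_le_one (by positivity))
    (coeff_linear_nonneg zero_le_one (by positivity)) n

theorem aeval_sqPoly (R : ℝ) (q : ℂ) : Polynomial.aeval q (sqPoly R) = (q + R + 1) ^ 2 := by
  simp [sqPoly, add_assoc]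

/-- The difference of the symbols is `P_J (q+R+1)² Θ`. Integration by parts leaves the kernel of
`Θ`, with moments `O(τ_J)`, against a family of derivatives bounded uniformly in `J`. -/
theorem exists_norm_integral_appr_sub_le (hκ : 0 ≤ κ) : ∃ D : ℝ, 0 ≤ D ∧ ∀ C u,
    WeightedFamily (d := d) N κ C A u → ∀ J α,
      ‖(∫ x, kernel (S.appr (J + 1)) x * u α x) - ∫ x, kernel (S.appr J) x * u α x‖ ≤
        D * C * S.τ J * ((A * S.H * S.H) ^ multiLength α * N (multiLength α)) := by
  have hκσ : κ + 1 < 2 * Real.pi * (κ + 1) := by nlinarith [Real.pi_gt_three]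
  have hσ : 0 < κ + 1 := by positivity
  obtain ⟨R, hR⟩ := S.sym (κ + 1) hσ
  obtain ⟨C', hC', hΘ⟩ := hR.exists_stripBound_expPart_sub S.L_pos S.L_large S.C₁_nonneg S.tau
    S.ε_nonneg
  obtain ⟨E, hE, hEb⟩ := S.exists_sum_growPoly_le hR.nonneg
  have hAH : 0 ≤ A * S.H := mul_nonneg S.A_nonneg S.H_nonneg
  have hAHH : 0 ≤ A * S.H * S.H := mul_nonneg hAH S.H_nonneg
  set E' := S.C₀ * ∑ n ∈ Finset.range ((sqPoly R).natDegree + 1),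
      (sqPoly R).coeff n * (d ^ n * ((A * S.H) ^ (S.L * n) * N (S.L * n))) with hE'
  have hE'0 : 0 ≤ E' := mul_nonneg S.C₀_nonneg (Finset.sum_nonneg fun n _ => by
    have := S.weight_pos (S.L * n)
    have := sqPoly_coeff_nonneg hR.nonneg n
    positivity)
  have hm := momentConst_nonneg (d := d)
  have hC₀ := S.C₀_nonneg
  refine ⟨C' * momentConst d * (E' * (S.C₀ * E)), by positivity, fun C u hu J α => ?_⟩
  obtain ⟨Θ, hΘr, hΘs, hΘe⟩ := hΘ J
  have hC := hu.nonneg (S.weight_pos 0)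
  have hv := hu.aeval S.weight_pos S.A_nonneg S.m2 S.L (sqPoly_coeff_nonneg hR.nonneg)
  rw [← hE'] at hv
  have hw := hv.aeval S.weight_pos hAH S.m2 S.L
    (S.tau.coeff_growPoly_nonneg (growConst_nonneg S.ε_nonneg) hR.nonneg J)
  set P := growPoly S.τ (growConst S.ε) R J with hP
  have hrap : Rapid (κ + 1) fun z => Polynomial.aeval (symbol S.L z) (P * sqPoly R) * Θ z :=
    hΘr.aeval_mul S.L _
  obtain ⟨a, ha⟩ := (S.rapid_appr J (κ + 1)).stripBound
  obtain ⟨b, hb⟩ := hrap.stripBound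
  have hk : kernel (S.appr (J + 1)) = kernel (S.appr J) +
      kernel fun z => Polynomial.aeval (symbol S.L z) (P * sqPoly R) * Θ z := by
    rw [← kernel_add hσ ha hb]
    refine kernel_congr fun ξ => ?_
    have h1 := hΘe ξ 0 (by simpa using hσ)
    rw [map_mul, aeval_sqPoly, mul_assoc, ← h1, appr, appr]
    ring
  have hi : (∫ x, kernel (S.appr (J + 1)) x * u α x) - ∫ x, kernel (S.appr J) x * u α x =
      ∫ x, kernel Θ x * Polynomial.aeval (jetOp d S.L _) P
        (Polynomial.aeval (jetOp d S.L _) (sqPoly R) u) α x := by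
    rw [hk]
    simp only [Pi.add_apply, add_mul]
    rw [integral_add (hu.expFamily.integrable (S.rapid_appr J _) hκ hκσ α)
      (hu.expFamily.integrable hrap hκ hκσ α), add_sub_cancel_left,
      hu.expFamily.integral_aeval hΘr hκ hκσ S.L_even, map_mul, Module.End.mul_apply]
  rw [hi]
  refine (hw.norm_integral_kernel_le S.weight_pos hAHH hκ hκσ hΘs α).trans ?_
  have hN := S.weight_pos (multiLength α)
  have hτ := S.tau.pos J
  calc _ ≤ C' * S.τ J * momentConst d * (C * E' * (S.C₀ * E)) *
        ((A * S.H * S.H) ^ multiLength α * N (multiLength α)) := by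
        gcongr
        exact hEb J
    _ = _ := by ring

theorem exists_norm_integral_appr_zero_le (hκ : 0 ≤ κ) : ∃ D : ℝ, 0 ≤ D ∧ ∀ C u,
    WeightedFamily (d := d) N κ C A u → ∀ α,
      ‖∫ x, kernel (S.appr 0) x * u α x‖ ≤ D * C * (A ^ multiLength α * N (multiLength α)) := by
  have hκσ : κ + 1 < 2 * Real.pi * (κ + 1) := by nlinarith [Real.pi_gt_three]
  obtain ⟨a, ha⟩ := (S.rapid_appr 0 (κ + 1)).stripBound
  refine ⟨a * momentConst d, mul_nonneg (ha.nonneg (by positivity)) momentConst_nonneg,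
    fun C u hu α => ?_⟩
  exact hu.norm_integral_kernel_le S.weight_pos S.A_nonneg hκ hκσ ha α

theorem symbol_smul (L : ℕ) (s : ℝ) (z : Fin d → ℂ) :
    symbol L (fun i => s * z i) = s ^ L * symbol L z := by
  rw [symbol, symbol, Finset.mul_sum]
  refine Finset.sum_congr rfl fun i _ => ?_
  rw [← mul_pow]
  congr 1
  ring

/-- The symbol is compared with `exp(-q τ_J)`. As `q` is homogeneous of degree `L` and `τ_J =
s_J^L`, the kernels of the latter are dilations of a single one with integral `1`. The error is
controlled by the tail `∑_{j≥J} τⱼ`. -/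
theorem tendsto_integral_expNeg_mul_appr (hκ : 0 ≤ κ) (hu : WeightedFamily (d := d) N κ C A u) :
    Tendsto (fun J => ∫ x, kernel (fun z => S.expNeg z * S.appr J z) x * u 0 x) atTop
      (𝓝 (u 0 0)) := by
  have hκσ : κ + 1 < 2 * Real.pi * (κ + 1) := by nlinarith [Real.pi_gt_three]
  have hσ : 0 < κ + 1 := by positivity
  obtain ⟨R, hR⟩ := S.sym (κ + 1) hσ
  obtain ⟨C', hC', hΘ⟩ := hR.exists_stripBound_exp_mul_expPart_sub S.L_pos S.L_large S.C₁_nonneg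
    S.tau S.ε_nonneg (S.rapid_exp _)
  have hAH : 0 ≤ A * S.H := mul_nonneg S.A_nonneg S.H_nonneg
  have hv := hu.aeval S.weight_pos S.A_nonneg S.m2 S.L (sqPoly_coeff_nonneg hR.nonneg)
  set C'' := C * (S.C₀ * ∑ n ∈ Finset.range ((sqPoly R).natDegree + 1),
      (sqPoly R).coeff n * (d ^ n * ((A * S.H) ^ (S.L * n) * N (S.L * n))))
  have hgauss : ∀ σ, Rapid (d := d) σ fun z => Complex.exp (-symbol S.L z) := by
    intro σ
    obtain ⟨R, hR⟩ := S.sym (max σ 1) (by positivity)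
    have := (hR.rapid_cexp S.L_pos S.C₁_nonneg one_pos).mono (le_max_left σ 1)
    simpa using this
  have hdil : ∀ J, (fun z : Fin d → ℂ => Complex.exp (-(symbol S.L z * S.τ J))) =
      fun z => (fun z => Complex.exp (-symbol S.L z)) fun i => S.s J * z i := by
    intro J
    funext z
    simp only [symbol_smul, ← S.s_pow J]
    push_cast
    ring_nf
  have h1 := tendsto_integral_kernel_dilation hgauss (hu.family.continuous 0) hκ
    (C := C * (A ^ multiLength (0 : Fin d → ℕ) * N (multiLength (0 : Fin d → ℕ))))
    (fun x => (hu.bound 0 x).trans (le_of_eq (by ring))) S.s_pos S.s_tendsto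
  simp only [← hdil] at h1
  have e0 : Complex.exp (-symbol S.L (0 : Fin d → ℂ)) = 1 := by
    simp [symbol, S.L_pos.ne']
  rw [e0, one_mul] at h1
  have hdiff : ∀ J, ‖(∫ x, kernel (fun z => S.expNeg z * S.appr J z) x * u 0 x) -
      ∫ x, kernel (fun z => Complex.exp (-(symbol S.L z * S.τ J))) x * u 0 x‖ ≤
      C' * momentConst d * C'' * ((A * S.H) ^ multiLength (0 : Fin d → ℕ) *
        N (multiLength (0 : Fin d → ℕ))) * ∑' j, S.τ (J + j) := by
    intro J
    obtain ⟨Θ, hΘr, hΘs, hΘe⟩ := hΘ J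
    have hrap : Rapid (κ + 1) fun z => Polynomial.aeval (symbol S.L z) (sqPoly R) * Θ z :=
      hΘr.aeval_mul S.L _
    have hcexp := hR.rapid_cexp S.L_pos S.C₁_nonneg (S.tau.pos J)
    obtain ⟨a, ha⟩ := hcexp.stripBound
    obtain ⟨b, hb⟩ := hrap.stripBound
    have hk : kernel (fun z => S.expNeg z * S.appr J z) =
        kernel (fun z => Complex.exp (-(symbol S.L z * S.τ J))) +
          kernel fun z => Polynomial.aeval (symbol S.L z) (sqPoly R) * Θ z := by
      rw [← kernel_add hσ ha hb]
      refine kernel_congr fun ξ => ?_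
      have h1 := hΘe ξ 0 (by simpa using hσ)
      rw [aeval_sqPoly, ← h1, appr, expNeg]
      ring
    rw [hk]
    simp only [Pi.add_apply, add_mul]
    rw [integral_add (hu.expFamily.integrable hcexp hκ hκσ 0)
      (hu.expFamily.integrable hrap hκ hκσ 0), add_sub_cancel_left,
      hu.expFamily.integral_aeval hΘr hκ hκσ S.L_even]
    refine (hv.norm_integral_kernel_le S.weight_pos hAH hκ hκσ hΘs 0).trans (le_of_eq ?_)
    ring
  have h2 : Tendsto (fun J => C' * momentConst d * C'' *
      ((A * S.H) ^ multiLength (0 : Fin d → ℕ) * N (multiLength (0 : Fin d → ℕ))) *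
        ∑' j, S.τ (J + j)) atTop (𝓝 0) := by
    have := (tendsto_sum_nat_add S.τ).const_mul (C' * momentConst d * C'' *
      ((A * S.H) ^ multiLength (0 : Fin d → ℕ) * N (multiLength (0 : Fin d → ℕ))))
    simpa only [mul_zero, add_comm] using this
  have h3 := squeeze_zero_norm hdiff h2
  have h4 := h3.add h1
  simpa using h4

end SeriesData

end Scalar

/-! ### Choice of the parameters of the entire function -/

section ExistsSeries

/-- The order of the choices is decisive: `L` comes from `N` and `d`, `ε` from the decay required of
`exp(-G)`, and only then `Λ` from the size of the family. None of the earlier constants depends on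
`Λ`. -/
theorem RegularWeight.exists_seriesData {N : ℕ → ℝ} (hN : RegularWeight N) (d : ℕ) {A : ℝ}
    (hA : 0 ≤ A) : ∃ S : SeriesData d N A, (∀ σ, Rapid σ S.expNeg) ∧
      ∃ h : ℝ, 0 < h ∧ kernel S.expNeg ∈ KSpaceH N h d := by
  obtain ⟨L₀, K, hK, hτ⟩ := hN.exists_tauSeq
  obtain ⟨L, hL⟩ : ∃ L, L = 4 * max L₀ (d + 1) := ⟨_, rfl⟩
  have hLL₀ : L₀ ≤ L := by have := le_max_left L₀ (d + 1); omega
  have hLd : d + 1 ≤ L := by have := le_max_right L₀ (d + 1); omega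
  have hL4 : 4 ∣ L := ⟨_, hL⟩
  have hLpos : 0 < L := by omega
  have hLe : Even L := by
    obtain ⟨m, rfl⟩ := hL4
    exact ⟨2 * m, by ring⟩
  obtain ⟨C₁, hC₁, hsym⟩ := exists_symbolBound d hL4 hLpos
  obtain ⟨C₀, H, hC₀, hH, h2⟩ := hN.m2
  obtain ⟨CB, B, hCB, hB, hNL⟩ := hN.exists_mul_le L
  obtain ⟨C, H', hC, hH', hrat⟩ := hN.exists_ratio_pow_le_mul
  have hε : 0 ≤ 2 * Real.log H' := mul_nonneg zero_le_two (Real.log_nonneg hH')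
  have hc := growConst_nonneg hε
  set b : ℝ := d * (A * H * H) ^ L * B with hb
  have hH0 : 0 ≤ H := by linarith
  have hB0 : 0 ≤ B := by linarith
  have hb0 : 0 ≤ b := by positivity
  set X := (1 + 2 * growConst (2 * Real.log H')) *
    Real.exp (2 * growConst (2 * Real.log H') * K) with hX
  have hX0 : 0 ≤ X := by positivity
  -- Since `Λ^L ≥ Λ ≥ 2bX`, the ratio `(b / Λ^L) X` is at most `1/2`.
  set Λ := 1 + 2 * (b * X) with hΛdef
  have hbX : 0 ≤ b * X := mul_nonneg hb0 hX0
  have hΛ1 : 1 ≤ Λ := by linarith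
  have hΛ : 0 < Λ := by linarith
  have hΛL : Λ ≤ Λ ^ L := le_self_pow₀ hΛ1 hLpos.ne'
  have hT := hτ L hLL₀ Λ hΛ
  have hΨ : Differentiable ℂ fun z : Fin d → ℂ =>
      Complex.exp (-gTot (fun j => ((Λ * ratio N j) ^ L)⁻¹) (2 * Real.log H') (symbol L z)) := by
    have h1 := (hT.differentiable_gTot (η := 2 * Real.log H')).comp (differentiable_symbol (d := d) L)
    exact h1.neg.cexp
  have hbd := exists_kernel_mem_KSpaceH hN hΨ (A := 2 * C₁ * (Λ + 1) * H') (by positivity)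
    fun σ hσ => by
      obtain ⟨R, hR⟩ := hsym σ hσ
      exact hR.exists_exp_gTot_bound hN hLpos hC₁ hΛ hT hC hH' hrat
  refine ⟨{
    L := L
    τ := fun j => ((Λ * ratio N j) ^ L)⁻¹
    s := fun j => (Λ * ratio N j)⁻¹
    C₁ := C₁
    K := K
    ε := 2 * Real.log H'
    C₀ := C₀
    H := H
    D := CB
    β := b / Λ ^ L
    weight_pos := hN.pos
    A_nonneg := hA
    L_pos := hLpos
    L_even := hLe
    L_large := hLd
    C₁_nonneg := by linarith
    sym := hsym
    tau := hT
    s_pos := fun j => by have := hN.ratio_pos j; positivity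
    s_pow := fun j => inv_pow _ _
    s_tendsto := (hN.tendsto_ratio.const_mul_atTop hΛ).inv_tendsto_atTop
    ε_nonneg := hε
    C₀_nonneg := by linarith
    one_le_H := hH
    m2 := h2
    D_nonneg := by linarith
    β_nonneg := by positivity
    weight_le := ?_
    small := ?_
    rapid_exp := hbd.1 }, hbd.1, hbd.2⟩
  · intro n
    have hNn := hN.pos n
    simp only [inv_inv]
    -- The quotients telescope to `N_n^L`, which controls `N_{Ln}` up to a geometric factor by
    -- `(M.2)`. That factor is beaten by `Λ^{Ln}`.
    have e1 : ∏ j ∈ Finset.range n, (Λ * ratio N j) ^ L = (Λ ^ L) ^ n * N n ^ L := by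
      rw [Finset.prod_pow, Finset.prod_mul_distrib, ← eq_prod_ratio hN.pos hN.zero, mul_pow]
      simp only [Finset.prod_const, Finset.card_range]
      rw [← pow_mul, ← pow_mul, mul_comm n L]
    rw [e1]
    calc (d : ℝ) ^ n * ((A * H * H) ^ (L * n) * N (L * n))
        ≤ (d : ℝ) ^ n * ((A * H * H) ^ (L * n) * (CB * B ^ n * N n ^ L)) := by
          have hAHH : 0 ≤ A * H * H := by positivity
          exact mul_le_mul_of_nonneg_left (mul_le_mul_of_nonneg_left (hNL n)
            (pow_nonneg hAHH _)) (by positivity)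
      _ = CB * (b ^ n * N n ^ L) := by
          rw [hb, mul_pow _ B n, mul_pow (d : ℝ) _ n, ← pow_mul]; ring
      _ = _ := by
          have : (Λ ^ L) ^ n ≠ 0 := by positivity
          rw [div_pow]
          field_simp
  · rw [div_mul_eq_mul_div, div_le_iff₀ (by positivity)]
    change b * X ≤ _
    linarith

end ExistsSeries

/-! ### Taylor estimates -/

section Taylor

variable {d : ℕ} {G : Type*} [NormedAddCommGroup G] [NormedSpace ℝ G]

theorem IsPartialFamily.hasDerivAt {F : (Fin d → ℕ) → EuclideanSpace ℝ (Fin d) → G}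
    (hF : IsPartialFamily F) (α : Fin d → ℕ) (i : Fin d) (x : EuclideanSpace ℝ (Fin d)) (s : ℝ) :
    HasDerivAt (fun t : ℝ => F α (x + t • stdVec i))
      (F (α + Pi.single i 1) (x + s • stdVec i)) s := by
  have h1 : HasDerivAt (fun t : ℝ => F α (x + s • stdVec i + t • stdVec i))
      (F (α + Pi.single i 1) (x + s • stdVec i)) (s - s) := by
    rw [sub_self]
    exact hF.hasLineDerivAt α i (x + s • stdVec i)
  have h2 := h1.comp_sub_const s s
  refine h2.congr_of_eventuallyEq (Eventually.of_forall fun t => ?_)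
  simp only
  rw [add_assoc, ← add_smul, add_sub_cancel]

theorem norm_image_sub_le_on_Icc {g g' : ℝ → G} (hg : ∀ s, HasDerivAt g (g' s) s) {t M : ℝ}
    (hM : ∀ s, |s| ≤ |t| → ‖g' s‖ ≤ M) : ‖g t - g 0‖ ≤ M * |t| := by
  have h := (convex_Icc (-|t|) |t|).norm_image_sub_le_of_norm_hasDerivWithin_le (f := g) (f' := g')
    (C := M) (x := 0) (y := t) (fun s _ => (hg s).hasDerivWithinAt)
    (fun s hs => hM s (abs_le.2 hs)) ⟨by simp, abs_nonneg t⟩ (abs_le.1 le_rfl)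
  simpa using h

/-- A quadratic remainder with an explicit constant is stable under integration, pointwise limits
and suprema over functionals. Together with its converse `hasLineDerivAt_of_taylor` it transports
derivatives through all these operations. -/
theorem IsPartialFamily.norm_taylor_le {F : (Fin d → ℕ) → EuclideanSpace ℝ (Fin d) → G}
    (hF : IsPartialFamily F) (α : Fin d → ℕ) (i : Fin d) (x : EuclideanSpace ℝ (Fin d)) {t M : ℝ}
    (hM : ∀ s : ℝ, |s| ≤ |t| → ‖F (α + Pi.single i 2) (x + s • stdVec i)‖ ≤ M) :
    ‖F α (x + t • stdVec i) - F α x - t • F (α + Pi.single i 1) x‖ ≤ M * t ^ 2 := by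
  have h1 := hF.hasDerivAt α i x
  have h2 := hF.hasDerivAt (α + Pi.single i 1) i x
  rw [add_assoc, ← Pi.single_add] at h2
  have hb : ∀ s, |s| ≤ |t| →
      ‖F (α + Pi.single i 1) (x + s • stdVec i) - F (α + Pi.single i 1) x‖ ≤ M * |t| := by
    intro s hs
    have h3 := norm_image_sub_le_on_Icc h2 (t := s) fun r hr => hM r (hr.trans hs)
    rw [zero_smul, add_zero] at h3
    have hM0 : 0 ≤ M := (norm_nonneg _).trans (hM 0 (by simp))
    exact h3.trans (mul_le_mul_of_nonneg_left hs hM0)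
  have h4 : ∀ s, HasDerivAt (fun s : ℝ => F α (x + s • stdVec i) - s • F (α + Pi.single i 1) x)
      (F (α + Pi.single i 1) (x + s • stdVec i) - F (α + Pi.single i 1) x) s := by
    intro s
    have := (h1 s).fun_sub ((hasDerivAt_id s).smul_const (F (α + Pi.single i 1) x))
    rwa [one_smul] at this
  have h5 := norm_image_sub_le_on_Icc h4 hb
  simp only [zero_smul, add_zero, sub_zero] at h5
  rw [sub_right_comm]
  refine h5.trans (le_of_eq ?_)
  rw [mul_assoc, abs_mul_abs_self, sq]

theorem hasLineDerivAt_of_taylor {f : EuclideanSpace ℝ (Fin d) → G} {f' : G}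
    {x v : EuclideanSpace ℝ (Fin d)} {M : ℝ}
    (h : ∀ t : ℝ, |t| ≤ 1 → ‖f (x + t • v) - f x - t • f'‖ ≤ M * t ^ 2) :
    HasLineDerivAt ℝ f f' x v := by
  unfold HasLineDerivAt
  rw [hasDerivAt_iff_isLittleO_nhds_zero]
  simp only [zero_add, zero_smul, add_zero]
  have h1 : (fun t : ℝ => f (x + t • v) - f x - t • f') =O[𝓝 0] fun t : ℝ => t ^ 2 := by
    refine Asymptotics.IsBigO.of_bound M ?_
    filter_upwards [Metric.closedBall_mem_nhds (0 : ℝ) one_pos] with t ht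
    rw [mem_closedBall_zero_iff, Real.norm_eq_abs] at ht
    simpa using h t ht
  exact h1.trans_isLittleO (Asymptotics.isLittleO_pow_id one_lt_two)

end Taylor

/-! ### Jets of vectors -/

section Jets

variable {d : ℕ} {E : Type*} [AddCommGroup E] [Module ℂ E] [TopologicalSpace E]

/-- The vectors `c_α` are the derivatives `∂^α γ_{c_0}(0)`, weakly. -/
def Representation.IsJet (π : Representation d E) (c : (Fin d → ℕ) → E) : Prop :=
  ∀ ℓ : E →L[ℂ] ℂ, IsPartialFamily fun α x => ℓ (π.orbit (c α) x)

/-- Families of jets with bounds by a weight. -/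
structure Representation.JetBound (π : Representation d E) (N : ℕ → ℝ) {ι : Type*}
    (c : ι → (Fin d → ℕ) → E) (A : ℝ) : Prop where
  jet : ∀ i, π.IsJet (c i)
  bound : ∀ p : Seminorm ℂ E, Continuous p → ∃ C κ : ℝ, 0 ≤ C ∧ 0 ≤ κ ∧ ∀ i α x,
    p (π.orbit (c i α) x) ≤ C * Real.exp (κ * ‖x‖) * (A ^ multiLength α * N (multiLength α))

variable [IsTopologicalAddGroup E] [ContinuousSMul ℂ E] [LocallyConvexSpace ℝ E] [T2Space E]
  {π : Representation d E}

theorem Representation.isJet_of_taylor {c : (Fin d → ℕ) → E}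
    (h : ∀ (ℓ : E →L[ℂ] ℂ) α i x, ∃ M : ℝ, ∀ t : ℝ, |t| ≤ 1 →
      ‖ℓ (π.orbit (c α) (x + t • stdVec i)) - ℓ (π.orbit (c α) x) -
        t • ℓ (π.orbit (c (α + Pi.single i 1)) x)‖ ≤ M * t ^ 2) : π.IsJet c := by
  intro ℓ
  refine ⟨fun α => ℓ.continuous.comp (π.continuous_orbit _), fun α i x => ?_⟩
  obtain ⟨M, hM⟩ := h ℓ α i x
  exact hasLineDerivAt_of_taylor hM

theorem norm_add_smul_stdVec_le (x : EuclideanSpace ℝ (Fin d)) (i : Fin d) {s : ℝ} (hs : |s| ≤ 1) :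
    ‖x + s • stdVec i‖ ≤ ‖x‖ + 1 := by
  refine (norm_add_le _ _).trans (add_le_add le_rfl ?_)
  rw [norm_smul]
  simpa using hs

/-- The Taylor estimates of the orbits are integrated against `k`, whose exponential moments
dominate the growth of the remainder. -/
theorem Representation.IsJet.bigPi (hE : IsSequentiallyComplete E) (hπ : π.HasExpGrowth)
    {c : (Fin d → ℕ) → E} (hc : π.IsJet c) {k : EuclideanSpace ℝ (Fin d) → ℂ}
    (hk : HasExpMoments k) : π.IsJet fun α => π.bigPi k (c α) := by
  refine isJet_of_taylor fun ℓ α i x => ?_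
  have hgr : ∀ α, ∃ C κ : ℝ, 0 ≤ C ∧ 0 ≤ κ ∧ ∀ y,
      ‖ℓ (π.orbit (c α) y)‖ ≤ C * Real.exp (κ * ‖y‖) := fun α =>
    (hπ.orbit (c α)).bound (dualSeminorm ℓ) (continuous_dualSeminorm ℓ)
  obtain ⟨C, κ, hC, hκ, hCκ⟩ := hgr (α + Pi.single i 2)
  have hint : ∀ α (z : EuclideanSpace ℝ (Fin d)),
      Integrable fun y => k y * ℓ (π.orbit (c α) (z + y)) := by
    intro α z
    obtain ⟨C, κ, hC, hκ, hCκ⟩ := hgr α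
    refine integrable_mul_of_expBound hk.meas (hk.integrable κ)
      (((hc ℓ).continuous α).comp (continuous_const.add continuous_id))
      (C := C * Real.exp (κ * ‖z‖)) fun y => (hCκ _).trans ?_
    rw [mul_assoc, ← Real.exp_add, ← mul_add]
    gcongr
    exact norm_add_le z y
  let I := ∫ y, ‖k y‖ * Real.exp (κ * ‖y‖)
  refine ⟨C * Real.exp (κ * (‖x‖ + 1)) * I, fun t ht => ?_⟩
  simp only [dual_orbit_bigPi hE hπ hk]
  have hint' : Integrable fun y => k y * ℓ (π.orbit (c α) (x + t • stdVec i + y)) -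
      k y * ℓ (π.orbit (c α) (x + y)) := (hint _ _).sub (hint _ _)
  rw [← integral_sub (hint _ _) (hint _ _), Complex.real_smul, ← integral_const_mul,
    ← integral_sub hint' ((hint _ _).const_mul _)]
  have h1 : ∀ y, ‖ℓ (π.orbit (c α) (x + y + t • stdVec i)) - ℓ (π.orbit (c α) (x + y)) -
      t • ℓ (π.orbit (c (α + Pi.single i 1)) (x + y))‖ ≤
        (C * Real.exp (κ * (‖x‖ + 1)) * t ^ 2) * Real.exp (κ * ‖y‖) := by
    intro y
    refine ((hc ℓ).norm_taylor_le α i (x + y)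
      (M := C * Real.exp (κ * (‖x‖ + 1)) * Real.exp (κ * ‖y‖)) fun s hs => ?_).trans
      (le_of_eq (by ring))
    refine (hCκ _).trans ?_
    rw [mul_assoc, ← Real.exp_add, ← mul_add]
    gcongr
    have := norm_add_smul_stdVec_le (x + y) i (hs.trans ht)
    linarith [norm_add_le x y]
  have h2 := norm_integral_mul_le (hk.integrable κ) h1
  refine le_trans (le_of_eq ?_) (h2.trans (le_of_eq ?_))
  · congr 2
    funext y
    rw [Complex.real_smul, add_right_comm]
    ring
  · simp only [I]; ring

variable {N : ℕ → ℝ} {ι : Type*} {c : ι → (Fin d → ℕ) → E} {A : ℝ}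

theorem Representation.JetBound.weightedFamily (hc : π.JetBound N c A) {p : Seminorm ℂ E}
    (hp : Continuous p) : ∃ C κ : ℝ, 0 ≤ C ∧ 0 ≤ κ ∧ ∀ ℓ : E →L[ℂ] ℂ, (∀ x, ‖ℓ x‖ ≤ p x) → ∀ i,
      WeightedFamily N κ C A fun α x => ℓ (π.orbit (c i α) x) := by
  obtain ⟨C, κ, hC, hκ, h⟩ := hc.bound p hp
  exact ⟨C, κ, hC, hκ, fun ℓ hℓ i => ⟨hc.jet i ℓ, fun α x => (hℓ _).trans (h i α x)⟩⟩

theorem sum_le_tsum_shift {τ : ℕ → ℝ} {K : ℝ} (h : TauSeq τ K) (m n : ℕ) :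
    ∑ j ∈ Finset.range n, τ (m + j) ≤ ∑' j, τ (m + j) :=
  (h.summable_shift m).sum_le_tsum _ fun _ _ => (h.pos _).le

/-- Strong factorization of families of jets. -/
theorem Representation.JetBound.exists_factorization (hE : IsSequentiallyComplete E)
    (hπ : π.HasExpGrowth) (hN : RegularWeight N) (hA : 0 ≤ A) (hc : π.JetBound N c A) :
    ∃ h : ℝ, 0 < h ∧ ∃ ψ ∈ KSpaceH N h d, ∃ (a : ι → (Fin d → ℕ) → E) (A' : ℝ), 0 ≤ A' ∧
      π.JetBound N a A' ∧ ∀ i, π.bigPi ψ (a i 0) = c i 0 := by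
  obtain ⟨S, hSr, h, hh, hψ⟩ := hN.exists_seriesData d hA
  have hNp := hN.pos
  set A' := A * S.H * S.H with hA'
  have hH := S.one_le_H
  have hA'0 : 0 ≤ A' := mul_nonneg (mul_nonneg hA S.H_nonneg) S.H_nonneg
  have hAA' : A ≤ A' := by
    have : 1 ≤ S.H * S.H := one_le_mul_of_one_le_of_one_le hH hH
    rw [hA', mul_assoc]
    exact le_mul_of_one_le_right hA this
  let w : (Fin d → ℕ) → ℝ := fun α => A' ^ multiLength α * N (multiLength α)
  have hw : ∀ α, 0 ≤ w α := fun α => mul_nonneg (pow_nonneg hA'0 _) (hNp _).le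
  have hk : ∀ J, HasExpMoments (kernel (S.appr J)) := fun J =>
    hasExpMoments_kernel (S.rapid_appr J)
  -- The approximations of `exp(G)(∂)`, applied to all the derivatives at once, so that the limit
  -- again comes as a jet.
  let b : ℕ → ι → (Fin d → ℕ) → E := fun J i α => π.bigPi (kernel (S.appr J)) (c i α)
  let T : ℕ → ℝ := fun m => ∑' j, S.τ (m + j)
  have hT0 : ∀ m, 0 ≤ T m := fun m => tsum_nonneg fun j => (S.tau.pos _).le
  have hT : Tendsto T atTop (𝓝 0) := by
    have := tendsto_sum_nat_add S.τ
    simpa only [T, add_comm] using this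
  -- The scalar estimates are applied to the translates `ℓ(π(x + ·) c_α)`, with constants common to
  -- all `ℓ` dominated by `p`. The translation only costs `exp(κ‖x‖)`.
  have hstep : ∀ p : Seminorm ℂ E, Continuous p → ∃ D κ : ℝ, 0 ≤ D ∧ 0 ≤ κ ∧ (∀ i α x,
      p (π.orbit (b 0 i α) x) ≤ D * Real.exp (κ * ‖x‖) * w α) ∧ ∀ J i α x,
      p (π.orbit (b (J + 1) i α) x - π.orbit (b J i α) x) ≤
        D * Real.exp (κ * ‖x‖) * w α * S.τ J := by
    intro p hp
    obtain ⟨C, κ, hC, hκ, hu⟩ := hc.weightedFamily hp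
    obtain ⟨D₀, hD₀, hb₀⟩ := S.exists_norm_integral_appr_zero_le hκ
    obtain ⟨D₁, hD₁, hb₁⟩ := S.exists_norm_integral_appr_sub_le hκ
    refine ⟨(D₀ + D₁) * C, κ, by positivity, hκ, fun i α x => ?_, fun J i α x => ?_⟩
    · refine seminorm_le_of_dual hp fun ℓ hℓ => ?_
      have h1 := hb₀ _ _ ((hu ℓ hℓ i).translate hNp hA hκ x) α
      rw [π.dual_orbit_bigPi hE hπ (hk 0)]
      refine h1.trans ?_
      have := hNp (multiLength α)
      calc _ ≤ (D₀ + D₁) * (C * Real.exp (κ * ‖x‖)) * w α := by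
            simp only [w]
            gcongr
            linarith
        _ = _ := by ring
    · refine seminorm_le_of_dual hp fun ℓ hℓ => ?_
      have h1 := hb₁ _ _ ((hu ℓ hℓ i).translate hNp hA hκ x) J α
      rw [map_sub, π.dual_orbit_bigPi hE hπ (hk _), π.dual_orbit_bigPi hE hπ (hk _)]
      refine h1.trans ?_
      have := hw α
      have := S.tau.pos J
      calc _ = D₁ * (C * Real.exp (κ * ‖x‖)) * S.τ J * w α := rfl
        _ ≤ (D₀ + D₁) * (C * Real.exp (κ * ‖x‖)) * S.τ J * w α := by
            gcongr
            linarith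
        _ = _ := by ring
  have htail : ∀ (p : Seminorm ℂ E) (D κ : ℝ), 0 ≤ D → (∀ J i α x,
      p (π.orbit (b (J + 1) i α) x - π.orbit (b J i α) x) ≤
        D * Real.exp (κ * ‖x‖) * w α * S.τ J) → ∀ m n i α x,
      p (π.orbit (b (m + n) i α) x - π.orbit (b m i α) x) ≤
        D * Real.exp (κ * ‖x‖) * w α * T m := by
    intro p D κ hD hp m n i α x
    have h1 : p (π.orbit (b (m + n) i α) x - π.orbit (b m i α) x) ≤
        D * Real.exp (κ * ‖x‖) * w α * ∑ j ∈ Finset.range n, S.τ (m + j) := by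
      induction n with
      | zero => simp
      | succ n ih =>
        rw [Finset.sum_range_succ, mul_add]
        have e : π.orbit (b (m + (n + 1)) i α) x - π.orbit (b m i α) x =
            (π.orbit (b (m + n + 1) i α) x - π.orbit (b (m + n) i α) x) +
              (π.orbit (b (m + n) i α) x - π.orbit (b m i α) x) := by
          rw [add_assoc]; abel
        rw [e]
        refine (map_add_le_add p _ _).trans ?_
        linarith [hp (m + n) i α x]
    refine h1.trans (mul_le_mul_of_nonneg_left (sum_le_tsum_shift S.tau m n) ?_)
    have := hw α
    positivity
  have hlim : ∀ i α, ∃ a, Tendsto (fun J => b J i α) atTop (𝓝 a) := by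
    intro i α
    refine cauchy_of_seminorm hE fun p hp => ?_
    obtain ⟨D, κ, hD, hκ, -, h1⟩ := hstep p hp
    have h2 := htail p D κ hD h1
    refine ⟨fun m => D * w α * T m, by simpa using hT.const_mul (D * w α), fun m n => ?_⟩
    have hwα := hw α
    have key : ∀ m n, p (b (m + n) i α - b m i α) ≤ D * w α * T m := by
      intro m n
      simpa [Representation.orbit_zero] using h2 m n i α 0
    have hnn : ∀ m, 0 ≤ D * w α * T m := fun m => by have := hT0 m; positivity
    rcases le_total m n with hmn | hmn
    · obtain ⟨k, rfl⟩ := Nat.exists_eq_add_of_le hmn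
      rw [map_sub_rev]
      linarith [key m k, hnn (m + k)]
    · obtain ⟨k, rfl⟩ := Nat.exists_eq_add_of_le hmn
      linarith [key n k, hnn (n + k)]
  choose a ha using hlim
  have haorb : ∀ i α x, Tendsto (fun J => π.orbit (b J i α) x) atTop (𝓝 (π.orbit (a i α) x)) :=
    fun i α x => ((π.act x).continuous.tendsto _).comp (ha i α)
  have hunif : ∀ p : Seminorm ℂ E, Continuous p → ∃ D κ : ℝ, 0 ≤ D ∧ 0 ≤ κ ∧ (∀ J i α x,
      p (π.orbit (b J i α) x) ≤ D * Real.exp (κ * ‖x‖) * w α) ∧ ∀ J i α x,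
      p (π.orbit (a i α) x - π.orbit (b J i α) x) ≤ D * Real.exp (κ * ‖x‖) * w α * T J := by
    intro p hp
    obtain ⟨D, κ, hD, hκ, h0, h1⟩ := hstep p hp
    have h2 := htail p D κ hD h1
    refine ⟨D * (1 + T 0), κ, by have := hT0 0; positivity, hκ, fun J i α x => ?_,
      fun J i α x => ?_⟩
    · have h3 := h2 0 J i α x
      rw [zero_add] at h3
      have h4 := map_add_le_add p (π.orbit (b J i α) x - π.orbit (b 0 i α) x)
        (π.orbit (b 0 i α) x)
      rw [sub_add_cancel] at h4
      linarith [h0 i α x]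
    · have h3 : Tendsto (fun n => p (π.orbit (b (J + n) i α) x - π.orbit (b J i α) x)) atTop
          (𝓝 (p (π.orbit (a i α) x - π.orbit (b J i α) x))) := by
        refine (hp.tendsto _).comp (Tendsto.sub_const ?_ _)
        simpa only [add_comm] using (tendsto_add_atTop_iff_nat J).2 (haorb i α x)
      refine (le_of_tendsto h3 (Eventually.of_forall fun n => h2 J n i α x)).trans ?_
      have := hT0 J
      have := hT0 0
      have := hw α
      gcongr
      exact le_mul_of_one_le_right hD (by linarith)
  have haB : ∀ p : Seminorm ℂ E, Continuous p → ∃ C κ : ℝ, 0 ≤ C ∧ 0 ≤ κ ∧ ∀ i α x,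
      p (π.orbit (a i α) x) ≤ C * Real.exp (κ * ‖x‖) * w α := by
    intro p hp
    obtain ⟨D, κ, hD, hκ, h1, -⟩ := hunif p hp
    exact ⟨D, κ, hD, hκ, fun i α x => le_of_tendsto ((hp.tendsto _).comp (haorb i α x))
      (Eventually.of_forall fun J => h1 J i α x)⟩
  refine ⟨h, hh, kernel S.expNeg, hψ, a, A', hA'0, ⟨fun i => ?_, haB⟩, fun i => ?_⟩
  -- The Taylor estimates of the approximations have a constant independent of `J`, hence pass to
  -- the limit.
  · refine isJet_of_taylor fun ℓ α j x => ?_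
    obtain ⟨D, κ, hD, hκ, h1, -⟩ := hunif (dualSeminorm ℓ) (continuous_dualSeminorm ℓ)
    refine ⟨D * Real.exp (κ * (‖x‖ + 1)) * w (α + Pi.single j 2), fun t ht => ?_⟩
    have hl : ∀ α x, Tendsto (fun J => ℓ (π.orbit (b J i α) x)) atTop
        (𝓝 (ℓ (π.orbit (a i α) x))) := fun α x => (ℓ.continuous.tendsto _).comp (haorb i α x)
    refine le_of_tendsto ((((hl α (x + t • stdVec j)).sub (hl α x)).sub
      ((hl (α + Pi.single j 1) x).const_smul t)).norm) (Eventually.of_forall fun J => ?_)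
    refine (((hc.jet i).bigPi hE hπ (hk J)) ℓ).norm_taylor_le α j x fun s hs => ?_
    refine (h1 J i _ _).trans ?_
    have := hw (α + Pi.single j 2)
    gcongr
    exact norm_add_smul_stdVec_le x j (hs.trans ht)
  -- The functional of `Π(ψ) b_J` has two limits. It tends to that of `Π(ψ) a`, because `b_J → a`
  -- uniformly up to an exponential weight. By the product rule for symbols it also tends to that of
  -- `c_0`.
  · have hψm : HasExpMoments (kernel S.expNeg) := hasExpMoments_kernel hSr
    refine eq_of_forall_dual_eq fun ℓ => ?_
    obtain ⟨C, κ, hC, hκ, hu⟩ := hc.weightedFamily (continuous_dualSeminorm ℓ)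
    have hul := hu ℓ (fun x => le_rfl) i
    have h1 := S.tendsto_integral_expNeg_mul_appr hκ hul
    obtain ⟨D, κ', hD, hκ', h2, h3⟩ := hunif (dualSeminorm ℓ) (continuous_dualSeminorm ℓ)
    have hcont : ∀ v, Continuous fun x => ℓ (π.orbit v x) := fun v =>
      ℓ.continuous.comp (π.continuous_orbit v)
    have e1 : ∀ J, ∫ x, kernel (fun z => S.expNeg z * S.appr J z) x * ℓ (π.orbit (c i 0) x) =
        ∫ x, kernel S.expNeg x * ℓ (π.orbit (b J i 0) x) := by
      intro J
      rw [← integral_kernel_kernel hSr (S.rapid_appr J) (hcont _) hκ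
        (C := C * (A ^ multiLength (0 : Fin d → ℕ) * N (multiLength (0 : Fin d → ℕ))))
        (fun x => (hul.bound 0 x).trans (le_of_eq (by ring)))]
      simp only [b, π.dual_orbit_bigPi hE hπ (hk J)]
    simp only [e1] at h1
    have hia : ∀ v C, (∀ x, ‖ℓ (π.orbit v x)‖ ≤ C * Real.exp (κ' * ‖x‖)) →
        Integrable fun x => kernel S.expNeg x * ℓ (π.orbit v x) := fun v C hv =>
      integrable_mul_of_expBound hψm.meas (hψm.integrable κ') (hcont v) hv
    obtain ⟨C'', κ'', hC'', hκ'', h5⟩ := haB (dualSeminorm ℓ) (continuous_dualSeminorm ℓ)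
    have hint2 : Integrable fun x => kernel S.expNeg x * ℓ (π.orbit (a i 0) x) :=
      integrable_mul_of_expBound hψm.meas (hψm.integrable κ'') (hcont _) (C := C'' * w 0)
        fun x => (h5 i 0 x).trans (le_of_eq (by ring))
    have h4 : Tendsto (fun J => ∫ x, kernel S.expNeg x * ℓ (π.orbit (b J i 0) x)) atTop
        (𝓝 (∫ x, kernel S.expNeg x * ℓ (π.orbit (a i 0) x))) := by
      rw [tendsto_iff_norm_sub_tendsto_zero]
      refine squeeze_zero (fun J => norm_nonneg _) (fun J => ?_)
        (g := fun J => D * w 0 * T J * ∫ x, ‖kernel S.expNeg x‖ * Real.exp (κ' * ‖x‖)) ?_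
      · rw [norm_sub_rev, ← integral_sub hint2 (hia _ (D * w 0) fun x => (h2 J i 0 x).trans
          (le_of_eq (by ring)))]
        simp only [← mul_sub]
        refine norm_integral_mul_le (hψm.integrable κ') fun x => ?_
        rw [← map_sub]
        exact (h3 J i 0 x).trans (le_of_eq (by ring))
      · simpa using (hT.const_mul (D * w 0)).mul_const
          (∫ x, ‖kernel S.expNeg x‖ * Real.exp (κ' * ‖x‖))
    rw [π.dual_bigPi hE hπ hψm, tendsto_nhds_unique h4 h1, Representation.orbit_zero]

end Jets

/-! ### Weights subordinate to a weight sequence -/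

section WeightBelow

/-- `N` defines a class contained in the class `[M]`. -/
def WeightBelow (t : UltraType) (M N : ℕ → ℝ) : Prop :=
  match t with
  | .beurling => ∀ s : ℝ, 0 < s → ∃ C : ℝ, 0 < C ∧ ∀ n, N n ≤ C * s ^ n * M n
  | .roumieu => ∃ s : ℝ, 0 < s ∧ ∃ C : ℝ, 0 < C ∧ ∀ n, N n ≤ C * s ^ n * M n

theorem weightBelow_roumieu_self (M : ℕ → ℝ) : WeightBelow .roumieu M M :=
  ⟨1, one_pos, 1, one_pos, fun n => by simp⟩

variable {M N : ℕ → ℝ} {d : ℕ}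

theorem KSpaceH.of_le (hM : ∀ n, 0 < M n) (hN : ∀ n, 0 < N n) {h s C : ℝ} (hh : 0 < h) (hs : 0 < s)
    (h' : ∀ n, N n ≤ C * s ^ n * M n) {φ : EuclideanSpace ℝ (Fin d) → ℂ}
    (hφ : φ ∈ KSpaceH N h d) : φ ∈ KSpaceH M (h / s) d := by
  refine ⟨hφ.1, fun n => ?_⟩
  obtain ⟨K, hK⟩ := hφ.2 n
  refine ⟨K * C, fun α x => ?_⟩
  have h1 := hK α x
  have h2 := h' (multiLength α)
  have hNα := hN (multiLength α)
  have hMα := hM (multiLength α)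
  have hK0 : 0 ≤ K := le_trans (by positivity) h1
  rw [div_le_iff₀ hNα] at h1
  rw [div_le_iff₀ hMα, div_pow, div_mul_eq_mul_div, div_mul_eq_mul_div, div_le_iff₀ (by positivity)]
  calc _ ≤ K * N (multiLength α) := h1
    _ ≤ K * (C * s ^ multiLength α * M (multiLength α)) := by gcongr
    _ = _ := by ring

theorem WeightBelow.kSpace_of_kSpaceH {t : UltraType} (hMN : WeightBelow t M N)
    (hM : ∀ n, 0 < M n) (hN : ∀ n, 0 < N n) {h : ℝ} (hh : 0 < h)
    {φ : EuclideanSpace ℝ (Fin d) → ℂ} (hφ : φ ∈ KSpaceH N h d) : φ ∈ KSpace t M d := by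
  cases t with
  | beurling =>
    intro h' hh'
    obtain ⟨C, _, hC⟩ := hMN (h / h') (by positivity)
    have := KSpaceH.of_le hM hN hh (by positivity) hC hφ
    rwa [div_div_cancel₀ hh.ne'] at this
  | roumieu =>
    obtain ⟨s, hs, C, _, hC⟩ := hMN
    exact ⟨h / s, by positivity, KSpaceH.of_le hM hN hh hs hC hφ⟩

/-- Countably many families of type `(M)` are dominated by a single sequence of type `(M)`. -/
theorem exists_common_bound (hM : ∀ n, 0 < M n) {ι : Type*} {len : ι → ℕ} {G : ℕ → ι → ℝ}
    (hG : ∀ k, ∀ s : ℝ, 0 < s → ∃ C, ∀ i, G k i ≤ C * s ^ len i * M (len i)) :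
    ∃ D : ℕ → ℝ, (∀ n, 0 ≤ D n) ∧ (∀ k, ∃ C, 0 ≤ C ∧ ∀ i, G k i ≤ C * D (len i)) ∧
      ∀ s : ℝ, 0 < s → ∃ C, ∀ n, D n ≤ C * s ^ n * M n := by
  have hs : ∀ j : ℕ, (0 : ℝ) < 1 / ((j : ℝ) + 1) := fun j => Nat.one_div_pos_of_nat
  choose C hC using fun k j => hG k _ (hs j)
  -- A diagonal splitting `C k j ≤ Q k * P j`: entries with `k ≤ j` are charged to `P`, the others
  -- to `Q`. Thus `P` serves all the families simultaneously.
  let P : ℕ → ℝ := fun j => 1 + ∑ k ∈ Finset.range (j + 1), |C k j|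
  let Q : ℕ → ℝ := fun k => 1 + ∑ j ∈ Finset.range k, |C k j|
  have hP : ∀ j, 1 ≤ P j := fun j =>
    le_add_of_nonneg_right (Finset.sum_nonneg fun _ _ => abs_nonneg _)
  have hQ : ∀ k, 1 ≤ Q k := fun k =>
    le_add_of_nonneg_right (Finset.sum_nonneg fun _ _ => abs_nonneg _)
  have hPQ : ∀ k j, C k j ≤ Q k * P j := by
    intro k j
    refine (le_abs_self _).trans ?_
    rcases lt_or_ge j k with h | h
    · have h1 : |C k j| ≤ Q k := by
        have := Finset.single_le_sum (f := fun j => |C k j|) (fun _ _ => abs_nonneg _)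
          (Finset.mem_range.2 h)
        simp only [Q]
        linarith
      exact h1.trans (le_mul_of_one_le_right (by linarith [hQ k]) (hP j))
    · have h1 : |C k j| ≤ P j := by
        have := Finset.single_le_sum (f := fun k => |C k j|) (fun _ _ => abs_nonneg _)
          (Finset.mem_range.2 (Nat.lt_succ_of_le h))
        simp only [P]
        linarith
      exact h1.trans (le_mul_of_one_le_left (by linarith [hP j]) (hQ k))
  have hnn : ∀ n j, 0 ≤ P j * (1 / ((j : ℝ) + 1)) ^ n := fun n j => by
    have := hP j
    positivity
  have hbdd : ∀ n, BddBelow (Set.range fun j : ℕ => P j * (1 / ((j : ℝ) + 1)) ^ n) := fun n =>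
    ⟨0, by rintro _ ⟨j, rfl⟩; exact hnn n j⟩
  -- The best bound obtainable from all the steps `1/(j+1)`. It is small compared with `M` because
  -- each single `j` already bounds the infimum.
  refine ⟨fun n => M n * ⨅ j : ℕ, P j * (1 / ((j : ℝ) + 1)) ^ n, fun n =>
    mul_nonneg (hM n).le (Real.iInf_nonneg (hnn n)), fun k => ⟨Q k, by linarith [hQ k], fun i => ?_⟩,
    fun s hs0 => ?_⟩
  · have hQk : 0 < Q k := by linarith [hQ k]
    have h1 : G k i / (Q k * M (len i)) ≤ ⨅ j : ℕ, P j * (1 / ((j : ℝ) + 1)) ^ len i := by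
      refine le_ciInf fun j => ?_
      rw [div_le_iff₀ (mul_pos hQk (hM _))]
      refine (hC k j i).trans ?_
      have := hM (len i)
      calc _ ≤ (Q k * P j) * (1 / ((j : ℝ) + 1)) ^ len i * M (len i) := by
            gcongr
            exact hPQ k j
        _ = _ := by ring
    rw [div_le_iff₀ (mul_pos hQk (hM _))] at h1
    linarith
  · obtain ⟨j, hj⟩ := exists_nat_one_div_lt hs0
    refine ⟨P j, fun n => ?_⟩
    have hPj := hP j
    have := hM n
    calc _ ≤ M n * (P j * (1 / ((j : ℝ) + 1)) ^ n) :=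
          mul_le_mul_of_nonneg_left (ciInf_le (hbdd n) j) (hM n).le
      _ ≤ M n * (P j * s ^ n) := by gcongr
      _ = _ := by ring

theorem RegularWeight.exists_weightBelow_of_forall (hM : RegularWeight M) {ι : Type*} {len : ι → ℕ}
    {G : ℕ → ι → ℝ} (hG : ∀ k, ∀ s : ℝ, 0 < s → ∃ C, ∀ i, G k i ≤ C * s ^ len i * M (len i)) :
    ∃ N, RegularWeight N ∧ WeightBelow .beurling M N ∧
      ∀ k, ∃ C, 0 ≤ C ∧ ∀ i, G k i ≤ C * N (len i) := by
  obtain ⟨D, hD, hGD, hDM⟩ := exists_common_bound hM.pos hG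
  obtain ⟨N, hN, ⟨C, hC, hDN⟩, hNM⟩ := hM.exists_smaller hD hDM
  refine ⟨N, hN, hNM, fun k => ?_⟩
  obtain ⟨K, hK, h⟩ := hGD k
  refine ⟨K * C, by positivity, fun i => (h i).trans ?_⟩
  rw [mul_assoc]
  exact mul_le_mul_of_nonneg_left (hDN _) hK

/-- Every element of `𝒦^{[M]}` belongs to a class defined by one weight and one step. -/
theorem RegularWeight.exists_kSpaceH_of_kSpace {t : UltraType} (hM : RegularWeight M)
    {φ : EuclideanSpace ℝ (Fin d) → ℂ} (hφ : φ ∈ KSpace t M d) :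
    ∃ N, RegularWeight N ∧ WeightBelow t M N ∧ ∃ h : ℝ, 0 < h ∧ φ ∈ KSpaceH N h d := by
  cases t with
  | roumieu =>
    obtain ⟨h, hh, hφ⟩ := hφ
    exact ⟨M, hM, weightBelow_roumieu_self M, h, hh, hφ⟩
  | beurling =>
    have hφ' : ∀ h : ℝ, 0 < h → φ ∈ KSpaceH M h d := hφ
    obtain ⟨N, hN, hNM, hC⟩ := hM.exists_weightBelow_of_forall
      (ι := (Fin d → ℕ) × EuclideanSpace ℝ (Fin d)) (len := fun i => multiLength i.1)
      -- One family for each exponential weight, indexed by `(α, x)`, so that the same `N` works for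
      -- all rates of decay.
      (G := fun k i => ‖multiDeriv i.1 φ i.2‖ * Real.exp (k * ‖i.2‖)) (by
        intro k s hs
        obtain ⟨C, hC⟩ := (hφ' s⁻¹ (by positivity)).2 k
        refine ⟨C, fun i => ?_⟩
        have h1 := hC i.1 i.2
        rw [div_le_iff₀ (hM.pos _), inv_pow, mul_assoc, inv_mul_le_iff₀ (by positivity)] at h1
        exact h1.trans (le_of_eq (by ring)))
    refine ⟨N, hN, hNM, 1, one_pos, (hφ' 1 one_pos).1, fun n => ?_⟩
    obtain ⟨C, hC0, hC⟩ := hC n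
    refine ⟨C, fun α x => ?_⟩
    rw [div_le_iff₀ (hN.pos _), one_pow, one_mul]
    exact hC (α, x)

theorem isRSequence_max_one : IsRSequence fun j : ℕ => max 1 (j : ℝ) where
  pos j := lt_of_lt_of_le one_pos (le_max_left _ _)
  zero := by simp
  one := by simp
  mono i j h := max_le_max le_rfl (by exact_mod_cast h)
  tendsto := tendsto_atTop_mono (fun j => le_max_right _ _) tendsto_natCast_atTop_atTop

theorem RegularWeight.exists_geometric_bound_of_forall (hM : ∀ n, 0 < M n) {ι : Type*}
    {len : ι → ℕ} {G : ι → ℝ} (hG : ∀ r, IsRSequence r →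
      ∃ C, ∀ i, G i / (M (len i) * ∏ j ∈ Finset.range (len i + 1), r j) ≤ C) :
    ∃ C A : ℝ, 0 ≤ C ∧ 0 ≤ A ∧ ∀ i, G i ≤ C * (A ^ len i * M (len i)) := by
  have hG' : ∀ r, IsRSequence r → ∃ C, 0 ≤ C ∧
      ∀ i, G i / M (len i) ≤ C * ∏ j ∈ Finset.range (len i + 1), r j := by
    intro r hr
    obtain ⟨C, hC⟩ := hG r hr
    have hpr : ∀ n, 0 < ∏ j ∈ Finset.range n, r j := fun n => Finset.prod_pos fun j _ => hr.pos j
    refine ⟨max C 0, le_max_right _ _, fun i => ?_⟩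
    have h1 := hC i
    rw [← div_div, div_le_iff₀ (hpr _)] at h1
    exact h1.trans (mul_le_mul_of_nonneg_right (le_max_left _ _) (hpr _).le)
  have hb : ∀ n, BddAbove (Set.range fun i : {i // len i = n} => G i / M (len i)) := by
    intro n
    -- Any sequence of `ℜ` would do. It only shows that the suprema over indices of a given length
    -- are finite.
    obtain ⟨C, _, hC⟩ := hG' _ isRSequence_max_one
    refine ⟨C * ∏ j ∈ Finset.range (n + 1), max 1 (j : ℝ), ?_⟩
    rintro _ ⟨⟨i, rfl⟩, rfl⟩
    exact hC i
  obtain ⟨C, A, hC, hA, h⟩ := exists_geometric_bound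
    (a := fun n => ⨆ i : {i // len i = n}, G i / M (len i)) (by
      intro r hr
      obtain ⟨C, hC0, hC⟩ := hG' r hr
      refine ⟨C, fun n => Real.iSup_le ?_ ?_⟩
      · rintro ⟨i, rfl⟩
        exact hC i
      · exact mul_nonneg hC0 (Finset.prod_nonneg fun j _ => (hr.pos j).le))
  refine ⟨C, A, hC.le, by linarith, fun i => ?_⟩
  have h1 : G i / M (len i) ≤ C * A ^ len i :=
    (le_ciSup (hb (len i)) ⟨i, rfl⟩).trans (h (len i))
  rw [div_le_iff₀ (hM _)] at h1
  linarith

/-- The derivatives at the origin of the elements of a bounded set satisfy estimates of one type. -/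
theorem RegularWeight.exists_weightBelow_of_isBounded {t : UltraType} (hM : RegularWeight M)
    {F : Type*} [NormedAddCommGroup F] [NormedSpace ℂ F] {𝓑 : Set (EuclideanSpace ℝ (Fin d) → F)}
    (h𝓑 : IsBoundedInUltra t M 𝓑) : ∃ N, RegularWeight N ∧ WeightBelow t M N ∧
      ∃ C A : ℝ, 0 ≤ C ∧ 0 ≤ A ∧ ∀ f ∈ 𝓑, ∀ α,
        ‖multiDeriv α f 0‖ ≤ C * (A ^ multiLength α * N (multiLength α)) := by
  have hp : Continuous (normSeminorm ℂ F) := continuous_norm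
  cases t with
  | roumieu =>
    obtain ⟨C, A, hC, hA, h⟩ := RegularWeight.exists_geometric_bound_of_forall hM.pos
      (ι := 𝓑 × (Fin d → ℕ)) (len := fun i => multiLength i.2)
      (G := fun i => ‖multiDeriv i.2 i.1.1 0‖) (by
        intro r hr
        obtain ⟨C, hC⟩ := h𝓑.2 {0} isCompact_singleton r hr _ hp
        exact ⟨C, fun i => hC i.1.1 i.1.2 i.2 0 rfl⟩)
    exact ⟨M, hM, weightBelow_roumieu_self M, C, A, hC, hA, fun f hf α => h (⟨f, hf⟩, α)⟩
  | beurling =>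
    obtain ⟨N, hN, hNM, h⟩ := hM.exists_weightBelow_of_forall
      (ι := 𝓑 × (Fin d → ℕ)) (len := fun i => multiLength i.2)
      (G := fun _ i => ‖multiDeriv i.2 i.1.1 0‖) (by
        intro k s hs
        obtain ⟨C, hC⟩ := h𝓑.2 {0} isCompact_singleton s⁻¹ (by positivity) _ hp
        refine ⟨C, fun i => ?_⟩
        have h1 := hC i.1.1 i.1.2 i.2 0 rfl
        rw [div_le_iff₀ (hM.pos _), inv_pow, inv_mul_le_iff₀ (by positivity)] at h1
        exact h1.trans (le_of_eq (by ring)))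
    obtain ⟨C, hC, h⟩ := h 0
    refine ⟨N, hN, hNM, C, 1, hC, zero_le_one, fun f hf α => ?_⟩
    rw [one_pow, one_mul]
    exact h (⟨f, hf⟩, α)

end WeightBelow

/-! ### Ultradifferentiable vectors and jets -/

section Compose

variable {d : ℕ} {G G' : Type*} [NormedAddCommGroup G] [NormedSpace ℝ G] [NormedAddCommGroup G']
  [NormedSpace ℝ G']

theorem IsPartialFamily.clm_comp {F : (Fin d → ℕ) → EuclideanSpace ℝ (Fin d) → G}
    (hF : IsPartialFamily F) (L : G →L[ℝ] G') : IsPartialFamily fun α x => L (F α x) where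
  continuous α := L.continuous.comp (hF.continuous α)
  hasLineDerivAt α i x := by
    have := L.hasFDerivAt.comp_hasDerivAt (0 : ℝ) (hF.hasLineDerivAt α i x)
    exact this

theorem norm_gradMap_le (g : Fin d → G) : ‖gradMap g‖ ≤ ∑ i, ‖g i‖ := by
  refine ContinuousLinearMap.opNorm_le_bound _ (Finset.sum_nonneg fun _ _ => norm_nonneg _)
    fun h => ?_
  rw [gradMap_apply, Finset.sum_mul]
  refine norm_sum_le_of_le _ fun i _ => ?_
  rw [norm_smul, mul_comm]
  exact mul_le_mul_of_nonneg_left (PiLp.norm_apply_le h i) (norm_nonneg _)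

theorem IsPartialFamily.norm_sub_le {F : (Fin d → ℕ) → EuclideanSpace ℝ (Fin d) → G}
    (hF : IsPartialFamily F) (α : Fin d → ℕ) {x y : EuclideanSpace ℝ (Fin d)} {M : Fin d → ℝ}
    (hM : ∀ i, ∀ z ∈ Metric.ball x 1, ‖F (α + Pi.single i 1) z‖ ≤ M i)
    (hy : y ∈ Metric.ball x 1) : ‖F α y - F α x‖ ≤ (∑ i, M i) * ‖y - x‖ :=
  (convex_ball x 1).norm_image_sub_le_of_norm_hasFDerivWithin_le
    (fun z _ => (hF.hasFDerivAt α z).hasFDerivWithinAt)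
    (fun z hz => (norm_gradMap_le _).trans (Finset.sum_le_sum fun i _ => hM i z hz))
    (Metric.mem_ball_self one_pos) hy

theorem exists_eq_add_single {α : Fin d → ℕ} {n : ℕ} (h : multiLength α = n + 1) :
    ∃ β i, α = β + Pi.single i 1 ∧ multiLength β = n := by
  have : ∃ i, α i ≠ 0 := by
    by_contra hcon
    push Not at hcon
    simp [multiLength, hcon] at h
  obtain ⟨i, hi⟩ := this
  have hα : α = (α - Pi.single i 1) + Pi.single i 1 := by
    funext j
    by_cases hj : j = i
    · subst hj
      simp
      omega
    · simp [hj]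
  refine ⟨α - Pi.single i 1, i, hα, ?_⟩
  rw [hα, multiLength_add_single] at h
  omega

end Compose

/-! ### Passage between ultradifferentiable orbits and bounded jets -/

section Vectors

variable {d : ℕ} {E : Type*} [AddCommGroup E] [Module ℂ E] [TopologicalSpace E]
  [IsTopologicalAddGroup E] [ContinuousSMul ℂ E] [LocallyConvexSpace ℝ E] [T2Space E]
  {π : Representation d E}

theorem BoundedDisk.isPartialFamily_dual {B : BoundedDisk E}
    {F : (Fin d → ℕ) → EuclideanSpace ℝ (Fin d) → B.Space} (hF : IsPartialFamily F)
    (ℓ : E →L[ℂ] ℂ) : IsPartialFamily fun α x => ℓ (F α x).val :=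
  hF.clm_comp ((B.restrictDual ℓ).restrictScalars ℝ)

/-- For the orbit itself this is the group law. Differentiating the identity weakly in `y`
propagates it to all `α`, by induction on `|α|`; the inclusion of `E_B` into `E` is continuous. -/
theorem Representation.orbit_val_eq {B : BoundedDisk E}
    {F : (Fin d → ℕ) → EuclideanSpace ℝ (Fin d) → B.Space} (hF : IsPartialFamily F) {e : E}
    (h0 : ∀ x, (F 0 x).val = π.orbit e x) (α : Fin d → ℕ) (x y : EuclideanSpace ℝ (Fin d)) :
    π.orbit (F α y).val x = (F α (x + y)).val := by
  obtain ⟨n, hn⟩ : ∃ n, multiLength α = n := ⟨_, rfl⟩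
  induction n generalizing α y with
  | zero =>
    have : α = 0 := by
      funext i
      have := (Finset.sum_eq_zero_iff.1 hn) i (Finset.mem_univ i)
      simpa using this
    subst this
    rw [h0, h0, π.orbit_orbit]
  | succ n ih =>
    obtain ⟨β, i, rfl, hβ⟩ := exists_eq_add_single hn
    refine eq_of_forall_dual_eq fun ℓ => ?_
    have h1 := (BoundedDisk.isPartialFamily_dual hF (ℓ.comp (π.act x))).hasLineDerivAt β i y
    have h2 := (BoundedDisk.isPartialFamily_dual hF ℓ).hasLineDerivAt β i (x + y)
    refine HasDerivAt.unique h1 (HasDerivAt.congr_of_eventuallyEq h2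
      (Eventually.of_forall fun t => ?_))
    simp only [ContinuousLinearMap.comp_apply, Representation.act_apply]
    rw [ih β _ hβ, add_assoc]

theorem Representation.isJet_of_isPartialFamily {B : BoundedDisk E}
    {F : (Fin d → ℕ) → EuclideanSpace ℝ (Fin d) → B.Space} (hF : IsPartialFamily F) {e : E}
    (h0 : ∀ x, (F 0 x).val = π.orbit e x) : π.IsJet fun α => (F α 0).val := by
  intro ℓ
  have := BoundedDisk.isPartialFamily_dual hF ℓ
  simpa only [Representation.orbit_val_eq hF h0, add_zero] using this

variable {M N : ℕ → ℝ} {t : UltraType}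

/-- The elements of a bounded set of ultradifferentiable vectors have jets with uniform bounds. -/
theorem Representation.IsBoundedUltra.exists_jetBound (hπ : π.HasExpGrowth) (hM : RegularWeight M)
    {S : Set E} (hS : π.IsBoundedUltra t M S) : ∃ N, RegularWeight N ∧ WeightBelow t M N ∧
      ∃ (c : S → (Fin d → ℕ) → E) (A : ℝ), 0 ≤ A ∧ π.JetBound N c A ∧ ∀ e, c e 0 = e := by
  obtain ⟨B, hf, hb⟩ := hS
  choose! f hf using hf
  obtain ⟨N, hN, hNM, C, A, hC, hA, h⟩ := hM.exists_weightBelow_of_isBounded hb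
  have hmem : ∀ e : S, f e ∈ π.orbitsIn B S := fun e => ⟨e, e.2, hf e e.2⟩
  have hF : ∀ e : S, IsPartialFamily fun α => multiDeriv α (f e) := fun e =>
    isPartialFamily_multiDeriv (hb.1 _ (hmem e))
  have h0 : ∀ (e : S) x, (multiDeriv 0 (f e) x).val = π.orbit e x := fun e x => by
    rw [multiDeriv_zero, hf e e.2]
  refine ⟨N, hN, hNM, fun e α => (multiDeriv α (f e) 0).val, A, hA,
    ⟨fun e => isJet_of_isPartialFamily (hF e) (h0 e), fun p hp => ?_⟩, fun e => ?_⟩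
  -- Estimates at the origin suffice, since `π(x)` carries the derivatives to the point `x` with at
  -- most exponential growth.
  · obtain ⟨K, κ, hK, hκ, hp⟩ := hπ B p hp
    refine ⟨K * C, κ, by positivity, hκ, fun e α x => (hp x _).trans ?_⟩
    calc _ ≤ K * Real.exp (κ * ‖x‖) * (C * (A ^ multiLength α * N (multiLength α))) := by
          gcongr
          exact h _ (hmem e) α
      _ = _ := by ring
  · exact (h0 e 0).trans (π.orbit_zero _)

theorem exp_mul_sub_sq_le (κ r : ℝ) : Real.exp (κ * r) * Real.exp (-r ^ 2) ≤ Real.exp (κ ^ 2) := by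
  rw [← Real.exp_add, Real.exp_le_exp]
  nlinarith [sq_nonneg (κ - r), sq_nonneg κ, sq_nonneg r]

theorem Representation.JetBound.mono (hN : ∀ n, 0 < N n) {ι : Type*} {c : ι → (Fin d → ℕ) → E}
    {A A' : ℝ} (hA : 0 ≤ A) (hAA' : A ≤ A') (hc : π.JetBound N c A) : π.JetBound N c A' where
  jet := hc.jet
  bound p hp := by
    obtain ⟨C, κ, hC, hκ, h⟩ := hc.bound p hp
    refine ⟨C, κ, hC, hκ, fun i α x => (h i α x).trans ?_⟩
    have := hN (multiLength α)
    gcongr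

/-- Jets with uniform bounds are realized by mappings into the normed space of one disk. -/
theorem Representation.JetBound.exists_disk (hN : ∀ n, 0 < N n) {ι : Type*}
    {c : ι → (Fin d → ℕ) → E} {A : ℝ} (hA : 0 < A) (hc : π.JetBound N c A) :
    ∃ (B : BoundedDisk E) (F : ι → (Fin d → ℕ) → EuclideanSpace ℝ (Fin d) → B.Space),
      (∀ i, IsPartialFamily (F i)) ∧ (∀ i α x, (F i α x).val = π.orbit (c i α) x) ∧
      ∀ i α x, ‖F i α x‖ ≤ Real.exp (‖x‖ ^ 2) * (A ^ multiLength α * N (multiLength α)) := by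
  let w : (Fin d → ℕ) → ℝ := fun α => A ^ multiLength α * N (multiLength α)
  have hw : ∀ α, 0 < w α := fun α => mul_pos (pow_pos hA _) (hN _)
  -- The rate `κ` depends on the seminorm. The Gaussian weight dominates every `exp(κ‖x‖)`, so the
  -- normalized values form one bounded set for all seminorms.
  let g : (Fin d → ℕ) → EuclideanSpace ℝ (Fin d) → ℝ := fun α x => Real.exp (‖x‖ ^ 2) * w α
  have hg : ∀ α x, 0 < g α x := fun α x => mul_pos (Real.exp_pos _) (hw α)
  obtain ⟨B, hB⟩ := exists_boundedDisk
    (Z := {z | ∃ i α x, z = (((g α x)⁻¹ : ℝ) : ℂ) • π.orbit (c i α) x}) (by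
      intro p hp
      obtain ⟨C, κ, hC, hκ, h⟩ := hc.bound p hp
      refine ⟨C * Real.exp (κ ^ 2), ?_⟩
      rintro _ ⟨i, α, x, rfl⟩
      rw [map_smul_eq_mul, Complex.norm_real, Real.norm_of_nonneg (inv_nonneg.2 (hg α x).le),
        inv_mul_le_iff₀ (hg α x)]
      refine (h i α x).trans ?_
      have h1 := exp_mul_sub_sq_le κ ‖x‖
      rw [Real.exp_neg, ← div_eq_mul_inv, div_le_iff₀ (Real.exp_pos _)] at h1
      calc C * Real.exp (κ * ‖x‖) * w α
          ≤ C * (Real.exp (κ ^ 2) * Real.exp (‖x‖ ^ 2)) * w α := by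
            have := (hw α).le
            gcongr
        _ = g α x * (C * Real.exp (κ ^ 2)) := by simp only [g]; ring)
  have hmem : ∀ i α x, π.orbit (c i α) x ∈ (g α x) • B.carrier := by
    intro i α x
    refine ⟨_, hB ⟨i, α, x, rfl⟩, ?_⟩
    change g α x • _ = _
    rw [Complex.coe_smul, smul_smul, mul_inv_cancel₀ (hg α x).ne', one_smul]
  let F : ι → (Fin d → ℕ) → EuclideanSpace ℝ (Fin d) → B.Space := fun i α x =>
    BoundedDisk.toSpace (π.orbit (c i α) x) (BoundedDisk.smul_mem_span (hmem i α x))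
  have hFn : ∀ i α x, ‖F i α x‖ ≤ g α x := fun i α x =>
    BoundedDisk.norm_le_of_mem_smul (hg α x).le _ (hmem i α x)
  -- A bound common to all functionals in the polar of `B`. It makes the Lipschitz and Taylor
  -- estimates below uniform in `ℓ`, hence valid for the norm of `E_B`.
  have hℓ : ∀ ℓ : E →L[ℂ] ℂ, (∀ b ∈ B.carrier, ‖ℓ b‖ ≤ 1) → ∀ i α x {r : ℝ}, ‖x‖ ≤ r →
      ‖ℓ (π.orbit (c i α) x)‖ ≤ Real.exp (r ^ 2) * w α := by
    intro ℓ hℓ i α x r hr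
    have h1 := BoundedDisk.seminorm_le (p := dualSeminorm ℓ) hℓ (F i α x)
    rw [one_mul] at h1
    refine (h1.trans (hFn i α x)).trans ?_
    have := (hw α).le
    simp only [g]
    gcongr
  have hball : ∀ {x z : EuclideanSpace ℝ (Fin d)}, z ∈ Metric.ball x 1 → ‖z‖ ≤ ‖x‖ + 1 := by
    intro x z hz
    rw [mem_ball_iff_norm] at hz
    have := norm_add_le x (z - x)
    rw [add_sub_cancel] at this
    linarith
  refine ⟨B, F, fun i => ⟨fun α => ?_, fun α j x => ?_⟩, fun i α x => rfl, hFn⟩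
  · rw [continuous_iff_continuousAt]
    intro x
    rw [ContinuousAt, tendsto_iff_norm_sub_tendsto_zero]
    let K : ℝ := ∑ j, Real.exp ((‖x‖ + 1) ^ 2) * w (α + Pi.single j 1)
    have hK : 0 ≤ K := Finset.sum_nonneg fun j _ => mul_nonneg (Real.exp_pos _).le (hw _).le
    have hlim : Tendsto (fun y => K * ‖y - x‖) (𝓝 x) (𝓝 0) := by
      have : Continuous fun y : EuclideanSpace ℝ (Fin d) => K * ‖y - x‖ := by fun_prop
      simpa using this.tendsto x
    refine squeeze_zero' (Eventually.of_forall fun y => norm_nonneg _) ?_ hlim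
    filter_upwards [Metric.ball_mem_nhds x one_pos] with y hy
    refine BoundedDisk.norm_le_of_dual _ (mul_nonneg hK (norm_nonneg _)) fun ℓ h1 => ?_
    rw [BoundedDisk.val_sub, map_sub]
    exact (hc.jet i ℓ).norm_sub_le α (fun j z hz => hℓ ℓ h1 i _ z (hball hz)) hy
  · refine hasLineDerivAt_of_taylor (M := Real.exp ((‖x‖ + 1) ^ 2) * w (α + Pi.single j 2))
      fun s hs => ?_
    refine BoundedDisk.norm_le_of_dual _
      (mul_nonneg (mul_nonneg (Real.exp_pos _).le (hw _).le) (sq_nonneg s)) fun ℓ h1 => ?_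
    have h2 := (hc.jet i ℓ).norm_taylor_le α j x (t := s) fun r hr =>
      hℓ ℓ h1 i (α + Pi.single j 2) _ (norm_add_smul_stdVec_le x j (hr.trans hs))
    refine le_trans (le_of_eq ?_) h2
    congr 1
    rw [← Complex.coe_smul, ← Complex.coe_smul, BoundedDisk.val_sub, BoundedDisk.val_sub,
      BoundedDisk.val_smul, map_sub, map_sub, map_smul]
    rfl

/-- The values of jets with uniform bounds form a bounded set of ultradifferentiable vectors. -/
theorem Representation.JetBound.isBoundedUltra (hM : RegularWeight M) (hN : ∀ n, 0 < N n)
    (hNM : WeightBelow t M N) {ι : Type*} {c : ι → (Fin d → ℕ) → E} {A : ℝ} (hA : 0 ≤ A)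
    (hc : π.JetBound N c A) : π.IsBoundedUltra t M (Set.range fun i => c i 0) := by
  have hA1 : 0 < A + 1 := by positivity
  obtain ⟨B, F, hF, hFo, hFn⟩ := (hc.mono hN hA (by linarith : A ≤ A + 1)).exists_disk hN hA1
  -- A vector has at most one orbit mapping into `E_B`, since the inclusion into `E` is injective.
  have hmem : ∀ f ∈ π.orbitsIn B (Set.range fun i => c i 0), ∃ i, f = F i 0 := by
    rintro f ⟨_, ⟨i, rfl⟩, hf⟩
    exact ⟨i, funext fun x => BoundedDisk.val_injective ((hf x).trans (hFo i 0 x).symm)⟩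
  have hbd : ∀ K : Set (EuclideanSpace ℝ (Fin d)), IsCompact K → ∀ p : Seminorm ℂ B.Space,
      Continuous p → ∃ D : ℝ, 0 ≤ D ∧ ∀ i α, ∀ x ∈ K, p (multiDeriv α (F i 0) x) ≤
        D * ((A + 1) ^ multiLength α * N (multiLength α)) := by
    intro K hK p hp
    obtain ⟨C, hC, hpC⟩ := Seminorm.bound_of_continuous_normedSpace p hp
    obtain ⟨R, hR⟩ := hK.isBounded.exists_norm_le
    refine ⟨C * Real.exp (R ^ 2), by positivity, fun i α x hx => ?_⟩
    rw [(hF i).multiDeriv_eq]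
    refine (hpC _).trans ?_
    rw [mul_assoc]
    refine mul_le_mul_of_nonneg_left ((hFn i α x).trans ?_) hC.le
    have := hN (multiLength α)
    have := hR x hx
    gcongr
  refine ⟨B, ?_, ?_, ?_⟩
  · rintro _ ⟨i, rfl⟩
    exact ⟨F i 0, hFo i 0⟩
  · intro f hf
    obtain ⟨i, rfl⟩ := hmem f hf
    exact (hF i).contDiff 0
  cases t with
  | beurling =>
    intro K hK h hh p hp
    obtain ⟨D, hD, hb⟩ := hbd K hK p hp
    obtain ⟨C, hC, hCN⟩ := hNM (h * (A + 1))⁻¹ (by positivity)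
    refine ⟨D * C, fun f hf α x hx => ?_⟩
    obtain ⟨i, rfl⟩ := hmem f hf
    rw [div_le_iff₀ (hM.pos _)]
    calc _ ≤ h ^ multiLength α * (D * ((A + 1) ^ multiLength α *
          (C * ((h * (A + 1))⁻¹) ^ multiLength α * M (multiLength α)))) := by
          refine mul_le_mul_of_nonneg_left ((hb i α x hx).trans ?_) (by positivity)
          gcongr
          exact hCN _
      _ = D * C * M (multiLength α) := by
          rw [inv_pow, mul_pow]
          field_simp
  | roumieu =>
    intro K hK r hr p hp
    obtain ⟨D, hD, hb⟩ := hbd K hK p hp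
    obtain ⟨s, hs, C, hC, hCN⟩ := hNM
    have hsA : 0 ≤ s * (A + 1) := by positivity
    -- The products of a sequence of `ℜ` beat every geometric sequence. The index is shifted because
    -- `r 0 = 1` contributes nothing.
    obtain ⟨R, hR, hRn⟩ := pow_le_prod_of_tendsto (r := fun j => r (j + 1)) (fun j => hr.pos _)
      ((tendsto_add_atTop_iff_nat 1).2 hr.tendsto) hsA
    refine ⟨D * C * R, fun f hf α x hx => ?_⟩
    obtain ⟨i, rfl⟩ := hmem f hf
    have hpr : 0 < ∏ j ∈ Finset.range (multiLength α + 1), r j :=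
      Finset.prod_pos fun j _ => hr.pos j
    have hMα := hM.pos (multiLength α)
    have h1 : (s * (A + 1)) ^ multiLength α ≤
        R * ∏ j ∈ Finset.range (multiLength α + 1), r j := by
      rw [Finset.prod_range_succ', hr.zero, mul_one]
      exact hRn _
    rw [div_le_iff₀ (by positivity)]
    calc _ ≤ D * ((A + 1) ^ multiLength α * (C * s ^ multiLength α * M (multiLength α))) := by
          refine (hb i α x hx).trans ?_
          gcongr
          exact hCN _
      _ = D * C * M (multiLength α) * (s * (A + 1)) ^ multiLength α := by
          rw [mul_pow]; ring
      _ ≤ D * C * M (multiLength α) *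
          (R * ∏ j ∈ Finset.range (multiLength α + 1), r j) := by gcongr
      _ = _ := by ring

theorem Representation.IsBoundedUltra.subset_ultraVectors {S : Set E}
    (hS : π.IsBoundedUltra t M S) : S ⊆ π.ultraVectors t M := by
  intro e he
  obtain ⟨B, hf, hb⟩ := hS
  obtain ⟨f, hf⟩ := hf e he
  have hfm : f ∈ π.orbitsIn B S := ⟨e, he, hf⟩
  refine ⟨B, f, ⟨?_, ?_⟩, hf⟩
  · rintro _ rfl
    exact hb.1 _ hfm
  · cases t with
    | beurling =>
      intro K hK h hh p hp
      obtain ⟨C, hC⟩ := hb.2 K hK h hh p hp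
      refine ⟨C, ?_⟩
      rintro _ rfl
      exact hC _ hfm
    | roumieu =>
      intro K hK r hr p hp
      obtain ⟨C, hC⟩ := hb.2 K hK r hr p hp
      refine ⟨C, ?_⟩
      rintro _ rfl
      exact hC _ hfm

theorem Representation.isBoundedUltra_singleton {e : E} (he : e ∈ π.ultraVectors t M) :
    π.IsBoundedUltra t M {e} := by
  obtain ⟨B, f, hf, hfe⟩ := he
  refine ⟨B, ?_, ?_⟩
  · rintro _ rfl
    exact ⟨f, hfe⟩
  · have : π.orbitsIn B {e} = {f} := by
      ext g
      constructor
      · rintro ⟨_, rfl, hg⟩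
        exact funext fun x => BoundedDisk.val_injective ((hg x).trans (hfe x).symm)
      · rintro rfl
        exact ⟨e, rfl, hfe⟩
    rw [this]
    exact hf

/-- Vectors of the form `Π(φ) e` have jets with bounds. -/
theorem Representation.exists_jetBound_bigPi (hE : IsSequentiallyComplete E)
    (hπ : π.HasExpGrowth) (hN : RegularWeight N) {h : ℝ} (hh : 0 < h)
    {φ : EuclideanSpace ℝ (Fin d) → ℂ} (hφ : φ ∈ KSpaceH N h d) (e : E) :
    ∃ c : (Fin d → ℕ) → E, π.JetBound N (fun _ : Unit => c) h⁻¹ ∧ c 0 = π.bigPi φ e := by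
  have hP := isPartialFamily_multiDeriv hφ.1
  have hbd : ∀ n : ℕ, ∃ C, 0 ≤ C ∧ ∀ α x, ‖multiDeriv α φ x‖ ≤
      C * (h⁻¹ ^ multiLength α * N (multiLength α)) * Real.exp (-(n * ‖x‖)) := by
    intro n
    obtain ⟨C, hC⟩ := hφ.2 n
    refine ⟨max C 0, le_max_right _ _, fun α x => ?_⟩
    have h1 := hC α x
    have hNα := hN.pos (multiLength α)
    rw [div_le_iff₀ hNα] at h1
    rw [Real.exp_neg, ← div_eq_mul_inv, le_div_iff₀ (Real.exp_pos _), inv_pow, ← mul_assoc,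
      ← div_eq_mul_inv, div_mul_eq_mul_div, le_div_iff₀ (by positivity)]
    have h2 : C * N (multiLength α) ≤ max C 0 * N (multiLength α) := by
      gcongr
      exact le_max_left _ _
    linarith
  have hmom : ∀ α, HasExpMoments (multiDeriv α φ) := by
    intro α
    refine hasExpMoments_of_forall_bound (hP.continuous α) fun n => ?_
    obtain ⟨C, _, hC⟩ := hbd n
    refine ⟨C * (h⁻¹ ^ multiLength α * N (multiLength α)), fun x => ?_⟩
    have h1 := hC α x
    rwa [Real.exp_neg, ← div_eq_mul_inv, le_div_iff₀ (Real.exp_pos _)] at h1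
  -- The orbit of `Π(φ)e` at `z` is `∫ φ(y - z) π(y)e dy`. Each derivative in `z` falls on `φ` with
  -- a minus sign.
  let k : (Fin d → ℕ) → EuclideanSpace ℝ (Fin d) → ℂ := fun α x =>
    (-1) ^ multiLength α * multiDeriv α φ x
  have hkn : ∀ α x, ‖k α x‖ = ‖multiDeriv α φ x‖ := fun α x => by simp [k]
  have hk : ∀ α, HasExpMoments (k α) := fun α =>
    ⟨(hmom α).meas.const_mul _, fun κ => by simpa only [hkn] using (hmom α).integrable κ⟩
  have hk0 : k 0 = φ := by
    funext x
    simp [k, multiLength, multiDeriv_zero]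
  have hgr : ∀ p : Seminorm ℂ E, Continuous p → ∃ C κ : ℝ, 0 ≤ C ∧ 0 ≤ κ ∧
      ∀ x, p (π.orbit e x) ≤ C * Real.exp (κ * ‖x‖) := (hπ.orbit e).bound
  refine ⟨fun α => π.bigPi (k α) e, ⟨fun _ => isJet_of_taylor fun ℓ α i x => ?_, fun p hp => ?_⟩,
    by simp only [hk0]⟩
  · obtain ⟨C, κ, hC, hκ, hCκ⟩ := hgr (dualSeminorm ℓ) (continuous_dualSeminorm ℓ)
    let u : EuclideanSpace ℝ (Fin d) → ℂ := fun y => ℓ (π.orbit e y)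
    have hu : Continuous u := ℓ.continuous.comp (π.continuous_orbit e)
    have hshift : ∀ α z, ℓ (π.orbit (π.bigPi (k α) e) z) = ∫ y, k α (y - z) * u y := by
      intro α z
      rw [π.dual_orbit_bigPi hE hπ (hk α)]
      have := integral_sub_right_eq_self (μ := volume) (fun y => k α y * u (z + y)) z
      rw [← this]
      simp [u]
    have hint : ∀ α z, Integrable fun y => k α (y - z) * u y := by
      intro α z
      have h1 : Integrable fun y => k α y * u (z + y) :=
        integrable_mul_of_expBound (hk α).meas ((hk α).integrable κ)
          (hu.comp (continuous_const.add continuous_id)) (C := C * Real.exp (κ * ‖z‖)) fun y => by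
            refine (hCκ _).trans ?_
            rw [mul_assoc, ← Real.exp_add, ← mul_add]
            gcongr
            exact norm_add_le z y
      simpa using h1.comp_sub_right z
    -- Decay of rate `n ≥ κ + 1` pays for the growth of the orbit and leaves an integrable
    -- `exp(-‖y‖)`.
    obtain ⟨n, hn⟩ := exists_nat_ge (κ + 1)
    obtain ⟨D, hD, hDn⟩ := hbd n
    set W := h⁻¹ ^ multiLength (α + Pi.single i 2) * N (multiLength (α + Pi.single i 2)) with hW
    have hW0 : 0 ≤ W := mul_nonneg (by positivity) (hN.pos _).le
    refine ⟨D * W * Real.exp (n * (‖x‖ + 1)) * C * ∫ y : EuclideanSpace ℝ (Fin d),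
      Real.exp (-(1 * ‖y‖)), fun s hs => ?_⟩
    have hint' : Integrable fun y => k α (y - (x + s • stdVec i)) * u y - k α (y - x) * u y :=
      (hint _ _).sub (hint _ _)
    simp only [hshift]
    rw [← integral_sub (hint _ _) (hint _ _), Complex.real_smul, ← integral_const_mul,
      ← integral_sub hint' ((hint _ _).const_mul _)]
    have hpt : ∀ y, ‖k α (y - (x + s • stdVec i)) * u y - k α (y - x) * u y -
        s * (k (α + Pi.single i 1) (y - x) * u y)‖ ≤
        (D * W * Real.exp (n * (‖x‖ + 1)) * C * s ^ 2) * Real.exp (-(1 * ‖y‖)) := by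
      intro y
      have e1 : k α (y - (x + s • stdVec i)) * u y - k α (y - x) * u y -
          s * (k (α + Pi.single i 1) (y - x) * u y) = (-1) ^ multiLength α *
            (multiDeriv α φ (y - x + (-s) • stdVec i) - multiDeriv α φ (y - x) -
              (-s) • multiDeriv (α + Pi.single i 1) φ (y - x)) * u y := by
        have : y - (x + s • stdVec i) = y - x + (-s) • stdVec i := by
          rw [neg_smul]; abel
        simp only [k, multiLength_add_single, this, Complex.real_smul, pow_succ]
        push_cast
        ring
      have h2 := hP.norm_taylor_le α i (y - x) (t := -s)
        (M := D * W * (Real.exp (n * (‖x‖ + 1)) * Real.exp (-(n * ‖y‖)))) fun r hr => by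
          refine (hDn _ _).trans ?_
          rw [← hW, ← Real.exp_add]
          gcongr
          have h3 : ‖y‖ ≤ ‖y - x + r • stdVec i‖ + (‖x‖ + 1) := by
            have h4 := norm_sub_le (y - x + r • stdVec i) (-x + r • stdVec i)
            have h5 := norm_add_smul_stdVec_le (-x) i (hr.trans (by rwa [abs_neg]))
            rw [norm_neg] at h5
            have h6 : y - x + r • stdVec i - (-x + r • stdVec i) = y := by abel
            rw [h6] at h4
            linarith
          have hn0 : (0 : ℝ) ≤ n := Nat.cast_nonneg n
          nlinarith
      rw [e1, norm_mul, norm_mul, norm_pow, norm_neg, norm_one, one_pow, one_mul]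
      have h7 : Real.exp (-(n * ‖y‖)) * Real.exp (κ * ‖y‖) ≤ Real.exp (-(1 * ‖y‖)) := by
        rw [← Real.exp_add, Real.exp_le_exp]
        nlinarith [norm_nonneg y]
      calc _ ≤ D * W * (Real.exp (n * (‖x‖ + 1)) * Real.exp (-(n * ‖y‖))) * (-s) ^ 2 *
            (C * Real.exp (κ * ‖y‖)) := by
            refine mul_le_mul h2 (hCκ y) (norm_nonneg _) (by positivity)
        _ = D * W * Real.exp (n * (‖x‖ + 1)) * C * s ^ 2 *
            (Real.exp (-(n * ‖y‖)) * Real.exp (κ * ‖y‖)) := by ring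
        _ ≤ _ := by gcongr
    refine (norm_integral_le_of_norm_le ((integrable_exp_neg_norm one_pos).const_mul _)
      (Eventually.of_forall hpt)).trans (le_of_eq ?_)
    rw [integral_const_mul]
    ring
  · obtain ⟨C, κ, hC, hκ, hCκ⟩ := hgr p hp
    obtain ⟨n, hn⟩ := exists_nat_ge (κ + 1)
    obtain ⟨D, hD, hDn⟩ := hbd n
    let I := ∫ y : EuclideanSpace ℝ (Fin d), Real.exp (-(1 * ‖y‖))
    have hI : 0 ≤ I := integral_nonneg fun y => (Real.exp_pos _).le
    refine ⟨D * C * I, κ, by positivity, hκ, fun _ α x => seminorm_le_of_dual hp fun ℓ hℓ => ?_⟩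
    rw [π.dual_orbit_bigPi hE hπ (hk α)]
    set W := h⁻¹ ^ multiLength α * N (multiLength α) with hW
    have hW0 : 0 ≤ W := mul_nonneg (by positivity) (hN.pos _).le
    refine (norm_integral_le_of_norm_le ((integrable_exp_neg_norm one_pos).const_mul
      (D * W * C * Real.exp (κ * ‖x‖))) (Eventually.of_forall fun y => ?_)).trans (le_of_eq ?_)
    · rw [norm_mul, hkn]
      have h7 : Real.exp (-(n * ‖y‖)) * Real.exp (κ * ‖y‖) ≤ Real.exp (-(1 * ‖y‖)) := by
        rw [← Real.exp_add, Real.exp_le_exp]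
        nlinarith [norm_nonneg y]
      have h8 : p (π.orbit e (x + y)) ≤ C * (Real.exp (κ * ‖x‖) * Real.exp (κ * ‖y‖)) := by
        refine (hCκ _).trans ?_
        rw [← Real.exp_add, ← mul_add]
        gcongr
        exact norm_add_le x y
      calc _ ≤ (D * W * Real.exp (-(n * ‖y‖))) *
            (C * (Real.exp (κ * ‖x‖) * Real.exp (κ * ‖y‖))) :=
            mul_le_mul (hDn α y) ((hℓ _).trans h8) (norm_nonneg _) (by positivity)
        _ = D * W * C * Real.exp (κ * ‖x‖) *
            (Real.exp (-(n * ‖y‖)) * Real.exp (κ * ‖y‖)) := by ring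
        _ ≤ _ := by gcongr
    · rw [integral_const_mul]
      simp only [I]
      ring

/-- Strong factorization of bounded sets of ultradifferentiable vectors. -/
theorem Representation.IsBoundedUltra.exists_factorization (hE : IsSequentiallyComplete E)
    (hπ : π.HasExpGrowth) (hM : RegularWeight M) {S : Set E} (hS : π.IsBoundedUltra t M S) :
    ∃ ψ ∈ KSpace t M d, ∃ A : Set E, π.IsBoundedUltra t M A ∧ π.bigPi ψ '' A = S := by
  obtain ⟨N, hN, hNM, c, A, hA, hc, hc0⟩ := hS.exists_jetBound hπ hM
  obtain ⟨h, hh, ψ, hψ, a, A', hA', ha, hac⟩ := hc.exists_factorization hE hπ hN hA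
  refine ⟨ψ, hNM.kSpace_of_kSpaceH hM.pos hN.pos hh hψ, Set.range fun i => a i 0,
    ha.isBoundedUltra hM hN.pos hNM hA', ?_⟩
  rw [← Set.range_comp]
  ext e
  constructor
  · rintro ⟨i, rfl⟩
    simp only [Function.comp_apply, hac, hc0]
    exact i.2
  · intro he
    exact ⟨⟨e, he⟩, by simp only [Function.comp_apply, hac, hc0]⟩

theorem Representation.bigPi_mem_ultraVectors (hE : IsSequentiallyComplete E)
    (hπ : π.HasExpGrowth) (hM : RegularWeight M) {φ : EuclideanSpace ℝ (Fin d) → ℂ}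
    (hφ : φ ∈ KSpace t M d) (e : E) : π.bigPi φ e ∈ π.ultraVectors t M := by
  obtain ⟨N, hN, hNM, h, hh, hφ⟩ := hM.exists_kSpaceH_of_kSpace hφ
  obtain ⟨c, hc, hc0⟩ := exists_jetBound_bigPi hE hπ hN hh hφ e
  exact (hc.isBoundedUltra hM hN.pos hNM (by positivity)).subset_ultraVectors ⟨(), hc0⟩

end Vectors

end UltraVectors

theorem theorem3p1 (d : ℕ) (E : Type*) [AddCommGroup E] [Module ℂ E] [TopologicalSpace E]
    [IsTopologicalAddGroup E] [ContinuousSMul ℂ E] [LocallyConvexSpace ℝ E] [T2Space E]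
    (hE : IsSequentiallyComplete E)
    (π : UltraVectors.Representation d E) (hπ : π.IsProjective ∨ π.IsInductive)
    (M : ℕ → ℝ) (hM : IsWeightSequence M) (hM2 : CondM2 M) (hM2' : CondM2Star M)
    (t : UltraType) :
    -- the weak integrals that define `Π(f) e` exist
    (∀ f ∈ CExp d, ∀ e : E, IsWeakIntegral (fun x => f x • π.orbit e x) (π.bigPi f e)) ∧
    Set.image2 π.bigPi (KSpace t M d) Set.univ = π.ultraVectors t M ∧
    Set.image2 π.bigPi (KSpace t M d) (π.ultraVectors t M) = π.ultraVectors t M ∧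
    ∀ S : Set E, π.IsBoundedUltra t M S →
      ∃ ψ ∈ KSpace t M d, ∃ A : Set E, π.IsBoundedUltra t M A ∧ π.bigPi ψ '' A = S := by
  have hM' : RegularWeight M := hM.regularWeight hM2 hM2'
  have hπ' : π.HasExpGrowth := Representation.hasExpGrowth hπ
  have h1 : Set.image2 π.bigPi (KSpace t M d) Set.univ ⊆ π.ultraVectors t M := by
    rintro _ ⟨φ, hφ, e, -, rfl⟩
    exact Representation.bigPi_mem_ultraVectors hE hπ' hM' hφ e
  -- Factorization of a single vector is the strong factorization of the bounded set `{e}`.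
  have h2 : π.ultraVectors t M ⊆ Set.image2 π.bigPi (KSpace t M d) (π.ultraVectors t M) := by
    intro e he
    obtain ⟨ψ, hψ, A, hA, hAe⟩ :=
      (Representation.isBoundedUltra_singleton he).exists_factorization hE hπ' hM'
    obtain ⟨a, ha, hae⟩ : e ∈ π.bigPi ψ '' A := by rw [hAe]; rfl
    exact ⟨ψ, hψ, a, hA.subset_ultraVectors ha, hae⟩
  have h3 : Set.image2 π.bigPi (KSpace t M d) (π.ultraVectors t M) ⊆
      Set.image2 π.bigPi (KSpace t M d) Set.univ :=
    Set.image2_subset_left (Set.subset_univ _)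
  exact ⟨fun f hf e => π.isWeakIntegral_bigPi hE hπ' (CExp.hasExpMoments hf) e,
    h1.antisymm (h2.trans h3), (h3.trans h1).antisymm h2,
    fun S hS => hS.exists_factorization hE hπ' hM'⟩
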